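/- **Setting.** Let $f\in SL(2,\mathbb Z)$ have two distinct positive real eigenvalues, and let the cyclic word $w=w_0\cdots w_{m-1}$ in the letters $\mathcal R,\mathcal L$ be a flip sequence of $f$, i.e. $f$ is conjugate in $SL(2,\mathbb Z)$ to the product $[w_0]\cdots[w_{m-1}]$, where $[\mathcal R]=\begin{pmatrix}1&1\\0&1\end{pmatrix}$, $[\mathcal L]=\begin{pmatrix}1&0\\1&1\end{pmatrix}$. Indices are taken modulo $m$. *CR space.* $\overline{\mathcal H}=(\mathbb C\times\mathbb R)\cup\{\infty\}$ is identified with the null lines of the Hermitian form $\langle z,w\rangle=\bar w^tJz$, $J$ the antidiagonal matrix with entries $1,1,1$, by $(z,t)\mapsto[\frac{it-|z|^2}2,z,1]$, $\infty\mapsto[1,0,0]$; $PU(2,1)$ acts on it. For $P\ne Q$ with null vectors $p,q$, the oriented edge $[P,Q]$ is the segment $\{p+is\langle p,q\rangle q : s>0\}\cup\{P,Q\}$ of the $\mathbb C$-circle through $P,Q$; $[P^+,Q,R]$ (resp. $[P^-,Q,R]$) is the union of the edges $[P,X]$ (resp. $[X,P]$), $X\in[Q,R]$. Let $\omega=-\frac12(1+i\sqrt3)$,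 $P_1=(1,\sqrt3)$, $P_2=(-\omega,\sqrt3)$, $P_3=(0,0)$, $P_4=\infty$. The tetrahedron $\mathfrak T_A$ (resp. $\mathfrak T_B$) is the closed ball in the upper half of $\overline{\mathcal H}$ bounded by $[P_4^-,P_1,P_2]$, $[P_4^-,P_3,P_1]$, $[P_4^-,P_3,P_2]$ and $[P_2^-,P_3,P_1]$ (resp. $[P_3^+,P_1,P_2]$). The slab $\mathfrak S_k$, $k\in\mathbb Z$, is the closed ball containing $(2,\sqrt3)$ bounded by $[P_4^\pm,P_1,P_2]$ and by the vertical half-planes $B'$ over $1+\mathbb R_{\ge0}e^{-i\pi/6}$ and $B_k$ over $-\omega+\mathbb R_{\ge0}e^{i\pi(1-2k)/6}$ (each with $\infty$). Let $$G_1=\begin{bmatrix}-\omega&0&0\\1&1&0\\-\bar\omega&\omega&-\omega\end{bmatrix},\; G_2=\begin{bmatrix}1&1&\omega\\0&-\bar\omega&\bar\omega\\0&0&1\end{bmatrix},\; G_3=\begin{bmatrix}1&0&0\\0&-\omega&0\\0&0&1\end{bmatrix},\; G_4=\begin{bmatrix}0&0&-\omega\\0&-\bar\omega&0\\-\omega&0&1-\bar\omega\end{bmatrix}.$$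 *The cell decomposition $\mathcal D_f$ and its geometric realisation.* For each $j$ there is an ideal tetrahedron $\hat\sigma_j$ with vertices $1,2,3,4$, realised (with vertex $i$ at $P_i$) by $\mathfrak T_B$ if $w_{j-1}=\mathcal R$ and by $\mathfrak T_A$ if $w_{j-1}=\mathcal L$. For each $j$ with $w_j=\mathcal R$ there is moreover an ideal slab $\hat\sigma^S_j$ with vertices $1,2,4$ and edges $12,14,24,41,42$, realised by $\mathfrak S_{k_j}$ with vertices at $P_1,P_2,P_4$ and with $14,24,41,42$ at $[P_1,P_4],[P_2,P_4],[P_4,P_1],[P_4,P_2]$; here $k_j+4$ is the valence of the edge of $\mathcal D_f$ represented by $\hat\sigma^S_j(24)$. The face pairings and their realisations are: - if $w_j=\mathcal L$: $\hat\sigma_j(134)\to\hat\sigma_{j+1}(132)$ by $G_1$, and $\hat\sigma_j(124)\to\hat\sigma_{j+1}(324)$ by $G_2$; - if $w_j=\mathcal R$: $\hat\sigma_j(134)\to\hat\sigma_{j+1}(234)$ by $G_3$; $\hat\sigma_j(124)\to$ the face of $\hat\sigma^S_j$ with edges $12,14,24$ by the identity; the face of $\hat\sigma_j^S$ with edges $12,41,42$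 $\to\hat\sigma_{j+1}(123)$ by $G_4$; and the bigon of $\hat\sigma^S_j$ with edges $14,41$ $\to$ the bigon of $\hat\sigma^S_{j+r+1}$ with edges $24,42$ by $G_2^{r}G_3$, where $r\ge 0$ is the number of letters $\mathcal L$ between $w_j$ and the next letter $\mathcal R$ of the cyclic word. Gluing the realised cells, without their vertices, along these pairings gives the once-punctured torus bundle $M_f$. Let $\hat\pi$ be the quotient map. The *valence* of an edge of $\mathcal D_f$ is the number of edges of $3$-cells that $\hat\pi$ maps to it. The charts of the branched CR structure on $M_f$ are continuous maps $\varphi:U\to\overline{\mathcal H}$, $U\subset M_f$ open, which on every $3$-cell agree locally with an element of $PU(2,1)$ applied to the realisation of the cell. The *ramification order* around an edge $e$ is the integer $N\ge1$ such that every point of $e$ has an open neighbourhood $U$ with a chart $\varphi$ which, in suitable topological coordinates on $U$ and on $\overline{\mathcal H}$, is the branching map $(z,t)\mapsto(z^N,t)$, with $e\cap U$ being the set $z=0$. **Lemma.** For every $j$ with $w_j=\mathcal R$, the valence of the edge $e_j=\hat\pi(\hat\sigma^S_j(41))$ of $\mathcal D_f$ is of the form $n_j+4$ with an integer $n_j\ge0$,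 and the ramification order around $e_j$ of the branched CR structure on $M_f$ is $\left\lceil\frac{n_j+5}{6}\right\rceil$. -/

import Mathlib

open scoped Topology Matrix

namespace CRBundle

noncomputable section

/-! ### The Heisenberg model of the CR sphere -/

/-- The Heisenberg model of the CR sphere: the one-point compactification of `ℂ × ℝ`. -/
abbrev Heis : Type := OnePoint (ℂ × ℝ)

/-- The matrix of the Hermitian form of signature `(2,1)` on `ℂ³`. -/
def formJ : Matrix (Fin 3) (Fin 3) ℂ := !![0, 0, 1; 0, 1, 0; 1, 0, 0]

/-- The Hermitian form `⟨z, w⟩ = w̄ᵗ J z`. -/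
def herm (z w : Fin 3 → ℂ) : ℂ := star w ⬝ᵥ (formJ *ᵥ z)

/-- The unitary group of the Hermitian form, as a set of matrices.  Its elements act on the CR
sphere through `PU(2,1)`. -/
def U21 : Set (Matrix (Fin 3) (Fin 3) ℂ) := {G | Gᴴ * formJ * G = formJ}

/-- The null vector representing a point of the Heisenberg model:
`(z, t) ↦ ((i t - |z|²) / 2, z, 1)` and `∞ ↦ (1, 0, 0)`. -/
def lift : Heis → Fin 3 → ℂ
  | none => ![1, 0, 0]
  | some (z, t) => ![(Complex.I * t - (‖z‖ : ℂ) ^ 2) / 2, z, 1]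

open Classical in
/-- Stereographic projection: the null line spanned by `(x, y, 1)` goes to
`(y, (2 x + |y|²) / i)`, whose second entry is real because `(x, y, 1)` is null, and the line
spanned by `(1, 0, 0)` goes to `∞`. -/
def proj (v : Fin 3 → ℂ) : Heis :=
  if v 2 = 0 then OnePoint.infty
  else ((v 1 / v 2,
    ((2 * (v 0 / v 2) + (‖v 1 / v 2‖ : ℂ) ^ 2) / Complex.I).re) : ℂ × ℝ)

/-- The action of (the class in `PU(2,1)` of) a matrix of `U21` on the Heisenberg model. -/
def act (G : Matrix (Fin 3) (Fin 3) ℂ) (X : Heis) : Heis := proj (G *ᵥ lift X)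

/-- The oriented edge `[P, Q]`, for `P ≠ Q`: the closed segment from `P` to `Q` of the
`ℂ`-circle through `P` and `Q`.  If `p`, `q` are null vectors over `P`, `Q`, the other points of
that `ℂ`-circle are the lines spanned by `p + i s ⟨p, q⟩ q` with `s` real and nonzero, and
`[P, Q]` is the part with `s > 0`; for instance `[(0,0), ∞]` is the half-line
`{(0, t) | t ≥ 0} ∪ {∞}`. -/
def arc (P Q : Heis) : Set Heis :=
  {P, Q} ∪ {X | ∃ s : ℝ, 0 < s ∧
    X = proj (lift P + (Complex.I * s * herm (lift P) (lift Q)) • lift Q)}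

/-- The marked triangle `[P⁺, Q, R]`, foliated by the oriented edges from `P` to points of
`[Q, R]`. -/
def triPlus (P Q R : Heis) : Set Heis := ⋃ X ∈ arc Q R, arc P X

/-- The marked triangle `[P⁻, Q, R]`, foliated by the oriented edges from points of `[Q, R]`
to `P`. -/
def triMinus (P Q R : Heis) : Set Heis := ⋃ X ∈ arc Q R, arc X P

/-! ### The standard tetrahedra, the slabs, and their face pairings -/

/-- The cube root of unity `-(1 + i √3) / 2`. -/
def om : ℂ := -(1 / 2) * (1 + Complex.I * (Real.sqrt 3 : ℂ))

def P₁ : Heis := (((1 : ℂ), Real.sqrt 3) : ℂ × ℝ)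
def P₂ : Heis := ((-om, Real.sqrt 3) : ℂ × ℝ)
def P₃ : Heis := (((0 : ℂ), (0 : ℝ)) : ℂ × ℝ)
def P₄ : Heis := OnePoint.infty

/-- The union of a set `F` with all the vertical rays going up from the points of `F` to `∞`. -/
def above (F : Set Heis) : Set Heis :=
  {X | X = OnePoint.infty ∨
    ∃ (z : ℂ) (s t : ℝ), s ≤ t ∧ (((z, s) : ℂ × ℝ) : Heis) ∈ F ∧ X = ((z, t) : ℂ × ℝ)}

/-- The standard symmetric tetrahedron of type `A`: the closed ball bounded by the marked triangles
`[P₄⁻, P₁, P₂]`, `[P₄⁻, P₃, P₁]`, `[P₄⁻, P₃, P₂]` and `[P₂⁻, P₃, P₁]` in the upper half of the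
Heisenberg model.  The first three triangles consist of the vertical rays going up from the three
edges of the fourth one, and the ball consists of the vertical rays going up from all the
points of the fourth one. -/
def tetA : Set Heis := above (triMinus P₂ P₃ P₁)

/-- The standard symmetric tetrahedron of type `B`: the closed ball bounded by the marked triangles
`[P₄⁻, P₁, P₂]`, `[P₄⁻, P₃, P₁]`, `[P₄⁻, P₃, P₂]` and `[P₃⁺, P₁, P₂]` in the upper half of the
Heisenberg model, described in the same way as type `A`. -/
def tetB : Set Heis := above (triPlus P₃ P₁ P₂)

/-- The (closed) bigon `B'`: the vertical half-plane over the ray from `1` in the direction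
`e^{-iπ/6}`, together with `∞`. -/
def bigonB' : Set Heis :=
  {X | X = OnePoint.infty ∨ ∃ a t : ℝ, 0 ≤ a ∧
    X = ((1 + a * Complex.exp (-(Real.pi / 6 : ℝ) * Complex.I), t) : ℂ × ℝ)}

/-- The base of the slab with index `k`: the closed region of the plane which contains `2` and whose
boundary consists of the ray `1 + ℝ≥0 e^{-iπ/6}` (the projection of the bigon `B'`), of the arc of
the unit circle from `1` to `-ω = e^{iπ/3}`, and of the ray `-ω + ℝ≥0 e^{iπ(1-2k)/6}` (the
projection of the bigon `B_k`).  The first set below is the region swept by the arc when it is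
translated in the direction `e^{-iπ/6}`, between two parallel rays; the second one is the
closed sector with apex `-ω` swept anticlockwise by a ray turning from the direction `e^{-iπ/6}`
to the direction `e^{iπ(1-2k)/6}`. -/
def slabBase (k : ℤ) : Set ℂ :=
  {z | ∃ θ a : ℝ, 0 ≤ θ ∧ θ ≤ Real.pi / 3 ∧ 0 ≤ a ∧
    z = Complex.exp (θ * Complex.I) + a * Complex.exp (-(Real.pi / 6 : ℝ) * Complex.I)} ∪
  {z | ∃ r α : ℝ, 0 ≤ r ∧ -(Real.pi / 6) ≤ α ∧
    α ≤ -(Real.pi / 6) + Real.pi / 3 * (((1 - k) % 6 : ℤ) : ℝ) ∧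
    z = -om + r * Complex.exp (α * Complex.I)}

/-- The slab with index `k`: the closed ball which contains `(2, √3)` and is bounded by the marked
triangles `[P₄⁺, P₁, P₂]` and `[P₄⁻, P₁, P₂]` (whose union is the vertical strip over the arc
from `1` to `-ω`) and by the bigons `B'` and `B_k`. -/
def slabSet (k : ℤ) : Set Heis :=
  {X | X = OnePoint.infty ∨ ∃ (z : ℂ) (t : ℝ), z ∈ slabBase k ∧ X = ((z, t) : ℂ × ℝ)}

/-- The transformation with `P₄, P₃, P₁ ↦ P₂, P₃, P₁`. -/
def G₁ : Matrix (Fin 3) (Fin 3) ℂ := !![-om, 0, 0; 1, 1, 0; -star om, om, -om]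

/-- The transformation with `P₄, P₁, P₂ ↦ P₄, P₃, P₂`. -/
def G₂ : Matrix (Fin 3) (Fin 3) ℂ := !![1, 1, om; 0, -star om, star om; 0, 0, 1]

/-- The transformation with `P₄, P₃, P₁ ↦ P₄, P₃, P₂`. -/
def G₃ : Matrix (Fin 3) (Fin 3) ℂ := !![1, 0, 0; 0, -om, 0; 0, 0, 1]

/-- The transformation with `P₄, P₁, P₂ ↦ P₃, P₁, P₂`. -/
def G₄ : Matrix (Fin 3) (Fin 3) ℂ := !![0, 0, -om; 0, -star om, 0; -om, 0, 1 - star om]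

/-! ### Flip sequences -/

/-- The two kinds of edge flips (right and left), and of layerings. -/
inductive Letter : Type
  | R
  | L

/-- The element of `SL(2,ℤ)` corresponding to a right or a left flip. -/
def Letter.toSL : Letter → Matrix.SpecialLinearGroup (Fin 2) ℤ
  | .R => ⟨!![1, 1; 0, 1], by simp [Matrix.det_fin_two]⟩
  | .L => ⟨!![1, 0; 1, 1], by simp [Matrix.det_fin_two]⟩

/-- `f` has two distinct positive real eigenvalues. -/
def HasDistinctPositiveEigenvalues (f : Matrix.SpecialLinearGroup (Fin 2) ℤ) : Prop :=
  ∃ a b : ℝ, 0 < a ∧ 0 < b ∧ a ≠ b ∧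
    Module.End.HasEigenvalue (Matrix.toLin' (f.1.map (Int.cast : ℤ → ℝ))) a ∧
    Module.End.HasEigenvalue (Matrix.toLin' (f.1.map (Int.cast : ℤ → ℝ))) b

/-- `w`, seen as a cyclic word `w 0, …, w (m - 1)` with a preferred starting point, is a flip
sequence of `f`: up to conjugation, `f` maps the standard positive ideal triangulation
`{0, 1, ∞}` of the once-punctured torus to the triangulation obtained from it by the flips
`w 0, …, w (m - 1)`. -/
def IsFlipSequence (f : Matrix.SpecialLinearGroup (Fin 2) ℤ) {m : ℕ}
    (w : ZMod m → Letter) : Prop :=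
  ∃ g : Matrix.SpecialLinearGroup (Fin 2) ℤ,
    f = g * (List.ofFn fun i : Fin m => (w ((i : ℕ) : ZMod m)).toSL).prod * g⁻¹

/-! ### The ideal cell decomposition -/

/-- The `3`-cells: a tetrahedron for every index `j`, and a slab for every index `j` of type `R`.
The cells with index `j` are of type `w j`: those with index `j + 1` are layered on them by a
`w j` layering. -/
inductive Cell {m : ℕ} (w : ZMod m → Letter) : Type
  | tet (j : ZMod m)
  | slab (j : ZMod m) (hj : w j = Letter.R)

/-- The six edges of a tetrahedron with vertices `1, 2, 3, 4`. -/
inductive TetEdge : Type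
  | e12 | e13 | e14 | e23 | e24 | e34

/-- The five edges of a slab with vertices `1, 2, 4`. -/
inductive SlabEdge : Type
  | e12 | e14 | e41 | e24 | e42

/-- The edges of all the `3`-cells, before gluing. -/
inductive CellEdge {m : ℕ} (w : ZMod m → Letter) : Type
  | tet (j : ZMod m) (a : TetEdge)
  | slab (j : ZMod m) (hj : w j = Letter.R) (a : SlabEdge)

/-- The number of letters `L` between position `j` and the next letter `R`. -/
def run {m : ℕ} (w : ZMod m → Letter) (j : ZMod m) : ℕ :=
  sInf {n : ℕ | w (j + n + 1) = Letter.R}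

theorem run_spec {m : ℕ} [NeZero m] (w : ZMod m → Letter) (j : ZMod m) (hj : w j = Letter.R) :
    w (j + run w j + 1) = Letter.R := by
  have hne : {n : ℕ | w (j + n + 1) = Letter.R}.Nonempty := by
    refine ⟨m - 1, ?_⟩
    have h1 : 1 ≤ m := Nat.one_le_iff_ne_zero.mpr (NeZero.ne m)
    simp [Nat.cast_sub h1, hj]
  exact Nat.sInf_mem hne

/-- The face pairings. -/
inductive Pairing {m : ℕ} (w : ZMod m → Letter) : Type
  /-- Face `134` of the tetrahedron `j` to face `132` of the tetrahedron `j + 1`, for `j` of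
  type `L`. -/
  | tetL134 (j : ZMod m) (hj : w j = Letter.L)
  /-- Face `124` of the tetrahedron `j` to face `324` of the tetrahedron `j + 1`, for `j` of
  type `L`. -/
  | tetL124 (j : ZMod m) (hj : w j = Letter.L)
  /-- Face `134` of the tetrahedron `j` to face `234` of the tetrahedron `j + 1`, for `j` of
  type `R`. -/
  | tetR134 (j : ZMod m) (hj : w j = Letter.R)
  /-- Face `124` of the tetrahedron `j` to the triangular face of the slab `j` with the edges
  `12, 14, 24`, for `j` of type `R`. -/
  | tetR124 (j : ZMod m) (hj : w j = Letter.R)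
  /-- The triangular face of the slab `j` with the edges `12, 41, 42` to face `123` of the
  tetrahedron `j + 1`, for `j` of type `R`. -/
  | slab124 (j : ZMod m) (hj : w j = Letter.R)
  /-- The bigonal face of the slab `j` with the edges `14, 41` to the bigonal face with the edges
  `24, 42` of the next slab, for `j` of type `R`. -/
  | bigon (j : ZMod m) (hj : w j = Letter.R)

namespace Pairing

variable {m : ℕ} [NeZero m] {w : ZMod m → Letter}

/-- The cell containing the face on which the pairing is defined. -/
def src : Pairing w → Cell w
  | tetL134 j _ => .tet j
  | tetL124 j _ => .tet j
  | tetR134 j _ => .tet j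
  | tetR124 j _ => .tet j
  | slab124 j hj => .slab j hj
  | bigon j hj => .slab j hj

/-- The cell containing the image of the pairing. -/
def tgt : Pairing w → Cell w
  | tetL134 j _ => .tet (j + 1)
  | tetL124 j _ => .tet (j + 1)
  | tetR134 j _ => .tet (j + 1)
  | tetR124 j hj => .slab j hj
  | slab124 j _ => .tet (j + 1)
  | bigon j hj => .slab (j + run w j + 1) (run_spec w j hj)

/-- The effect of the pairing on the edges of the face. -/
def edgePairs : Pairing w → List (CellEdge w × CellEdge w)
  | tetL134 j _ =>
      [(.tet j .e13, .tet (j + 1) .e13), (.tet j .e14, .tet (j + 1) .e12),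
        (.tet j .e34, .tet (j + 1) .e23)]
  | tetL124 j _ =>
      [(.tet j .e12, .tet (j + 1) .e23), (.tet j .e14, .tet (j + 1) .e34),
        (.tet j .e24, .tet (j + 1) .e24)]
  | tetR134 j _ =>
      [(.tet j .e13, .tet (j + 1) .e23), (.tet j .e14, .tet (j + 1) .e24),
        (.tet j .e34, .tet (j + 1) .e34)]
  | tetR124 j hj =>
      [(.tet j .e12, .slab j hj .e12), (.tet j .e14, .slab j hj .e14),
        (.tet j .e24, .slab j hj .e24)]
  | slab124 j hj =>
      [(.slab j hj .e12, .tet (j + 1) .e12), (.slab j hj .e41, .tet (j + 1) .e13),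
        (.slab j hj .e42, .tet (j + 1) .e23)]
  | bigon j hj =>
      [(.slab j hj .e14, .slab (j + run w j + 1) (run_spec w j hj) .e24),
        (.slab j hj .e41, .slab (j + run w j + 1) (run_spec w j hj) .e42)]

/-- The geometric realisation of the face on which the pairing is defined. -/
def face : Pairing w → Set Heis
  | tetL134 _ _ => triMinus P₄ P₃ P₁
  | tetL124 _ _ => triMinus P₄ P₁ P₂
  | tetR134 _ _ => triMinus P₄ P₃ P₁
  | tetR124 _ _ => triMinus P₄ P₁ P₂
  | slab124 _ _ => triPlus P₄ P₁ P₂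
  | bigon _ _ => bigonB'

/-- The geometric realisation of the pairing. -/
def mat : Pairing w → Matrix (Fin 3) (Fin 3) ℂ
  | tetL134 _ _ => G₁
  | tetL124 _ _ => G₂
  | tetR134 _ _ => G₃
  | tetR124 _ _ => 1
  | slab124 _ _ => G₄
  | bigon j _ => G₂ ^ run w j * G₃

end Pairing

/-- Two edges of `3`-cells are identified in the cell decomposition. -/
def EdgeEquiv {m : ℕ} [NeZero m] (w : ZMod m → Letter) : CellEdge w → CellEdge w → Prop :=
  Relation.EqvGen fun a b => ∃ p : Pairing w, (a, b) ∈ p.edgePairs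

/-- The valence of the edge of the cell decomposition represented by `a`: the number of edges of
`3`-cells which are identified with `a`. -/
def valence {m : ℕ} [NeZero m] (w : ZMod m → Letter) (a : CellEdge w) : ℕ :=
  {b | EdgeEquiv w a b}.ncard

/-! ### The finite geometric realisation -/

/-- The geometric realisation of a `3`-cell, with its vertices. -/
def Cell.closedSet {m : ℕ} [NeZero m] {w : ZMod m → Letter} : Cell w → Set Heis
  | .tet j =>
    match w (j - 1) with
    | Letter.R => tetB
    | Letter.L => tetA
  | .slab j hj => slabSet ((valence w (.slab j hj .e24) : ℤ) - 4)

/-- The vertices of the geometric realisation of a `3`-cell. -/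
def Cell.vertices {m : ℕ} {w : ZMod m → Letter} : Cell w → Set Heis
  | .tet _ => {P₁, P₂, P₃, P₄}
  | .slab _ _ => {P₁, P₂, P₄}

/-- The geometric realisation of an ideal `3`-cell. -/
def Cell.idealSet {m : ℕ} [NeZero m] {w : ZMod m → Letter} (c : Cell w) : Set Heis :=
  c.closedSet \ c.vertices

/-- The disjoint union of the (geometrically realised) ideal `3`-cells. -/
abbrev TotalSpace {m : ℕ} [NeZero m] (w : ZMod m → Letter) : Type :=
  Σ c : Cell w, c.idealSet

/-- A point of a face and its image under a face pairing. -/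
def Glue {m : ℕ} [NeZero m] (w : ZMod m → Letter) (x y : TotalSpace w) : Prop :=
  ∃ p : Pairing w, p.src = x.1 ∧ p.tgt = y.1 ∧ (x.2 : Heis) ∈ p.face ∧
    (y.2 : Heis) = act p.mat x.2

/-- The once-punctured torus bundle with flip sequence `w`, obtained by gluing the ideal `3`-cells
along the face pairings, with the quotient topology. -/
abbrev Bundle {m : ℕ} [NeZero m] (w : ZMod m → Letter) : Type := Quot (Glue w)

/-- The geometric realisation of an edge of a `3`-cell, with its endpoints. -/
def CellEdge.closedArc {m : ℕ} {w : ZMod m → Letter} : CellEdge w → Set Heis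
  | .tet _ .e12 => arc P₁ P₂
  | .tet _ .e13 => arc P₃ P₁
  | .tet _ .e14 => arc P₁ P₄
  | .tet _ .e23 => arc P₃ P₂
  | .tet _ .e24 => arc P₂ P₄
  | .tet _ .e34 => arc P₃ P₄
  | .slab _ _ .e12 => arc P₁ P₂
  | .slab _ _ .e14 => arc P₁ P₄
  | .slab _ _ .e41 => arc P₄ P₁
  | .slab _ _ .e24 => arc P₂ P₄
  | .slab _ _ .e42 => arc P₄ P₂

/-- The `3`-cell to which an edge belongs. -/
def CellEdge.cell {m : ℕ} {w : ZMod m → Letter} : CellEdge w → Cell w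
  | .tet j _ => .tet j
  | .slab j hj _ => .slab j hj

/-- The ideal edge of the cell decomposition represented by an edge of a `3`-cell: the image of
the (open) edge in the bundle. -/
def edgeLocus {m : ℕ} [NeZero m] {w : ZMod m → Letter} (a : CellEdge w) : Set (Bundle w) :=
  {x | ∃ y : a.cell.idealSet, (y : Heis) ∈ a.closedArc ∧ x = Quot.mk _ ⟨a.cell, y⟩}

/-! ### Branched charts and ramification orders -/

/-- The standard CR branching map `(z, t) ↦ (z ^ N, t)`. -/
def branchMap (N : ℕ) (p : ℂ × ℝ) : ℂ × ℝ := (p.1 ^ N, p.2)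

/-- `φ` restricts on the set `U` to a continuous map into the CR sphere that is compatible with the
geometric realisation: on each of the `3`-cells it is, locally, the geometric realisation of the
cell followed by a CR transformation. -/
def IsCRMap {m : ℕ} [NeZero m] {w : ZMod m → Letter} (U : Set (Bundle w))
    (φ : Bundle w → Heis) : Prop :=
  ContinuousOn φ U ∧
  ∀ (c : Cell w) (x : c.idealSet), Quot.mk (Glue w) ⟨c, x⟩ ∈ U →
    ∃ G ∈ U21, ∀ᶠ y : c.idealSet in 𝓝 x, φ (Quot.mk (Glue w) ⟨c, y⟩) = act G y

/-- The branched CR structure defined by the geometric realisation has ramification order `N ≥ 1`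
around the ideal edge `e`: every point of `e` has an open neighbourhood `U` with a chart `φ` of the
structure which, in suitable topological coordinates `h` on `U` and `k` on the CR sphere, is
the standard branching map `(z, t) ↦ (z ^ N, t)`, with `e` corresponding to the axis `z = 0`. -/
def HasRamificationOrder {m : ℕ} [NeZero m] {w : ZMod m → Letter} (e : Set (Bundle w))
    (N : ℕ) : Prop :=
  1 ≤ N ∧ ∀ x ∈ e, ∃ (φ : Bundle w → Heis) (h : OpenPartialHomeomorph (Bundle w) (ℂ × ℝ))
    (k : OpenPartialHomeomorph Heis (ℂ × ℝ)),
    x ∈ h.source ∧ IsCRMap h.source φ ∧ Set.MapsTo φ h.source k.source ∧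
    (∀ y ∈ h.source, k (φ y) = branchMap N (h y)) ∧
    (∀ y ∈ h.source, y ∈ e ↔ (h y).1 = 0)

end

end CRBundle

open scoped Topology Matrix

namespace CRBundle

/-! ### The action of the unitary group on the Heisenberg model -/

/-! Let r = `run w j` be the number of letters L between w_j and the next letter R. Exactly r + 4
edges of cells are glued to e_j: edge 41 of slab j, edge 13 of the tetrahedra j+1, …, j+r+1, edge 23
of the tetrahedron j+r+2, and edge 42 of slab j+r+1 (`valence_slab41`). Hence n_j = r, and what
remains is to show that the cells wind ⌈(r+5)/6⌉ times around e_j.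

All these cells are developed into one copy of Heisenberg space, with e_j on the half-axis z = 0, t
< 0. The first slab is developed by the Heisenberg translation `T` and the first tetrahedron by `K`;
crossing an L-pairing composes with the rotation G₃ by π/3 about the axis, and the last tetrahedron
and the last slab use `K * G₃inv` and `T * G₃inv`, rotated r times. The identities `G₄_mul_Tinv`,
`G₁_mul_Kinv`, `G₄_mul_G₃` and `G₂_pow_mul_G₃_mul_Tinv` say that developed neighbours fit along
their common faces; the last of them closes up the ring.

Near the axis each developed cell is a wedge bounded by two explicit walls θ = a(ρ,t)
(`act_ringInv_mem_idealSet`). The first slab starts at angle -π/6 and ends at a wall tangent to π/2.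
The first tetrahedron of type B ends at `wallAngle`, each tetrahedron of type A adds exactly π/3,
and the second tetrahedron of type B ends at a wall tangent to 3π/2 + rπ/3. The last slab, of index
k, ends at 3π/2 + rπ/3 + (π/3)·((1-k) mod 6). Here k is the valence of its edge 24 minus 4, which is
again r (`valence_slab24`). The total angle is (π/3)(r + 5 + ((1-r) mod 6)). Since 1-r ≡ -(r+5) mod
6, the bracket is r+5 rounded up to a multiple of 6, so the angle is 2π⌈(r+5)/6⌉
(`ringWall_last_eq`, `ceil_eq_turns`).

The chart comes from the topological statement `exists_chart_of_cyclic_wedges`: wedges glued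
cyclically with total angle 2πN are flattened by an N-th root of the developed position, which is
well defined because the wedges carry real angles. Its hypotheses require that near e_j no gluing
happens except between consecutive wedges (`exists_isLink_src`, `exists_isLink_tgt`), and that the
pieces stay disjoint even when the same cell occurs twice in the ring (`ringSet_disjoint_aux`). -/

theorem herm_apply (z w : Fin 3 → ℂ) :
    herm z w = star (w 0) * z 2 + star (w 1) * z 1 + star (w 2) * z 0 := by
  simp [herm, formJ, Matrix.mulVec, dotProduct, Fin.sum_univ_three]

theorem lift_coe (z : ℂ) (t : ℝ) :
    lift ((z, t) : ℂ × ℝ) = ![(Complex.I * t - (‖z‖ : ℂ) ^ 2) / 2, z, 1] := rfl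

theorem lift_infty : lift OnePoint.infty = ![1, 0, 0] := rfl

theorem herm_lift_self (X : Heis) : herm (lift X) (lift X) = 0 := by
  induction X using OnePoint.rec with
  | infty => simp [herm_apply, lift_infty]
  | coe p =>
    obtain ⟨z, t⟩ := p
    rw [lift_coe, herm_apply]
    have h : star z * z = (‖z‖ : ℂ) ^ 2 := by
      simpa using Complex.conj_mul' z
    simp only [Matrix.cons_val_zero, Matrix.cons_val_one, Matrix.cons_val, h]
    simp
    ring

theorem lift_ne_zero (X : Heis) : lift X ≠ 0 := by
  induction X using OnePoint.rec with
  | infty => intro h; simpa [lift_infty] using congrFun h 0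
  | coe p =>
    obtain ⟨z, t⟩ := p
    intro h; simpa [lift_coe] using congrFun h 2

theorem herm_smul_left (c : ℂ) (z w : Fin 3 → ℂ) : herm (c • z) w = c * herm z w := by
  simp only [herm_apply, Pi.smul_apply, smul_eq_mul]; ring

theorem herm_smul_right (c : ℂ) (z w : Fin 3 → ℂ) : herm z (c • w) = star c * herm z w := by
  simp only [herm_apply, Pi.smul_apply, smul_eq_mul, star_mul']; ring

theorem proj_smul {c : ℂ} (hc : c ≠ 0) (v : Fin 3 → ℂ) : proj (c • v) = proj v := by
  simp only [proj, Pi.smul_apply, smul_eq_mul, mul_eq_zero, hc, false_or]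
  simp only [mul_div_mul_left _ _ hc]

theorem proj_lift (X : Heis) : proj (lift X) = X := by
  induction X using OnePoint.rec with
  | infty => simp [proj, lift_infty]
  | coe p =>
    obtain ⟨z, t⟩ := p
    simp only [proj, lift_coe]
    have h : ((2 * ((Complex.I * t - (‖z‖ : ℂ) ^ 2) / 2) + (‖z‖ : ℂ) ^ 2) / Complex.I) = t := by
      field_simp; ring
    simp [h]

theorem proj_of_ne {v : Fin 3 → ℂ} (h : v 2 ≠ 0) :
    proj v = ((v 1 / v 2,
      ((2 * (v 0 / v 2) + (‖v 1 / v 2‖ : ℂ) ^ 2) / Complex.I).re) : ℂ × ℝ) := by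
  simp [proj, h]

theorem proj_of_eq {v : Fin 3 → ℂ} (h : v 2 = 0) : proj v = OnePoint.infty := by
  simp [proj, h]

/-- If the last coordinate of a null vector vanishes, nullity kills the middle one and the line is
∞. Otherwise nullity makes the quantity divided by i in `proj` purely imaginary, so taking the real
part of the quotient loses nothing. -/
theorem exists_smul_lift_proj {v : Fin 3 → ℂ} (hv : herm v v = 0) (h0 : v ≠ 0) :
    ∃ c : ℂ, c ≠ 0 ∧ v = c • lift (proj v) := by
  by_cases h : v 2 = 0
  · have h1 : v 1 = 0 := by
      rw [herm_apply, h] at hv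
      simpa using hv
    refine ⟨v 0, ?_, ?_⟩
    · intro h2
      apply h0
      ext i
      fin_cases i <;> simp [h, h1, h2]
    · rw [proj_of_eq h, lift_infty]
      ext i
      fin_cases i <;> simp [h, h1]
  · refine ⟨v 2, h, ?_⟩
    rw [proj_of_ne h, lift_coe]
    set a := v 0 / v 2 with ha
    set b := v 1 / v 2 with hb
    have h0' : v 0 = v 2 * a := by rw [ha]; field_simp
    have h1' : v 1 = v 2 * b := by rw [hb]; field_simp
    -- This is the null condition divided by the squared modulus of the last coordinate.
    have key : 2 * a.re + ‖b‖ ^ 2 = 0 := by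
      rw [herm_apply, h0', h1'] at hv
      have hb2 : star b * b = ((‖b‖ ^ 2 : ℝ) : ℂ) := by
        have := Complex.conj_mul' b
        push_cast; simpa using this
      have e : star (v 2 * a) * v 2 + star (v 2 * b) * (v 2 * b) + star (v 2) * (v 2 * a)
          = (star (v 2) * v 2) * (star a + a + star b * b) := by
        simp only [star_mul']; ring
      rw [e, hb2] at hv
      have hne : star (v 2) * v 2 ≠ 0 := by simpa using h
      have h3 := (mul_eq_zero.mp hv).resolve_left hne
      have h4 := congrArg Complex.re h3
      simp only [Complex.add_re, Complex.star_def, Complex.conj_re, Complex.ofReal_re,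
        Complex.zero_re] at h4
      linarith
    have e0 : (Complex.I * ((2 * a + (‖b‖ : ℂ) ^ 2) / Complex.I).re - (‖b‖ : ℂ) ^ 2) / 2 = a := by
      have e1 : (2 * a + (‖b‖ : ℂ) ^ 2) / Complex.I = ((2 * a.im : ℝ) : ℂ) := by
        rw [div_eq_iff Complex.I_ne_zero]
        apply Complex.ext
        · have : ((‖b‖ : ℂ) ^ 2).re = ‖b‖ ^ 2 := by rw [← Complex.ofReal_pow, Complex.ofReal_re]
          simp [this]; linarith
        · have : ((‖b‖ : ℂ) ^ 2).im = 0 := by rw [← Complex.ofReal_pow, Complex.ofReal_im]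
          simp [this]
      rw [e1, Complex.ofReal_re]
      apply Complex.ext
      · have : ((‖b‖ : ℂ) ^ 2).re = ‖b‖ ^ 2 := by rw [← Complex.ofReal_pow, Complex.ofReal_re]
        simp [this]; linarith
      · have : ((‖b‖ : ℂ) ^ 2).im = 0 := by rw [← Complex.ofReal_pow, Complex.ofReal_im]
        simp [this]
    rw [e0]
    ext i
    fin_cases i <;> simp [h0', h1']

theorem herm_mulVec {G : Matrix (Fin 3) (Fin 3) ℂ} (hG : G ∈ U21) (z w : Fin 3 → ℂ) :
    herm (G *ᵥ z) (G *ᵥ w) = herm z w := by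
  have h : Gᴴ * formJ * G = formJ := hG
  unfold herm
  rw [Matrix.star_mulVec, Matrix.mulVec_mulVec, ← Matrix.dotProduct_mulVec, Matrix.mulVec_mulVec,
    ← Matrix.mul_assoc, h]

theorem formJ_mul_formJ : formJ * formJ = 1 := by
  ext i j
  fin_cases i <;> fin_cases j <;> simp [formJ, Matrix.mul_apply, Fin.sum_univ_three]

theorem U21_left_inv {G : Matrix (Fin 3) (Fin 3) ℂ} (hG : G ∈ U21) :
    (formJ * Gᴴ * formJ) * G = 1 := by
  have h : Gᴴ * formJ * G = formJ := hG
  rw [Matrix.mul_assoc, Matrix.mul_assoc, ← Matrix.mul_assoc Gᴴ, h, formJ_mul_formJ]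

theorem U21_mul {G H : Matrix (Fin 3) (Fin 3) ℂ} (hG : G ∈ U21) (hH : H ∈ U21) : G * H ∈ U21 := by
  have h1 : Gᴴ * formJ * G = formJ := hG
  have h2 : Hᴴ * formJ * H = formJ := hH
  change (G * H)ᴴ * formJ * (G * H) = formJ
  rw [Matrix.conjTranspose_mul]
  calc Hᴴ * Gᴴ * formJ * (G * H) = Hᴴ * (Gᴴ * formJ * G) * H := by simp only [Matrix.mul_assoc]
    _ = formJ := by rw [h1, h2]

theorem U21_one : (1 : Matrix (Fin 3) (Fin 3) ℂ) ∈ U21 := by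
  simp [U21]

theorem U21_pow {G : Matrix (Fin 3) (Fin 3) ℂ} (hG : G ∈ U21) (n : ℕ) : G ^ n ∈ U21 := by
  induction n with
  | zero => simpa using U21_one
  | succ n ih => rw [pow_succ]; exact U21_mul ih hG

theorem mulVec_lift_ne_zero {G : Matrix (Fin 3) (Fin 3) ℂ} (hG : G ∈ U21) (X : Heis) :
    G *ᵥ lift X ≠ 0 := by
  intro h
  have := congrArg ((formJ * Gᴴ * formJ) *ᵥ ·) h
  simp only [Matrix.mulVec_mulVec, U21_left_inv hG, Matrix.one_mulVec, Matrix.mulVec_zero] at this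
  exact lift_ne_zero X this

theorem exists_mulVec_lift {G : Matrix (Fin 3) (Fin 3) ℂ} (hG : G ∈ U21) (X : Heis) :
    ∃ c : ℂ, c ≠ 0 ∧ G *ᵥ lift X = c • lift (act G X) := by
  apply exists_smul_lift_proj
  · rw [herm_mulVec hG, herm_lift_self]
  · exact mulVec_lift_ne_zero hG X

theorem act_mul (G : Matrix (Fin 3) (Fin 3) ℂ) {H : Matrix (Fin 3) (Fin 3) ℂ} (hH : H ∈ U21)
    (X : Heis) : act (G * H) X = act G (act H X) := by
  obtain ⟨c, hc, h⟩ := exists_mulVec_lift hH X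
  change proj ((G * H) *ᵥ lift X) = proj (G *ᵥ lift (act H X))
  rw [← Matrix.mulVec_mulVec, h, Matrix.mulVec_smul, proj_smul hc]

theorem act_one (X : Heis) : act 1 X = X := by
  rw [act, Matrix.one_mulVec, proj_lift]

theorem act_smul {c : ℂ} (hc : c ≠ 0) (G : Matrix (Fin 3) (Fin 3) ℂ) (X : Heis) :
    act (c • G) X = act G X := by
  rw [act, Matrix.smul_mulVec, proj_smul hc, act]

/-- A lift to null vectors that is continuous at `∞`. -/
noncomputable def normLift (X : Heis) : Fin 3 → ℂ :=
  (lift X 0 - lift X 2)⁻¹ • lift X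

theorem normLift_coe (p : ℂ × ℝ) :
    normLift p = (lift p 0 - 1)⁻¹ • lift p := by
  obtain ⟨z, t⟩ := p
  simp [normLift, lift_coe]

theorem normLift_infty : normLift OnePoint.infty = ![1, 0, 0] := by
  simp [normLift, lift_infty]

theorem lift_coe_sub_one (p : ℂ × ℝ) :
    (lift p 0 - 1).re = -(1 + ‖p.1‖ ^ 2 / 2) ∧ (lift p 0 - 1).im = p.2 / 2 := by
  obtain ⟨z, t⟩ := p
  rw [lift_coe]
  have h1 : ((‖z‖ : ℂ) ^ 2).re = ‖z‖ ^ 2 := by rw [← Complex.ofReal_pow, Complex.ofReal_re]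
  have h2 : ((‖z‖ : ℂ) ^ 2).im = 0 := by rw [← Complex.ofReal_pow, Complex.ofReal_im]
  constructor
  · simp [h1]; ring
  · simp [h2]

/-- The first coordinate of a finite lift has nonpositive real part, so subtracting 1 keeps it away
from 0 and makes it tend to infinity with the point. This is why `normLift` divides by that
difference. -/
theorem one_le_norm_lift_sub (p : ℂ × ℝ) :
    1 + ‖p.1‖ ^ 2 / 2 ≤ ‖lift p 0 - 1‖ ∧ |p.2| / 2 ≤ ‖lift p 0 - 1‖ := by
  obtain ⟨h1, h2⟩ := lift_coe_sub_one p
  constructor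
  · have := Complex.abs_re_le_norm (lift p 0 - 1)
    rw [h1, abs_neg] at this
    exact (le_abs_self _).trans this
  · have := Complex.abs_im_le_norm (lift p 0 - 1)
    rw [h2, abs_div] at this
    simpa using this

theorem lift_sub_ne_zero (p : ℂ × ℝ) : lift p 0 - 1 ≠ 0 := by
  intro h
  have := (one_le_norm_lift_sub p).1
  rw [h, norm_zero] at this
  nlinarith [sq_nonneg ‖p.1‖]

theorem continuous_lift_coe : Continuous fun p : ℂ × ℝ => lift p := by
  have : (fun p : ℂ × ℝ => lift p) =
      fun p => ![(Complex.I * p.2 - (‖p.1‖ : ℂ) ^ 2) / 2, p.1, 1] := by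
    funext p; obtain ⟨z, t⟩ := p; rfl
  rw [this]
  refine continuous_pi fun i => ?_
  fin_cases i
  · simp; fun_prop
  · simp; fun_prop
  · simp; fun_prop

/-- With d the normalising denominator, the finite vectors are (1 + 1/d, z/d, 1/d). Since |d| tends
to infinity and |z|² ≤ 2|d|, they converge to (1, 0, 0). -/
theorem continuous_normLift : Continuous normLift := by
  rw [OnePoint.continuous_iff]
  constructor
  · rw [Filter.coclosedCompact_eq_cocompact, normLift_infty]
    have hN : Filter.Tendsto (fun p : ℂ × ℝ => ‖lift p 0 - 1‖) (Filter.cocompact _) Filter.atTop := by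
      have h2 : Filter.Tendsto (fun p : ℂ × ℝ => ‖p‖ / 2) (Filter.cocompact _) Filter.atTop :=
        (tendsto_norm_cocompact_atTop).atTop_div_const (by norm_num)
      refine Filter.tendsto_atTop_mono (fun p => ?_) h2
      obtain ⟨h3, h4⟩ := one_le_norm_lift_sub p
      rw [Prod.norm_def]
      rcases max_cases ‖p.1‖ ‖p.2‖ with h | h
      · rw [h.1]; nlinarith [sq_nonneg (‖p.1‖ - 1)]
      · rw [h.1]; exact h4
    have hI : Filter.Tendsto (fun p : ℂ × ℝ => (lift p 0 - 1)⁻¹) (Filter.cocompact _) (𝓝 0) := by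
      rw [tendsto_zero_iff_norm_tendsto_zero]
      simp only [norm_inv]
      exact tendsto_inv_atTop_zero.comp hN
    rw [tendsto_pi_nhds]
    intro i
    simp only [normLift_coe, Pi.smul_apply, smul_eq_mul]
    fin_cases i
    · have : Filter.Tendsto (fun p : ℂ × ℝ => 1 + (lift p 0 - 1)⁻¹) (Filter.cocompact _)
          (𝓝 (1 + 0)) := tendsto_const_nhds.add hI
      rw [add_zero] at this
      simp only [Fin.zero_eta, Matrix.cons_val_zero]
      refine this.congr fun p => ?_
      have := lift_sub_ne_zero p
      field_simp
      ring
    · simp only [Fin.mk_one, Matrix.cons_val_one, Matrix.cons_val_zero]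
      rw [tendsto_zero_iff_norm_tendsto_zero]
      have hs : Filter.Tendsto (fun p : ℂ × ℝ => Real.sqrt (2 * ‖lift p 0 - 1‖⁻¹))
          (Filter.cocompact _) (𝓝 0) := by
        have := ((tendsto_inv_atTop_zero.comp hN).const_mul 2).sqrt
        simpa using this
      refine squeeze_zero (fun _ => norm_nonneg _) (fun p => ?_) hs
      apply Real.le_sqrt_of_sq_le
      have h3 := (one_le_norm_lift_sub p).1
      have h5 : lift p 1 = p.1 := by obtain ⟨z, t⟩ := p; simp [lift_coe]
      have hpos : 0 < ‖lift p 0 - 1‖ := norm_pos_iff.mpr (lift_sub_ne_zero p)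
      rw [norm_mul, norm_inv, h5, mul_pow, inv_pow]
      have e : 2 * ‖lift p 0 - 1‖⁻¹ = (‖lift p 0 - 1‖ ^ 2)⁻¹ * (2 * ‖lift p 0 - 1‖) := by
        field_simp
      rw [e]
      apply mul_le_mul_of_nonneg_left _ (by positivity)
      nlinarith
    · have h5 : ∀ p : ℂ × ℝ, lift p 2 = 1 := by rintro ⟨z, t⟩; simp [lift_coe]
      simpa [h5] using hI
  · simp only [normLift_coe]
    refine Continuous.smul (Continuous.inv₀ ?_ lift_sub_ne_zero) continuous_lift_coe
    exact ((continuous_apply 0).comp continuous_lift_coe).sub continuous_const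

theorem exists_smul_normLift (X : Heis) : ∃ c : ℂ, c ≠ 0 ∧ normLift X = c • lift X := by
  induction X using OnePoint.rec with
  | infty => exact ⟨1, one_ne_zero, by rw [normLift_infty, one_smul, lift_infty]⟩
  | coe p => exact ⟨_, inv_ne_zero (lift_sub_ne_zero p), normLift_coe p⟩

/-- Distinct points have non-orthogonal null vectors. -/
theorem eq_of_herm_lift_eq_zero {X Y : Heis} (h : herm (lift X) (lift Y) = 0) : X = Y := by
  induction X using OnePoint.rec with
  | infty =>
    induction Y using OnePoint.rec with
    | infty => rfl
    | coe q => obtain ⟨z, t⟩ := q; simp [herm_apply, lift_coe, lift_infty] at h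
  | coe p =>
    obtain ⟨z, t⟩ := p
    induction Y using OnePoint.rec with
    | infty => simp [herm_apply, lift_coe, lift_infty] at h
    | coe q =>
      obtain ⟨z', t'⟩ := q
      have hz : z = z' := by
        have hre := congrArg Complex.re h
        rw [herm_apply, lift_coe, lift_coe] at hre
        simp only [Matrix.cons_val_zero, Matrix.cons_val_one, Matrix.cons_val] at hre
        have h1 : ∀ u : ℂ, ((‖u‖ : ℂ) ^ 2).re = ‖u‖ ^ 2 := fun u => by
          rw [← Complex.ofReal_pow, Complex.ofReal_re]
        have h2 : ∀ u : ℂ, ((‖u‖ : ℂ) ^ 2).im = 0 := fun u => by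
          rw [← Complex.ofReal_pow, Complex.ofReal_im]
        simp [h1] at hre
        have n1 := Complex.sq_norm z
        have n2 := Complex.sq_norm z'
        rw [Complex.normSq_apply] at n1 n2
        -- The real part of the form between two finite lifts is -|z - z'|²/2.
        have h5 : (z.re - z'.re) ^ 2 + (z.im - z'.im) ^ 2 = 0 := by nlinarith
        apply Complex.ext
        · nlinarith [sq_nonneg (z.re - z'.re), sq_nonneg (z.im - z'.im)]
        · nlinarith [sq_nonneg (z.re - z'.re), sq_nonneg (z.im - z'.im)]
      subst hz
      have him := congrArg Complex.im h
      rw [herm_apply, lift_coe, lift_coe] at him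
      simp only [Matrix.cons_val_zero, Matrix.cons_val_one, Matrix.cons_val] at him
      have h2 : ∀ u : ℂ, ((‖u‖ : ℂ) ^ 2).im = 0 := fun u => by
        rw [← Complex.ofReal_pow, Complex.ofReal_im]
      have h1 : ∀ u : ℂ, ((‖u‖ : ℂ) ^ 2).re = ‖u‖ ^ 2 := fun u => by
          rw [← Complex.ofReal_pow, Complex.ofReal_re]
      simp [h2] at him
      have : t = t' := by linarith
      rw [this]

/-- Null vectors are orthogonal only when proportional, so the graph of the action is cut out by one
equation in the continuous lifts, with no case distinction at ∞. -/
theorem act_eq_iff {G : Matrix (Fin 3) (Fin 3) ℂ} (hG : G ∈ U21) (X Y : Heis) :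
    act G X = Y ↔ herm (G *ᵥ normLift X) (normLift Y) = 0 := by
  obtain ⟨c, hc, h⟩ := exists_mulVec_lift hG X
  obtain ⟨a, ha, h1⟩ := exists_smul_normLift X
  obtain ⟨b, hb, h2⟩ := exists_smul_normLift Y
  rw [h1, h2, Matrix.mulVec_smul, h, herm_smul_left, herm_smul_left, herm_smul_right]
  constructor
  · rintro rfl
    rw [herm_lift_self]; simp
  · intro h3
    have : herm (lift (act G X)) (lift Y) = 0 := by simpa [ha, hb, hc] using h3
    exact eq_of_herm_lift_eq_zero this

/-- A map into a compact space with closed graph is continuous: the preimage of a closed set is the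
projection of a closed set along a compact factor. -/
theorem continuous_act {G : Matrix (Fin 3) (Fin 3) ℂ} (hG : G ∈ U21) : Continuous (act G) := by
  have hcl : IsClosed {p : Heis × Heis | act G p.1 = p.2} := by
    have : {p : Heis × Heis | act G p.1 = p.2} =
        {p | herm (G *ᵥ normLift p.1) (normLift p.2) = 0} := by
      ext p; exact act_eq_iff hG p.1 p.2
    rw [this]
    refine isClosed_eq ?_ continuous_const
    have h1 : Continuous fun p : Heis × Heis => G *ᵥ normLift p.1 :=
      Continuous.matrix_mulVec continuous_const (continuous_normLift.comp continuous_fst)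
    have h2 : Continuous fun p : Heis × Heis => normLift p.2 :=
      continuous_normLift.comp continuous_snd
    simp only [herm_apply]
    fun_prop
  rw [continuous_iff_isClosed]
  intro C hC
  have : act G ⁻¹' C = Prod.fst '' ({p : Heis × Heis | act G p.1 = p.2} ∩ Prod.snd ⁻¹' C) := by
    ext X
    constructor
    · intro h
      exact ⟨(X, act G X), ⟨rfl, h⟩, rfl⟩
    · rintro ⟨⟨X', Y⟩, ⟨h1, h2⟩, rfl⟩
      change act G X' = Y at h1
      change act G X' ∈ C
      rw [h1]; exact h2
  rw [this]
  exact isClosedMap_fst_of_compactSpace _ (hcl.inter (hC.preimage continuous_snd))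

/-! ### Charts of a quotient space -/

/-- A saturated open set of the form `⋃ O i`, with compatible continuous maps `Ψ i : O i → V` that
separate the classes and have continuous sections on the members of a finite closed cover of `V`,
gives a homeomorphism from an open set of the quotient onto `V`. -/
theorem exists_chart_of_sections {X Y : Type*} [TopologicalSpace X] [TopologicalSpace Y]
    [Nonempty Y] (r : X → X → Prop) (M : ℕ) (O : ℕ → Set X) (Ψ : ℕ → X → Y) (V : Set Y)
    (K : ℕ → Set Y) (s : ℕ → Y → X)
    (hO : ∀ i < M, IsOpen (O i)) (hΨ : ∀ i < M, ContinuousOn (Ψ i) (O i)) (hV : IsOpen V)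
    (hΨV : ∀ i < M, Set.MapsTo (Ψ i) (O i) V)
    (hsat : ∀ i < M, ∀ x ∈ O i, ∀ y, (r x y ∨ r y x) → ∃ i' < M, y ∈ O i' ∧ Ψ i' y = Ψ i x)
    (hcons : ∀ i < M, ∀ i' < M, ∀ x, x ∈ O i → x ∈ O i' → Ψ i x = Ψ i' x)
    (hinj : ∀ i < M, ∀ i' < M, ∀ x ∈ O i, ∀ y ∈ O i', Ψ i x = Ψ i' y →
      Quot.mk r x = Quot.mk r y)
    (hK : ∀ i < M, IsClosed (K i)) (hcover : ∀ y ∈ V, ∃ i < M, y ∈ K i)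
    (hs : ∀ i < M, ContinuousOn (s i) (K i ∩ V))
    (hsO : ∀ i < M, ∀ y ∈ K i ∩ V, s i y ∈ O i ∧ Ψ i (s i y) = y) :
    ∃ h : OpenPartialHomeomorph (Quot r) Y,
      (∀ i < M, ∀ x ∈ O i, Quot.mk r x ∈ h.source ∧ h (Quot.mk r x) = Ψ i x) ∧
      (∀ x, Quot.mk r x ∈ h.source → ∃ i < M, x ∈ O i) := by
  classical
  obtain ⟨y0⟩ := ‹Nonempty Y›
  let U : Set X := {x | ∃ i, i < M ∧ x ∈ O i}
  let Φ : X → Y := fun x => if h : ∃ i, i < M ∧ x ∈ O i then Ψ h.choose x else y0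
  -- The index chosen in `Φ` is irrelevant, because the maps agree on overlaps.
  have hΦ : ∀ i < M, ∀ x ∈ O i, Φ x = Ψ i x := by
    intro i hi x hx
    have h : ∃ i, i < M ∧ x ∈ O i := ⟨i, hi, hx⟩
    simp only [Φ, dif_pos h]
    exact hcons _ h.choose_spec.1 _ hi x h.choose_spec.2 hx
  have hΦ0 : ∀ x, x ∉ U → Φ x = y0 := fun x hx => dif_neg hx
  have hUr : ∀ x y, r x y → (x ∈ U ↔ y ∈ U) := by
    intro x y hxy
    constructor
    · rintro ⟨i, hi, hx⟩
      obtain ⟨i', hi', hy, -⟩ := hsat i hi x hx y (Or.inl hxy)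
      exact ⟨i', hi', hy⟩
    · rintro ⟨i, hi, hy⟩
      obtain ⟨i', hi', hx, -⟩ := hsat i hi y hy x (Or.inr hxy)
      exact ⟨i', hi', hx⟩
  have hΦr : ∀ x y, r x y → Φ x = Φ y := by
    intro x y hxy
    by_cases hx : x ∈ U
    · obtain ⟨i, hi, hxi⟩ := hx
      obtain ⟨i', hi', hy, e⟩ := hsat i hi x hxi y (Or.inl hxy)
      rw [hΦ i hi x hxi, hΦ i' hi' y hy, e]
    · have hy : y ∉ U := fun h => hx ((hUr x y hxy).2 h)
      rw [hΦ0 x hx, hΦ0 y hy]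
  let S : Set (Quot r) := {b | Quot.lift (fun x => x ∈ U) (fun x y h => propext (hUr x y h)) b}
  let H : Quot r → Y := Quot.lift Φ hΦr
  -- The inverse picks any closed piece containing y. Different choices give sections in the same
  -- class by `hinj`; the default 0 is never reached on V.
  let idx : Y → ℕ := fun y => if h : ∃ i, i < M ∧ y ∈ K i then h.choose else 0
  have hidx : ∀ y ∈ V, idx y < M ∧ y ∈ K (idx y) := by
    intro y hy
    have h : ∃ i, i < M ∧ y ∈ K i := hcover y hy
    simp only [idx, dif_pos h]
    exact h.choose_spec
  let g : Y → Quot r := fun y => Quot.mk r (s (idx y) y)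
  have hg : ∀ i < M, ∀ y ∈ K i ∩ V, g y = Quot.mk r (s i y) := by
    intro i hi y hy
    obtain ⟨h1, h2⟩ := hidx y hy.2
    obtain ⟨h3, h4⟩ := hsO _ h1 y ⟨h2, hy.2⟩
    obtain ⟨h5, h6⟩ := hsO i hi y hy
    exact hinj _ h1 i hi _ h3 _ h5 (h4.trans h6.symm)
  have hU : IsOpen U := by
    have : U = ⋃ i ∈ Set.Iio M, O i := by
      ext x; simp [U]
    rw [this]
    exact isOpen_biUnion fun i hi => hO i hi
  have hΦc : ContinuousOn Φ U := by
    rintro x ⟨i, hi, hx⟩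
    have h1 : ContinuousAt (Ψ i) x := (hΨ i hi).continuousAt ((hO i hi).mem_nhds hx)
    refine (h1.congr ?_).continuousWithinAt
    filter_upwards [(hO i hi).mem_nhds hx] with y hy using (hΦ i hi y hy).symm
  have hS : IsOpen S := by
    have : IsOpen (Quot.mk r ⁻¹' S) := hU
    exact this
  refine ⟨⟨⟨⟨H, g, S, V, ?_, ?_, ?_, ?_⟩, ?_, ?_⟩, hS, hV⟩, ?_, ?_⟩
  · rintro ⟨x⟩ ⟨i, hi, hx⟩
    change Φ x ∈ V
    rw [hΦ i hi x hx]
    exact hΨV i hi hx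
  · intro y hy
    obtain ⟨h1, h2⟩ := hidx y hy
    exact ⟨_, h1, (hsO _ h1 y ⟨h2, hy⟩).1⟩
  · rintro ⟨x⟩ ⟨i, hi, hx⟩
    change Quot.mk r (s (idx (Φ x)) (Φ x)) = Quot.mk r x
    have hy : Φ x ∈ V := by rw [hΦ i hi x hx]; exact hΨV i hi hx
    obtain ⟨h1, h2⟩ := hidx _ hy
    obtain ⟨h3, h4⟩ := hsO _ h1 _ ⟨h2, hy⟩
    exact hinj _ h1 i hi _ h3 x hx (h4.trans (hΦ i hi x hx))
  · intro y hy
    obtain ⟨h1, h2⟩ := hidx y hy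
    obtain ⟨h3, h4⟩ := hsO _ h1 y ⟨h2, hy⟩
    change Φ (s (idx y) y) = y
    rw [hΦ _ h1 _ h3, h4]
  · change ContinuousOn H S
    rw [continuousOn_open_iff hS]
    intro t ht
    have : IsOpen (Quot.mk r ⁻¹' (S ∩ H ⁻¹' t)) := (continuousOn_open_iff hU).1 hΦc t ht
    exact this
  · change ContinuousOn g V
    intro y hy
    -- Continuity of the inverse is checked on each member of the finite closed cover.
    have hVK : V = ⋃ i ∈ Set.Iio M, (K i ∩ V) := by
      ext z
      simp only [Set.mem_Iio, Set.mem_iUnion, Set.mem_inter_iff, exists_prop]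
      constructor
      · intro hz
        obtain ⟨i, hi, h⟩ := hcover z hz
        exact ⟨i, hi, h, hz⟩
      · rintro ⟨i, hi, h, hz⟩; exact hz
    unfold ContinuousWithinAt
    rw [hVK, nhdsWithin_biUnion (Set.finite_Iio M), Filter.tendsto_iSup]
    intro i
    rw [Filter.tendsto_iSup]
    intro hi
    by_cases hyi : y ∈ K i
    · have h1 : ContinuousWithinAt (fun z => Quot.mk r (s i z)) (K i ∩ V) y :=
        (continuous_quot_mk.continuousAt).comp_continuousWithinAt (hs i hi y ⟨hyi, hy⟩)
      exact h1.congr (fun z hz => hg i hi z hz) (hg i hi y ⟨hyi, hy⟩)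
    -- A closed piece that misses y contributes nothing to the limit at y.
    · have : 𝓝[K i ∩ V] y = ⊥ := by
        apply le_bot_iff.1
        refine (nhdsWithin_mono y Set.inter_subset_left).trans (le_of_eq ?_)
        by_contra hne
        have := mem_closure_iff_nhdsWithin_neBot.2 ⟨hne⟩
        rw [(hK i hi).closure_eq] at this
        exact hyi this
      rw [this]
      exact Filter.tendsto_bot
  · intro i hi x hx
    exact ⟨⟨i, hi, hx⟩, hΦ i hi x hx⟩
  · rintro x ⟨i, hi, hx⟩
    exact ⟨i, hi, hx⟩

/-! ### Wedges around the vertical axis -/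

/-- The points `(ρ e^{ia}, t)`, with `a = a (ρ, t)`. -/
def OnWall (a : ℝ × ℝ → ℝ) (p : ℂ × ℝ) : Prop :=
  p.1 = ‖p.1‖ * Complex.exp (a (‖p.1‖, p.2) * Complex.I)

/-- The points `(ρ e^{iθ}, t)` with `a (ρ, t) ≤ θ ≤ b (ρ, t)`. -/
def Wedge (a b : ℝ × ℝ → ℝ) : Set (ℂ × ℝ) :=
  {p | ∃ θ : ℝ, a (‖p.1‖, p.2) ≤ θ ∧ θ ≤ b (‖p.1‖, p.2) ∧
    p.1 = ‖p.1‖ * Complex.exp (θ * Complex.I)}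

/-- The cylinder of radius `ε` around the point `(0, t₀)`. -/
def Cyl (ε t₀ : ℝ) : Set (ℂ × ℝ) := {p | ‖p.1‖ < ε ∧ |p.2 - t₀| < ε}

/-- The branch of `(z, t) ↦ (z ^ (1 / N), t)` with argument of `z` in `(c - π, c + π)`. -/
noncomputable def rootMap (c : ℝ) (N : ℕ) (p : ℂ × ℝ) : ℂ × ℝ :=
  (Complex.exp ((c / N : ℝ) * Complex.I) *
    (p.1 * Complex.exp (-(c : ℂ) * Complex.I)) ^ ((N : ℂ)⁻¹), p.2)

theorem isOpen_Cyl (ε t₀ : ℝ) : IsOpen (Cyl ε t₀) := by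
  have h1 : IsOpen {p : ℂ × ℝ | ‖p.1‖ < ε} := isOpen_lt (by fun_prop) continuous_const
  have h2 : IsOpen {p : ℂ × ℝ | |p.2 - t₀| < ε} := isOpen_lt (by fun_prop) continuous_const
  exact h1.inter h2

/-- For φ in (-π, π] the principal logarithm of ρe^{iφ} has imaginary part φ; this range cannot be
enlarged. -/
theorem cpow_inv_of_polar {ρ φ : ℝ} (hρ : 0 ≤ ρ) (h1 : -Real.pi < φ) (h2 : φ ≤ Real.pi) {N : ℕ}
    (hN : 1 ≤ N) :
    ((ρ : ℂ) * Complex.exp (φ * Complex.I)) ^ ((N : ℂ)⁻¹) =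
      ((ρ ^ ((N : ℝ)⁻¹) : ℝ) : ℂ) * Complex.exp ((φ / N : ℝ) * Complex.I) := by
  have hN' : (N : ℝ) ≠ 0 := by positivity
  have hN'' : (N : ℂ) ≠ 0 := by exact_mod_cast hN'
  rcases hρ.eq_or_lt with rfl | hρ
  · rw [Real.zero_rpow (inv_ne_zero hN')]
    simp [hN'']
  · have hne : (ρ : ℂ) * Complex.exp (φ * Complex.I) ≠ 0 :=
      mul_ne_zero (by exact_mod_cast hρ.ne') (Complex.exp_ne_zero _)
    rw [Complex.cpow_def_of_ne_zero hne, Complex.log_ofReal_mul hρ (Complex.exp_ne_zero _),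
      Complex.log_exp (by simpa using h1) (by simpa using h2), Real.rpow_def_of_pos hρ,
      Complex.ofReal_exp, ← Complex.exp_add]
    congr 1
    push_cast
    field_simp

/-- Rotating by -c brings the argument into the principal range, and rotating back by c/N restores
the angle θ/N for the real number θ, not merely its class modulo 2π. This is what lets the roots on
different wedges match. -/
theorem rootMap_of_polar {c θ : ℝ} {N : ℕ} (hN : 1 ≤ N) {p : ℂ × ℝ}
    (hp : p.1 = ‖p.1‖ * Complex.exp (θ * Complex.I)) (h1 : c - Real.pi < θ)
    (h2 : θ < c + Real.pi) :
    rootMap c N p =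
      (((‖p.1‖ ^ ((N : ℝ)⁻¹) : ℝ) : ℂ) * Complex.exp ((θ / N : ℝ) * Complex.I), p.2) := by
  unfold rootMap
  congr 1
  have e : p.1 * Complex.exp (-(c : ℂ) * Complex.I) =
      (‖p.1‖ : ℂ) * Complex.exp ((θ - c : ℝ) * Complex.I) := by
    conv_lhs => rw [hp]
    rw [mul_assoc, ← Complex.exp_add]
    congr 2
    push_cast; ring
  rw [e, cpow_inv_of_polar (norm_nonneg _) (by linarith) (by linarith) hN]
  rw [mul_left_comm, ← Complex.exp_add]
  congr 2
  push_cast; ring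

theorem branchMap_polar {ρ θ t : ℝ} (hρ : 0 ≤ ρ) {N : ℕ} (hN : 1 ≤ N) :
    branchMap N (((ρ ^ ((N : ℝ)⁻¹) : ℝ) : ℂ) * Complex.exp ((θ / N : ℝ) * Complex.I), t) =
      ((ρ : ℂ) * Complex.exp (θ * Complex.I), t) := by
  have hN' : (N : ℕ) ≠ 0 := by omega
  have hN'' : (N : ℂ) ≠ 0 := by exact_mod_cast hN'
  unfold branchMap
  congr 1
  simp only
  rw [mul_pow, ← Complex.ofReal_pow, Real.rpow_inv_natCast_pow hρ hN', ← Complex.exp_nat_mul]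
  congr 2
  push_cast
  field_simp

/-- Off the axis, the rotated point lies in the slit plane. On the axis, continuity comes from the
positive real part of the exponent 1/N. -/
theorem continuousAt_rootMap {c θ : ℝ} {N : ℕ} (hN : 1 ≤ N) {p : ℂ × ℝ}
    (hp : p.1 = ‖p.1‖ * Complex.exp (θ * Complex.I)) (h1 : c - Real.pi < θ)
    (h2 : θ < c + Real.pi) : ContinuousAt (rootMap c N) p := by
  have hN' : (N : ℝ) ≠ 0 := by positivity
  unfold rootMap
  refine ContinuousAt.prodMk (continuousAt_const.mul ?_) continuousAt_snd
  have hlin : ContinuousAt (fun q : ℂ × ℝ => q.1 * Complex.exp (-(c : ℂ) * Complex.I)) p := by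
    fun_prop
  have e : p.1 * Complex.exp (-(c : ℂ) * Complex.I) =
      (‖p.1‖ : ℂ) * Complex.exp ((θ - c : ℝ) * Complex.I) := by
    conv_lhs => rw [hp]
    rw [mul_assoc, ← Complex.exp_add]
    congr 2
    push_cast; ring
  by_cases h0 : p.1 = 0
  · have h3 : ContinuousAt (fun x : ℂ × ℂ => x.1 ^ x.2) (0, (N : ℂ)⁻¹) := by
      apply Complex.continuousAt_cpow_zero_of_re_pos
      rw [← Complex.ofReal_natCast, ← Complex.ofReal_inv, Complex.ofReal_re]
      positivity
    have h4 : ContinuousAt (fun q : ℂ × ℝ =>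
        (q.1 * Complex.exp (-(c : ℂ) * Complex.I), (N : ℂ)⁻¹)) p :=
      hlin.prodMk continuousAt_const
    exact ContinuousAt.comp_of_eq h3 h4 (by simp [h0])
  · have hpos : 0 < ‖p.1‖ := norm_pos_iff.mpr h0
    refine hlin.cpow continuousAt_const ?_
    rw [e, Complex.mem_slitPlane_iff_arg, Complex.arg_real_mul _ hpos, Complex.arg_exp_mul_I]
    · constructor
      · rw [(toIocMod_eq_self Real.two_pi_pos).2]
        · linarith
        · constructor <;> linarith
      · exact mul_ne_zero (by exact_mod_cast hpos.ne') (Complex.exp_ne_zero _)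

/-- The angle is confined to a compact interval, so the set is the projection of a closed set along
a compact factor. -/
theorem isClosed_angle_range (N : ℕ) (c : ℝ) {a b : ℝ × ℝ → ℝ} (ha : Continuous a)
    (hb : Continuous b) :
    IsClosed {y : ℂ × ℝ | ∃ θ : ℝ, (c - Real.pi ≤ θ ∧ θ ≤ c + Real.pi) ∧
      a (‖y.1‖ ^ N, y.2) ≤ θ ∧ θ ≤ b (‖y.1‖ ^ N, y.2) ∧
      y.1 = ‖y.1‖ * Complex.exp ((θ / N : ℝ) * Complex.I)} := by
  let F : Set ((ℂ × ℝ) × Set.Icc (c - Real.pi) (c + Real.pi)) :=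
    {q | a (‖q.1.1‖ ^ N, q.1.2) ≤ (q.2 : ℝ) ∧ (q.2 : ℝ) ≤ b (‖q.1.1‖ ^ N, q.1.2) ∧
      q.1.1 = ‖q.1.1‖ * Complex.exp (((q.2 : ℝ) / N : ℝ) * Complex.I)}
  have hF : IsClosed F := by
    simp only [F, Set.ofPred_and]
    refine IsClosed.inter (isClosed_le ?_ ?_) (IsClosed.inter (isClosed_le ?_ ?_)
      (isClosed_eq ?_ ?_)) <;> fun_prop
  have := isClosedMap_fst_of_compactSpace F hF
  convert this using 1
  ext y
  constructor
  · rintro ⟨θ, h1, h2⟩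
    exact ⟨(y, ⟨θ, h1⟩), h2, rfl⟩
  · rintro ⟨⟨y', θ⟩, h, rfl⟩
    exact ⟨θ, θ.2, h⟩

theorem exists_index_of_le {M : ℕ} {a : ℕ → ℝ} {θ : ℝ} (h0 : a 0 ≤ θ) (hM : θ < a M) :
    ∃ i < M, a i ≤ θ ∧ θ ≤ a (i + 1) := by
  induction M with
  | zero => linarith
  | succ M ih =>
    by_cases h : θ < a M
    · obtain ⟨i, hi, h'⟩ := ih h
      exact ⟨i, by omega, h'⟩
    · exact ⟨M, by omega, not_lt.1 h, hM.le⟩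

theorem le_of_steps {M : ℕ} {a : ℕ → ℝ} (h : ∀ i < M, a i < a (i + 1)) {i k : ℕ} (hik : i < k)
    (hk : k ≤ M) : a i < a k := by
  induction k with
  | zero => omega
  | succ k ih =>
    rcases Nat.lt_succ_iff_lt_or_eq.1 hik with h1 | rfl
    · exact (ih h1 (by omega)).trans (h k (by omega))
    · exact h i (by omega)

/-- After the N-th root, N turns become a single one. -/
theorem exp_two_pi_shift {N : ℕ} (hN : 1 ≤ N) (θ : ℝ) :
    Complex.exp (((θ + 2 * Real.pi * N) / N : ℝ) * Complex.I) =
      Complex.exp ((θ / N : ℝ) * Complex.I) := by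
  have hN'' : (N : ℂ) ≠ 0 := by exact_mod_cast (by omega : N ≠ 0)
  rw [Complex.exp_eq_exp_iff_exists_int]
  refine ⟨1, ?_⟩
  push_cast
  field_simp

/-- A quotient space that is made of finitely many wedges around the axis, glued along their walls
in cyclic order with total angle `2πN`, has a chart in which the map given by the positions
is the branching map of order `N`. -/
theorem exists_chart_of_cyclic_wedges {X : Type*} [TopologicalSpace X] (r : X → X → Prop)
    {M N : ℕ} (hN : 1 ≤ N) (a : ℕ → ℝ × ℝ → ℝ) (ha : ∀ i ≤ M, Continuous (a i))
    (haM : ∀ q, a M q = a 0 q + 2 * Real.pi * N) {ε t₀ : ℝ}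
    (hmono : ∀ i < M, ∀ ρ t, 0 < ρ → ρ < ε → |t - t₀| < ε → a i (ρ, t) < a (i + 1) (ρ, t))
    (hmono0 : ∀ i < M, ∀ t, |t - t₀| < ε → a i (0, t) ≤ a (i + 1) (0, t))
    (c : ℕ → ℝ) (hc : ∀ i < M, ∀ ρ t, 0 ≤ ρ → ρ < ε → |t - t₀| < ε →
      c i - Real.pi < a i (ρ, t) ∧ a (i + 1) (ρ, t) < c i + Real.pi)
    (O : ℕ → Set X) (hO : ∀ i < M, IsOpen (O i)) (pos : ℕ → X → ℂ × ℝ)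
    (hpos : ∀ i < M, ContinuousOn (pos i) (O i)) (s : ℕ → ℂ × ℝ → X)
    (hposC : ∀ i < M, ∀ x ∈ O i, pos i x ∈ Cyl ε t₀ ∩ Wedge (a i) (a (i + 1)) ∧
      s i (pos i x) = x)
    (hs : ∀ i < M, ∀ p ∈ Cyl ε t₀ ∩ Wedge (a i) (a (i + 1)), s i p ∈ O i ∧ pos i (s i p) = p)
    (hsc : ∀ i < M, ContinuousOn (s i) (Cyl ε t₀ ∩ Wedge (a i) (a (i + 1))))
    (hdisj : ∀ i < M, ∀ i' < M, ∀ x, x ∈ O i → x ∈ O i' → i = i')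
    (hrel : ∀ i < M, ∀ x ∈ O i, ∀ y, (r x y ∨ r y x) → ∃ i' < M, y ∈ O i' ∧
      pos i' y = pos i x ∧ ((i' = i + 1 ∧ OnWall (a i') (pos i x)) ∨
        (i = i' + 1 ∧ OnWall (a i) (pos i x)) ∨
        (i + 1 = M ∧ i' = 0 ∧ OnWall (a 0) (pos i x)) ∨
        (i = 0 ∧ i' + 1 = M ∧ OnWall (a 0) (pos i x))))
    (hwall : ∀ i, i + 1 < M → ∀ x ∈ O i, ∀ y ∈ O (i + 1), pos i x = pos (i + 1) y →
      OnWall (a (i + 1)) (pos i x) → Quot.mk r x = Quot.mk r y)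
    (hwall0 : ∀ i, i + 1 = M → ∀ x ∈ O i, ∀ y ∈ O 0, pos i x = pos 0 y →
      OnWall (a 0) (pos i x) → Quot.mk r x = Quot.mk r y) :
    ∃ h : OpenPartialHomeomorph (Quot r) (ℂ × ℝ),
      (∀ i < M, ∀ x ∈ O i, Quot.mk r x ∈ h.source ∧
        branchMap N (h (Quot.mk r x)) = pos i x) ∧
      (∀ x, Quot.mk r x ∈ h.source → ∃ i < M, x ∈ O i) := by
  have hN' : N ≠ 0 := by omega
  have hNR : (0 : ℝ) < N := by exact_mod_cast hN
  have hle : ∀ i < M, ∀ ρ t, 0 ≤ ρ → ρ < ε → |t - t₀| < ε → a i (ρ, t) ≤ a (i + 1) (ρ, t) := by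
    intro i hi ρ t h0 h1 h2
    rcases h0.eq_or_lt with rfl | h0
    · exact hmono0 i hi t h2
    · exact (hmono i hi ρ t h0 h1 h2).le
  -- On the i-th wedge the chart is the branch of the N-th root centred at c i; that wedge is
  -- contained in the open sector of half-width π about c i.
  let Ψ : ℕ → X → ℂ × ℝ := fun i x => rootMap (c i) N (pos i x)
  have hroot : ∀ i < M, ∀ p ∈ Cyl ε t₀, ∀ θ : ℝ, a i (‖p.1‖, p.2) ≤ θ →
      θ ≤ a (i + 1) (‖p.1‖, p.2) → p.1 = ‖p.1‖ * Complex.exp (θ * Complex.I) →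
      c i - Real.pi < θ ∧ θ < c i + Real.pi ∧ rootMap (c i) N p =
      (((‖p.1‖ ^ ((N : ℝ)⁻¹) : ℝ) : ℂ) * Complex.exp ((θ / N : ℝ) * Complex.I), p.2) := by
    intro i hi p hp θ h1 h2 h3
    obtain ⟨h4, h5⟩ := hc i hi _ p.2 (norm_nonneg p.1) hp.1 hp.2
    have h6 : c i - Real.pi < θ := by linarith
    have h7 : θ < c i + Real.pi := by linarith
    exact ⟨h6, h7, rootMap_of_polar hN h3 h6 h7⟩
  have hbr : ∀ i < M, ∀ x ∈ O i, branchMap N (Ψ i x) = pos i x := by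
    intro i hi x hx
    obtain ⟨⟨hC, θ, h1, h2, h3⟩, -⟩ := hposC i hi x hx
    have := (hroot i hi _ hC θ h1 h2 h3).2.2
    simp only [Ψ]
    rw [this, branchMap_polar (norm_nonneg _) hN, ← h3]
  have hwallL : ∀ i < M, ∀ p ∈ Cyl ε t₀, OnWall (a i) p → rootMap (c i) N p =
      (((‖p.1‖ ^ ((N : ℝ)⁻¹) : ℝ) : ℂ) *
        Complex.exp ((a i (‖p.1‖, p.2) / N : ℝ) * Complex.I), p.2) := by
    intro i hi p hp hw
    exact (hroot i hi p hp _ le_rfl (hle i hi _ _ (norm_nonneg _) hp.1 hp.2) hw).2.2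
  have hwallR : ∀ i < M, ∀ p ∈ Cyl ε t₀, OnWall (a (i + 1)) p → rootMap (c i) N p =
      (((‖p.1‖ ^ ((N : ℝ)⁻¹) : ℝ) : ℂ) *
        Complex.exp ((a (i + 1) (‖p.1‖, p.2) / N : ℝ) * Complex.I), p.2) := by
    intro i hi p hp hw
    exact (hroot i hi p hp _ (hle i hi _ _ (norm_nonneg _) hp.1 hp.2) le_rfl hw).2.2
  have hOnM : ∀ p, OnWall (a 0) p → OnWall (a M) p := by
    intro p hp
    unfold OnWall at hp ⊢
    rw [haM]
    have := Complex.exp_periodic.nat_mul N (a 0 (‖p.1‖, p.2) * Complex.I)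
    rw [← this] at hp
    convert hp using 3
    push_cast; ring
  -- The only wall where the two angles disagree is the closing one, and there they differ by 2πN.
  have hwrap : ∀ i, i + 1 = M → ∀ p ∈ Cyl ε t₀, OnWall (a 0) p →
      rootMap (c i) N p = rootMap (c 0) N p := by
    intro i hi p hp hw
    have h1 := hOnM p hw
    rw [hwallL 0 (by omega) p hp hw]
    rw [← hi] at h1
    rw [hwallR i (by omega) p hp h1, hi, haM, exp_two_pi_shift hN]
  -- The closed pieces are the images of the wedges under the root. Upstairs, the sections are `s i`
  -- applied after raising to the N-th power.
  have key := exists_chart_of_sections r M O Ψ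
    (branchMap N ⁻¹' Cyl ε t₀)
    (fun i => {y : ℂ × ℝ | ∃ θ : ℝ, (c i - Real.pi ≤ θ ∧ θ ≤ c i + Real.pi) ∧
      a i (‖y.1‖ ^ N, y.2) ≤ θ ∧ θ ≤ a (i + 1) (‖y.1‖ ^ N, y.2) ∧
      y.1 = ‖y.1‖ * Complex.exp ((θ / N : ℝ) * Complex.I)})
    (fun i y => s i (branchMap N y)) hO ?_ ?_ ?_ ?_ ?_ ?_ ?_ ?_ ?_ ?_
  · obtain ⟨h, h1, h2⟩ := key
    refine ⟨h, fun i hi x hx => ?_, h2⟩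
    obtain ⟨h3, h4⟩ := h1 i hi x hx
    exact ⟨h3, by rw [h4, hbr i hi x hx]⟩
  · intro i hi x hx
    obtain ⟨⟨hC, θ, h1, h2, h3⟩, -⟩ := hposC i hi x hx
    obtain ⟨h4, h5, -⟩ := hroot i hi _ hC θ h1 h2 h3
    exact (continuousAt_rootMap hN h3 h4 h5).comp_continuousWithinAt (hpos i hi x hx)
  · refine (isOpen_Cyl ε t₀).preimage ?_
    unfold branchMap; fun_prop
  · intro i hi x hx
    change branchMap N (Ψ i x) ∈ Cyl ε t₀
    rw [hbr i hi x hx]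
    exact (hposC i hi x hx).1.1
  · intro i hi x hx y hxy
    obtain ⟨i', hi', hy, e, hw⟩ := hrel i hi x hx y hxy
    refine ⟨i', hi', hy, ?_⟩
    have hC := (hposC i hi x hx).1.1
    simp only [Ψ]
    rw [e]
    rcases hw with ⟨rfl, hw⟩ | ⟨rfl, hw⟩ | ⟨hi0, rfl, hw⟩ | ⟨rfl, hi0, hw⟩
    · rw [hwallR i hi _ hC hw, hwallL _ hi' _ hC hw]
    · rw [hwallR i' hi' _ hC hw, hwallL _ hi _ hC hw]
    · rw [hwrap i hi0 _ hC hw]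
    · rw [hwrap i' hi0 _ hC hw]
  · intro i hi i' hi' x hx hx'
    rw [hdisj i hi i' hi' x hx hx']
  -- An axis point lies on every wall, so it can be moved down the chain of wedges to the wedge 0,
  -- one wall at a time.
  · have haxis : ∀ i < M, ∀ x ∈ O i, ∀ y ∈ O 0, pos i x = pos 0 y → (pos i x).1 = 0 →
        Quot.mk r x = Quot.mk r y := by
      intro i
      induction i with
      | zero =>
        intro hi x hx y hy e _
        rw [← (hposC 0 hi x hx).2, ← (hposC 0 hi y hy).2, e]
      | succ i ih =>
        intro hi x hx y hy e h0
        have hi' : i < M := by omega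
        have hC := (hposC _ hi x hx).1.1
        have hm : pos (i + 1) x ∈ Cyl ε t₀ ∩ Wedge (a i) (a (i + 1)) := by
          refine ⟨hC, _, le_rfl, hle i hi' _ _ (norm_nonneg _) hC.1 hC.2, ?_⟩
          simp [h0]
        obtain ⟨h1, h2⟩ := hs i hi' _ hm
        rw [← ih hi' _ h1 y hy (h2.trans e) (by rw [h2]; exact h0)]
        symm
        apply hwall i hi _ h1 x hx h2
        unfold OnWall
        rw [h2]; simp [h0]
    -- Off the axis the walls are strictly ordered. Equal angles in different wedges therefore force
    -- consecutive wedges and a point on their wall; angles a full period apart force the first and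
    -- last wedge and the closing wall.
    have hmain : ∀ i < M, ∀ i' < M, ∀ x ∈ O i, ∀ y ∈ O i', ∀ θ θ' : ℝ, pos i x = pos i' y →
        0 < ‖(pos i x).1‖ →
        (pos i x).1 = ‖(pos i x).1‖ * Complex.exp (θ * Complex.I) →
        a i (‖(pos i x).1‖, (pos i x).2) ≤ θ → θ ≤ a (i + 1) (‖(pos i x).1‖, (pos i x).2) →
        a i' (‖(pos i x).1‖, (pos i x).2) ≤ θ' → θ' ≤ a (i' + 1) (‖(pos i x).1‖, (pos i x).2) →
        (θ = θ' ∧ i < i') ∨ θ' = θ + 2 * Real.pi * N → Quot.mk r x = Quot.mk r y := by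
      intro i hi i' hi' x hx y hy θ θ' e hρ hθ h1 h2 h3 h4 h5
      have hC := (hposC i hi x hx).1.1
      have hst : ∀ k < M, a k (‖(pos i x).1‖, (pos i x).2) <
          a (k + 1) (‖(pos i x).1‖, (pos i x).2) := fun k hk => hmono k hk _ _ hρ hC.1 hC.2
      rcases h5 with ⟨rfl, hlt⟩ | h5
      · have hi1 : i + 1 = i' := by
          by_contra hne
          have := le_of_steps (a := fun k => a k (‖(pos i x).1‖, (pos i x).2)) hst
            (show i + 1 < i' by omega) hi'.le
          linarith
        subst hi1
        have hθ' : θ = a (i + 1) (‖(pos i x).1‖, (pos i x).2) := le_antisymm h2 h3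
        apply hwall i hi' x hx y hy e
        unfold OnWall
        rw [← hθ']; exact hθ
      · have hM := haM (‖(pos i x).1‖, (pos i x).2)
        have hi0 : i = 0 := by
          by_contra hne
          have := le_of_steps (a := fun k => a k (‖(pos i x).1‖, (pos i x).2)) hst
            (show 0 < i by omega) hi.le
          rcases (show i' + 1 ≤ M by omega).eq_or_lt with h6 | h6
          · rw [h6] at h4; linarith
          · have := le_of_steps (a := fun k => a k (‖(pos i x).1‖, (pos i x).2)) hst h6 le_rfl
            linarith
        subst hi0
        have hi1 : i' + 1 = M := by
          by_contra hne
          have := le_of_steps (a := fun k => a k (‖(pos 0 x).1‖, (pos 0 x).2)) hst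
            (show i' + 1 < M by omega) le_rfl
          linarith
        symm
        apply hwall0 i' hi1 y hy x hx e.symm
        rw [hi1] at h4
        have : θ = a 0 (‖(pos 0 x).1‖, (pos 0 x).2) := by linarith
        rw [← e]
        unfold OnWall
        rw [← this]; exact hθ
    intro i hi i' hi' x hx y hy e
    have e' : pos i x = pos i' y := by rw [← hbr i hi x hx, ← hbr i' hi' y hy, e]
    obtain ⟨⟨hC, θ, h1, h2, h3⟩, hsx⟩ := hposC i hi x hx
    obtain ⟨⟨hC', θ', h1', h2', h3'⟩, hsy⟩ := hposC i' hi' y hy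
    have r1 := (hroot i hi _ hC θ h1 h2 h3).2.2
    have r2 := (hroot i' hi' _ hC' θ' h1' h2' h3').2.2
    simp only [Ψ] at e
    rw [r1, r2] at e
    rw [← e'] at e h1' h2' h3' hC'
    rcases (norm_nonneg (pos i x).1).eq_or_lt with h0 | h0
    · have h00 : (pos i x).1 = 0 := norm_eq_zero.1 h0.symm
      have hm : pos i x ∈ Cyl ε t₀ ∩ Wedge (a 0) (a 1) := by
        refine ⟨hC, _, le_rfl, hle 0 (by omega) _ _ (norm_nonneg _) hC.1 hC.2, ?_⟩
        simp [h00]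
      obtain ⟨h4, h5⟩ := hs 0 (by omega) _ hm
      rw [haxis i hi x hx _ h4 h5.symm h00,
        haxis i' hi' y hy _ h4 (e'.symm.trans h5.symm) (by rw [← e']; exact h00)]
    · have hr : (((‖(pos i x).1‖ ^ ((N : ℝ)⁻¹) : ℝ) : ℂ)) ≠ 0 := by
        exact_mod_cast (Real.rpow_pos_of_pos h0 _).ne'
      have e2 := mul_left_cancel₀ hr (congrArg Prod.fst e)
      rw [Complex.exp_eq_exp_iff_exists_int] at e2
      obtain ⟨n, hn⟩ := e2
      -- Equality of the roots determines the angles modulo 2πN rather than modulo 2π.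
      have hn' : θ = θ' + n * (2 * Real.pi * N) := by
        have h6 : ((θ / N : ℝ) : ℂ) = ((θ' / N + n * (2 * Real.pi) : ℝ) : ℂ) := by
          apply mul_right_cancel₀ Complex.I_ne_zero
          rw [hn]; push_cast; ring
        have h7 := Complex.ofReal_injective h6
        field_simp at h7
        linarith
      have hst : ∀ k < M, a k (‖(pos i x).1‖, (pos i x).2) <
          a (k + 1) (‖(pos i x).1‖, (pos i x).2) := fun k hk => hmono k hk _ _ h0 hC.1 hC.2
      -- All wedge angles lie in one closed interval of length 2πN, which leaves only n = -1, 0, 1.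
      have hbd : ∀ k < M, ∀ φ : ℝ, a k (‖(pos i x).1‖, (pos i x).2) ≤ φ →
          φ ≤ a (k + 1) (‖(pos i x).1‖, (pos i x).2) →
          a 0 (‖(pos i x).1‖, (pos i x).2) ≤ φ ∧
          φ ≤ a 0 (‖(pos i x).1‖, (pos i x).2) + 2 * Real.pi * N := by
        intro k hk φ h8 h9
        rw [← haM]
        constructor
        · rcases Nat.eq_zero_or_pos k with rfl | h10
          · exact h8
          · have := le_of_steps (a := fun k => a k (‖(pos i x).1‖, (pos i x).2)) hst h10 hk.le
            linarith
        · rcases (show k + 1 ≤ M by omega).eq_or_lt with h6 | h6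
          · rwa [h6] at h9
          · have := le_of_steps (a := fun k => a k (‖(pos i x).1‖, (pos i x).2)) hst h6 le_rfl
            linarith
      obtain ⟨b1, b2⟩ := hbd i hi θ h1 h2
      obtain ⟨b3, b4⟩ := hbd i' hi' θ' h1' h2'
      have hT : 0 < 2 * Real.pi * N := by positivity
      have hn1 : (n : ℝ) ≤ 1 := by
        by_contra h; push Not at h; nlinarith
      have hn2 : (-1 : ℝ) ≤ n := by
        by_contra h; push Not at h; nlinarith
      have hn1' : n ≤ 1 := by exact_mod_cast hn1
      have hn2' : -1 ≤ n := by exact_mod_cast hn2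
      have hcase : n = -1 ∨ n = 0 ∨ n = 1 := by omega
      rcases hcase with rfl | rfl | rfl
      · apply hmain i hi i' hi' x hx y hy θ θ' e' h0 h3 h1 h2 h1' h2'
        right; push_cast at hn'; linarith
      · have hθ : θ = θ' := by simpa using hn'
        rcases lt_trichotomy i i' with h | rfl | h
        · exact hmain i hi i' hi' x hx y hy θ θ' e' h0 h3 h1 h2 h1' h2' (Or.inl ⟨hθ, h⟩)
        · rw [← hsx, ← hsy, e']
        · symm
          apply hmain i' hi' i hi y hy x hx θ' θ e'.symm
          all_goals try rw [← e']
          all_goals first | assumption | exact Or.inl ⟨hθ.symm, h⟩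
      · symm
        apply hmain i' hi' i hi y hy x hx θ' θ e'.symm
        all_goals try rw [← e']
        all_goals first | assumption | exact Or.inr (by push_cast at hn'; linarith)
  · intro i hi
    exact isClosed_angle_range N (c i) (ha i hi.le) (ha (i + 1) hi)
  · intro y hy
    have hN1 : (0 : ℝ) < 2 * Real.pi * N := by positivity
    -- This is the representative of N·arg in [a 0, a 0 + 2πN) = [a 0, a M), so some wedge contains
    -- it.
    let θ := toIcoMod hN1 (a 0 (‖y.1‖ ^ N, y.2)) (N * Complex.arg y.1)
    have hθ := toIcoMod_mem_Ico hN1 (a 0 (‖y.1‖ ^ N, y.2)) (N * Complex.arg y.1)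
    obtain ⟨i, hi, h1, h2⟩ := exists_index_of_le (M := M)
      (a := fun k => a k (‖y.1‖ ^ N, y.2)) (θ := θ) hθ.1 (by rw [haM]; exact hθ.2)
    refine ⟨i, hi, θ, ?_, h1, h2, ?_⟩
    · have hy1 : ‖y.1 ^ N‖ < ε ∧ |y.2 - t₀| < ε := hy
      rw [norm_pow] at hy1
      obtain ⟨h3, h4⟩ := hc i hi _ y.2 (by positivity) hy1.1 hy1.2
      constructor <;> linarith
    · have h5 : (N * Complex.arg y.1 : ℝ) - toIcoDiv hN1 (a 0 (‖y.1‖ ^ N, y.2))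
          (N * Complex.arg y.1) • (2 * Real.pi * N) = θ := self_sub_toIcoDiv_zsmul _ _ _
      conv_lhs => rw [← Complex.norm_mul_exp_arg_mul_I y.1]
      congr 1
      rw [Complex.exp_eq_exp_iff_exists_int]
      refine ⟨toIcoDiv hN1 (a 0 (‖y.1‖ ^ N, y.2)) (N * Complex.arg y.1), ?_⟩
      rw [← h5]
      have hNC : (N : ℂ) ≠ 0 := by exact_mod_cast hN'
      push_cast
      simp only [zsmul_eq_mul]
      field_simp
      ring
  · intro i hi
    refine (hsc i hi).comp (by unfold branchMap; fun_prop) ?_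
    rintro y ⟨⟨θ, -, h1, h2, h3⟩, hy⟩
    refine ⟨hy, θ, ?_, ?_, ?_⟩
    · simpa [branchMap] using h1
    · simpa [branchMap] using h2
    · have hNC : (N : ℂ) ≠ 0 := by exact_mod_cast hN'
      simp only [branchMap, norm_pow]
      conv_lhs => rw [h3]
      rw [mul_pow, ← Complex.exp_nat_mul]
      push_cast
      congr 2
      field_simp
  · rintro i hi y ⟨⟨θ, -, h1, h2, h3⟩, hy⟩
    have hNC : (N : ℂ) ≠ 0 := by exact_mod_cast hN'
    have e : (branchMap N y).1 = ‖(branchMap N y).1‖ * Complex.exp (θ * Complex.I) := by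
      simp only [branchMap, norm_pow]
      conv_lhs => rw [h3]
      rw [mul_pow, ← Complex.exp_nat_mul]
      push_cast
      congr 2
      field_simp
    have hm : branchMap N y ∈ Cyl ε t₀ ∩ Wedge (a i) (a (i + 1)) := by
      refine ⟨hy, θ, ?_, ?_, e⟩
      · simpa [branchMap] using h1
      · simpa [branchMap] using h2
    obtain ⟨h4, h5⟩ := hs i hi _ hm
    refine ⟨h4, ?_⟩
    simp only [Ψ]
    obtain ⟨-, θ', h6, h7, h8⟩ := hm
    rw [h5, (hroot i hi _ hy θ (by simpa [branchMap] using h1) (by simpa [branchMap] using h2) e).2.2]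
    have : ‖(branchMap N y).1‖ ^ ((N : ℝ)⁻¹) = ‖y.1‖ := by
      simp only [branchMap, norm_pow]
      exact Real.pow_rpow_inv_natCast (norm_nonneg _) hN'
    rw [this, ← h3]
    rfl

/-! ### The edges of the cell decomposition -/

theorem Letter.eq_L_of_ne {a : Letter} (h : a ≠ Letter.R) : a = Letter.L := by
  cases a
  · exact absurd rfl h
  · rfl

theorem Letter.R_ne_L : Letter.R ≠ Letter.L := fun h => Letter.noConfusion h

section

variable {m : ℕ} [NeZero m] {w : ZMod m → Letter}

theorem run_lt (w : ZMod m → Letter) {j : ZMod m} (hj : w j = Letter.R) : run w j < m := by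
  have h1 : 1 ≤ m := Nat.one_le_iff_ne_zero.mpr (NeZero.ne m)
  have : m - 1 ∈ {n : ℕ | w (j + n + 1) = Letter.R} := by
    simp [Nat.cast_sub h1, hj]
  have := Nat.sInf_le this
  unfold run
  omega

theorem eq_L_of_lt_run (w : ZMod m → Letter) {j : ZMod m} {n : ℕ} (hn : n < run w j) :
    w (j + n + 1) = Letter.L := by
  apply Letter.eq_L_of_ne
  intro h
  have : run w j ≤ n := Nat.sInf_le h
  omega

theorem eq_L_of_pos_of_le_run (w : ZMod m → Letter) {j : ZMod m} {i : ℕ} (h0 : 1 ≤ i)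
    (hi : i ≤ run w j) : w (j + i) = Letter.L := by
  have := eq_L_of_lt_run w (j := j) (n := i - 1) (by omega)
  rwa [Nat.cast_sub h0, Nat.cast_one, add_assoc, sub_add_cancel] at this

theorem natCast_injOn {i i' : ℕ} (hi : i < m) (hi' : i' < m) (h : (i : ZMod m) = i') : i = i' := by
  rw [ZMod.natCast_eq_natCast_iff'] at h
  rwa [Nat.mod_eq_of_lt hi, Nat.mod_eq_of_lt hi'] at h

/-- If the two runs had different lengths, the starting letter R of the shorter one would lie inside
the other run, which contains only L. So passing to the next R is injective. -/
theorem eq_of_next_eq {j k : ZMod m} (hj : w j = Letter.R) (hk : w k = Letter.R)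
    (h : j + run w j + 1 = k + run w k + 1) : j = k := by
  have key : ∀ j k : ZMod m, w j = Letter.R → j + run w j + 1 = k + run w k + 1 →
      ¬ run w j < run w k := by
    intro j k hj h hlt
    have h1 := eq_L_of_pos_of_le_run w (j := k) (i := run w k - run w j) (by omega) (by omega)
    rw [Nat.cast_sub hlt.le] at h1
    have : k + ((run w k : ZMod m) - run w j) = j := by linear_combination -h
    rw [this, hj] at h1
    exact Letter.R_ne_L h1
  have h3 : run w j = run w k :=
    le_antisymm (not_lt.1 (key k j hk h.symm)) (not_lt.1 (key j k hj h))
  rw [h3] at h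
  simpa using h

/-! ### Edge classes and their cardinalities. -/

theorem EdgeEquiv.of_pairing {a b : CellEdge w} (p : Pairing w) (h : (a, b) ∈ p.edgePairs) :
    EdgeEquiv w a b :=
  Relation.EqvGen.rel _ _ ⟨p, h⟩

theorem EdgeEquiv.mem_iff {S : Set (CellEdge w)}
    (hS : ∀ p : Pairing w, ∀ e ∈ p.edgePairs, e.1 ∈ S ↔ e.2 ∈ S) {a b : CellEdge w}
    (h : EdgeEquiv w a b) : a ∈ S ↔ b ∈ S := by
  induction h with
  | rel x y hxy => obtain ⟨p, hp⟩ := hxy; exact hS p _ hp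
  | refl x => rfl
  | symm x y _ ih => exact ih.symm
  | trans x y z _ _ ih1 ih2 => exact ih1.trans ih2

/-- A class is recognised without analysing chains of identifications: stability under every pairing
gives one inclusion, and explicit connections give the other. -/
theorem setOf_edgeEquiv_eq {S : Set (CellEdge w)} {a : CellEdge w} (ha : a ∈ S)
    (hS : ∀ p : Pairing w, ∀ e ∈ p.edgePairs, e.1 ∈ S ↔ e.2 ∈ S)
    (hconn : ∀ b ∈ S, EdgeEquiv w a b) : {b | EdgeEquiv w a b} = S := by
  ext b
  exact ⟨fun h => (EdgeEquiv.mem_iff hS h).1 ha, hconn b⟩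

/-- The bound r < m keeps the r + 1 consecutive indices distinct modulo m; the three further edges
are never of the fan type. -/
theorem ncard_edge_fan {r : ℕ} (hr : r < m) (j : ZMod m) (a : TetEdge) {x y z : CellEdge w}
    (hxy : x ≠ y) (hxz : x ≠ z) (hyz : y ≠ z)
    (hx : ∀ i, x ≠ .tet i a) (hy : ∀ i, y ≠ .tet i a) (hz : ∀ i, z ≠ .tet i a) :
    {b : CellEdge w | b = x ∨ b = y ∨ b = z ∨ ∃ i : ℕ, i ≤ r ∧ b = .tet (j + 1 + i) a}.ncard
      = r + 4 := by
  have e : {b : CellEdge w | b = x ∨ b = y ∨ b = z ∨ ∃ i : ℕ, i ≤ r ∧ b = .tet (j + 1 + i) a} =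
      insert x (insert y (insert z ((fun i : ℕ => CellEdge.tet (w := w) (j + 1 + i) a) ''
        Set.Iio (r + 1)))) := by
    ext b
    simp only [Set.mem_ofPred_eq, Set.mem_insert_iff, Set.mem_image, Set.mem_Iio,
      Nat.lt_succ_iff, eq_comm (a := b)]
  have hf : ((fun i : ℕ => CellEdge.tet (w := w) (j + 1 + i) a) '' Set.Iio (r + 1)).Finite :=
    (Set.finite_Iio _).image _
  have hc : ((fun i : ℕ => CellEdge.tet (w := w) (j + 1 + i) a) '' Set.Iio (r + 1)).ncard
      = r + 1 := by
    rw [Set.ncard_image_of_injOn, Set.ncard_eq_toFinset_card']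
    · simp
    · intro i hi i' hi' h
      simp only [CellEdge.tet.injEq, add_right_inj, and_true] at h
      simp only [Set.mem_Iio] at hi hi'
      exact natCast_injOn (by omega) (by omega) h
  rw [e, Set.ncard_insert_of_notMem _ ((hf.insert _).insert _), Set.ncard_insert_of_notMem _
    (hf.insert _), Set.ncard_insert_of_notMem _ hf, hc]
  · rintro ⟨i, -, h⟩; exact hz _ h.symm
  · rintro (h | ⟨i, -, h⟩)
    · exact hyz h
    · exact hy _ h.symm
  · rintro (h | h | ⟨i, -, h⟩)
    · exact hxy h
    · exact hxz h
    · exact hx _ h.symm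

/-- Leaving slab j through its face 12, 41, 42, the edge becomes edge 13 of tetrahedron j+1. It
stays edge 13 through the L-layerings and becomes edge 23 at the next R-layering. Through the bigon
of slab j it becomes edge 42 of the next slab, which closes the cycle. -/
theorem valence_slab41 (w : ZMod m → Letter) (j : ZMod m) (hj : w j = Letter.R) :
    valence w (.slab j hj .e41) = run w j + 4 := by
  unfold valence
  have hj' := run_spec w j hj
  rw [← ncard_edge_fan (w := w) (run_lt w hj) j .e13 (x := .slab j hj .e41)
    (y := .slab (j + run w j + 1) hj' .e42) (z := .tet (j + run w j + 1 + 1) .e23)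
    (by simp) (by simp) (by simp) (by simp) (by simp) (by simp)]
  congr 1
  refine setOf_edgeEquiv_eq (Or.inl rfl) ?_ ?_
  · intro p e he
    cases p with
    | tetL134 k hk =>
      simp only [Pairing.edgePairs, List.mem_cons, List.not_mem_nil, or_false] at he
      rcases he with rfl | rfl | rfl <;> simp
      · constructor
        · rintro ⟨i, hi, rfl⟩
          -- The fan cannot be left this way: its last tetrahedron has a letter R, whereas this
          -- pairing requires L.
          refine ⟨i + 1, ?_, by push_cast; ring⟩
          by_contra h
          have : i = run w j := by omega
          subst this
          have h1 : j + 1 + (run w j : ZMod m) = j + run w j + 1 := by ring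
          rw [h1, hj'] at hk
          exact Letter.R_ne_L hk
        · rintro ⟨i, hi, h⟩
          rcases Nat.eq_zero_or_pos i with rfl | h0
          · have : k = j := by simpa using h
            rw [this, hj] at hk
            exact absurd hk Letter.R_ne_L
          · refine ⟨i - 1, by omega, ?_⟩
            rw [Nat.cast_sub h0]
            push_cast
            linear_combination h
      · intro h
        rw [h, hj'] at hk
        exact Letter.R_ne_L hk
    | tetL124 k hk =>
      simp only [Pairing.edgePairs, List.mem_cons, List.not_mem_nil, or_false] at he
      rcases he with rfl | rfl | rfl <;> simp
      intro h
      rw [h, hj'] at hk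
      exact Letter.R_ne_L hk
    | tetR134 k hk =>
      simp only [Pairing.edgePairs, List.mem_cons, List.not_mem_nil, or_false] at he
      rcases he with rfl | rfl | rfl <;> simp
      constructor
      · rintro ⟨i, hi, h⟩
        -- Within the fan only the last tetrahedron carries a letter R.
        have : i = run w j := by
          by_contra hne
          have h1 := eq_L_of_lt_run w (j := j) (n := i) (by omega)
          have h2 : j + (i : ZMod m) + 1 = k := by rw [h]; ring
          rw [h2, hk] at h1
          exact Letter.R_ne_L h1
        subst this
        rw [h]; ring
      · intro h
        exact ⟨run w j, le_rfl, by rw [h]; ring⟩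
    | tetR124 k hk =>
      simp only [Pairing.edgePairs, List.mem_cons, List.not_mem_nil, or_false] at he
      rcases he with rfl | rfl | rfl <;> simp
    | slab124 k hk =>
      simp only [Pairing.edgePairs, List.mem_cons, List.not_mem_nil, or_false] at he
      rcases he with rfl | rfl | rfl <;> simp
      constructor
      · rintro rfl
        exact ⟨0, Nat.zero_le _, by simp⟩
      · rintro ⟨i, hi, h⟩
        rcases Nat.eq_zero_or_pos i with rfl | h0
        · simpa using h
        · have h1 := eq_L_of_pos_of_le_run w h0 hi
          have h2 : j + (i : ZMod m) = k := by linear_combination -h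
          rw [h2, hk] at h1
          exact absurd h1 Letter.R_ne_L
    | bigon k hk =>
      simp only [Pairing.edgePairs, List.mem_cons, List.not_mem_nil, or_false] at he
      rcases he with rfl | rfl <;> simp
      constructor
      · rintro rfl; rfl
      · intro h
        exact eq_of_next_eq hk hj (by rw [h])
  · have hfan : ∀ i : ℕ, i ≤ run w j →
        EdgeEquiv w (.slab j hj .e41) (.tet (j + 1 + i) .e13) := by
      intro i
      induction i with
      | zero =>
        intro _
        refine EdgeEquiv.of_pairing (.slab124 j hj) ?_
        simp [Pairing.edgePairs]
      | succ i ih =>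
        intro hi
        have h1 : w (j + 1 + i) = Letter.L := by
          have := eq_L_of_lt_run w (j := j) (n := i) (by omega)
          rwa [add_right_comm] at this
        refine (ih (by omega)).trans _ _ _ (EdgeEquiv.of_pairing (.tetL134 _ h1) ?_)
        simp [Pairing.edgePairs, add_assoc]
    rintro b (rfl | rfl | rfl | ⟨i, hi, rfl⟩)
    · exact Relation.EqvGen.refl _
    · refine EdgeEquiv.of_pairing (.bigon j hj) ?_
      simp [Pairing.edgePairs]
    · refine (hfan _ le_rfl).trans _ _ _ ?_
      rw [add_right_comm]
      refine EdgeEquiv.of_pairing (.tetR134 _ hj') ?_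
      simp [Pairing.edgePairs]
    · exact hfan i hi

/-- The class consists of the edges 14 of slab j and of tetrahedron j, edge 24 of the next slab, and
the edges 24 of tetrahedra j+1, …, j+r+1. Its purpose is to identify the index of the last slab
around e_j: it is r, the same number that counts the tetrahedra of type A around e_j. -/
theorem valence_slab24 (w : ZMod m → Letter) (j : ZMod m) (hj : w j = Letter.R) :
    valence w (.slab (j + run w j + 1) (run_spec w j hj) .e24) = run w j + 4 := by
  unfold valence
  have hj' := run_spec w j hj
  rw [← ncard_edge_fan (w := w) (run_lt w hj) j .e24 (x := .slab j hj .e14)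
    (y := .slab (j + run w j + 1) hj' .e24) (z := .tet j .e14)
    (by simp) (by simp) (by simp) (by simp) (by simp) (by simp)]
  congr 1
  refine setOf_edgeEquiv_eq (Or.inr (Or.inl rfl)) ?_ ?_
  · intro p e he
    cases p with
    | tetL134 k hk =>
      simp only [Pairing.edgePairs, List.mem_cons, List.not_mem_nil, or_false] at he
      rcases he with rfl | rfl | rfl <;> simp
      intro h
      rw [h, hj] at hk
      exact Letter.R_ne_L hk
    | tetL124 k hk =>
      simp only [Pairing.edgePairs, List.mem_cons, List.not_mem_nil, or_false] at he
      rcases he with rfl | rfl | rfl <;> simp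
      · intro h
        rw [h, hj] at hk
        exact Letter.R_ne_L hk
      · constructor
        · rintro ⟨i, hi, rfl⟩
          refine ⟨i + 1, ?_, by push_cast; ring⟩
          by_contra h
          have : i = run w j := by omega
          subst this
          have h1 : j + 1 + (run w j : ZMod m) = j + run w j + 1 := by ring
          rw [h1, hj'] at hk
          exact Letter.R_ne_L hk
        · rintro ⟨i, hi, h⟩
          rcases Nat.eq_zero_or_pos i with rfl | h0
          · have : k = j := by simpa using h
            rw [this, hj] at hk
            exact absurd hk Letter.R_ne_L
          · refine ⟨i - 1, by omega, ?_⟩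
            rw [Nat.cast_sub h0]
            push_cast
            linear_combination h
    | tetR134 k hk =>
      simp only [Pairing.edgePairs, List.mem_cons, List.not_mem_nil, or_false] at he
      rcases he with rfl | rfl | rfl <;> simp
      constructor
      · rintro rfl
        exact ⟨0, Nat.zero_le _, by simp⟩
      · rintro ⟨i, hi, h⟩
        rcases Nat.eq_zero_or_pos i with rfl | h0
        · simpa using h
        · have h1 := eq_L_of_pos_of_le_run w h0 hi
          have h2 : j + (i : ZMod m) = k := by linear_combination -h
          rw [h2, hk] at h1
          exact absurd h1 Letter.R_ne_L
    | tetR124 k hk =>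
      simp only [Pairing.edgePairs, List.mem_cons, List.not_mem_nil, or_false] at he
      rcases he with rfl | rfl | rfl <;> simp
      constructor
      · rintro ⟨i, hi, h⟩
        have : i = run w j := by
          by_contra hne
          have h1 := eq_L_of_lt_run w (j := j) (n := i) (by omega)
          have h2 : j + (i : ZMod m) + 1 = k := by rw [h]; ring
          rw [h2, hk] at h1
          exact Letter.R_ne_L h1
        subst this
        rw [h]; ring
      · intro h
        exact ⟨run w j, le_rfl, by rw [h]; ring⟩
    | slab124 k hk =>
      simp only [Pairing.edgePairs, List.mem_cons, List.not_mem_nil, or_false] at he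
      rcases he with rfl | rfl | rfl <;> simp
    | bigon k hk =>
      simp only [Pairing.edgePairs, List.mem_cons, List.not_mem_nil, or_false] at he
      rcases he with rfl | rfl <;> simp
      constructor
      · rintro rfl; rfl
      · intro h
        exact eq_of_next_eq hk hj (by rw [h])
  · have h14 : EdgeEquiv w (.slab (j + run w j + 1) hj' .e24) (.slab j hj .e14) := by
      refine (EdgeEquiv.of_pairing (.bigon j hj) ?_).symm _ _
      simp [Pairing.edgePairs]
    have htet : EdgeEquiv w (.slab (j + run w j + 1) hj' .e24) (.tet j .e14) := by
      refine h14.trans _ _ _ ((EdgeEquiv.of_pairing (.tetR124 j hj) ?_).symm _ _)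
      simp [Pairing.edgePairs]
    have hfan : ∀ i : ℕ, i ≤ run w j →
        EdgeEquiv w (.slab (j + run w j + 1) hj' .e24) (.tet (j + 1 + i) .e24) := by
      intro i
      induction i with
      | zero =>
        intro _
        refine htet.trans _ _ _ (EdgeEquiv.of_pairing (.tetR134 j hj) ?_)
        simp [Pairing.edgePairs]
      | succ i ih =>
        intro hi
        have h1 : w (j + 1 + i) = Letter.L := by
          have := eq_L_of_lt_run w (j := j) (n := i) (by omega)
          rwa [add_right_comm] at this
        refine (ih (by omega)).trans _ _ _ (EdgeEquiv.of_pairing (.tetL124 _ h1) ?_)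
        simp [Pairing.edgePairs, add_assoc]
    rintro b (rfl | rfl | rfl | ⟨i, hi, rfl⟩)
    · exact h14
    · exact Relation.EqvGen.refl _
    · exact htet
    · exact hfan i hi

end

/-! ### The matrices of the developing map -/

theorem om_re : om.re = -(1 / 2) := by simp [om]

theorem om_im : om.im = -(Real.sqrt 3 / 2) := by
  simp [om]; ring

theorem sqrt_three_sq : Real.sqrt 3 ^ 2 = 3 := Real.sq_sqrt (by norm_num)

theorem sqrt_three_mul : Real.sqrt 3 * Real.sqrt 3 = 3 := Real.mul_self_sqrt (by norm_num)

theorem sqrt_three_pos : 0 < Real.sqrt 3 := Real.sqrt_pos.2 (by norm_num)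

theorem star_om : star om = -1 - om := by
  apply Complex.ext
  · simp [om_re]; norm_num
  · simp [om_im]

theorem conj_om : (starRingEnd ℂ) om = -1 - om := star_om

theorem om_quad : om ^ 2 + om + 1 = 0 := by
  apply Complex.ext
  · simp [pow_two, om_re, om_im]; nlinarith [sqrt_three_mul]
  · simp [pow_two, om_re, om_im]; ring

theorem om_ne_zero : om ≠ 0 := by
  intro h
  have := om_quad
  rw [h] at this
  norm_num at this

theorem norm_om : ‖om‖ = 1 := by
  have h : ‖om‖ ^ 2 = 1 := by
    rw [Complex.sq_norm, Complex.normSq_apply, om_re, om_im]; nlinarith [sqrt_three_mul]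
  nlinarith [norm_nonneg om]

/-- The Heisenberg translation taking the origin to `P₁`. -/
noncomputable def Tinv : Matrix (Fin 3) (Fin 3) ℂ := !![1, -1, star om; 0, 1, 1; 0, 0, 1]

/-- The inverse of `Tinv`. -/
noncomputable def T : Matrix (Fin 3) (Fin 3) ℂ := !![1, 1, om; 0, 1, -1; 0, 0, 1]

/-- The transformation with `∞, 0 ↦ P₃, P₁` that is proportional to `G₄ * Tinv`. -/
noncomputable def Kinv : Matrix (Fin 3) (Fin 3) ℂ := !![0, 0, 1; 0, om, om; 1, -1, om]

/-- The inverse of `Kinv`. -/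
noncomputable def K : Matrix (Fin 3) (Fin 3) ℂ := !![star om, star om, 1; -1, star om, 0; 1, 0, 0]

/-- The inverse of `G₃`. -/
noncomputable def G₃inv : Matrix (Fin 3) (Fin 3) ℂ := !![1, 0, 0; 0, -star om, 0; 0, 0, 1]

theorem T_mul_Tinv : T * Tinv = 1 := by
  ext i j
  fin_cases i <;> fin_cases j <;>
    simp [T, Tinv, Matrix.mul_apply, Fin.sum_univ_three, conj_om] <;> ring

theorem Tinv_mul_T : Tinv * T = 1 := by
  ext i j
  fin_cases i <;> fin_cases j <;>
    simp [T, Tinv, Matrix.mul_apply, Fin.sum_univ_three, conj_om] <;> ring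

theorem K_mul_Kinv : K * Kinv = 1 := by
  have := om_quad
  ext i j
  fin_cases i <;> fin_cases j <;>
    simp [K, Kinv, Matrix.mul_apply, Fin.sum_univ_three, conj_om] <;> grind

theorem Kinv_mul_K : Kinv * K = 1 := by
  have := om_quad
  ext i j
  fin_cases i <;> fin_cases j <;>
    simp [K, Kinv, Matrix.mul_apply, Fin.sum_univ_three, conj_om] <;> grind

theorem G₃_mul_G₃inv : G₃ * G₃inv = 1 := by
  have := om_quad
  ext i j
  fin_cases i <;> fin_cases j <;>
    simp [G₃, G₃inv, Matrix.mul_apply, Fin.sum_univ_three, conj_om] <;> grind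

theorem G₃inv_mul_G₃ : G₃inv * G₃ = 1 := by
  have := om_quad
  ext i j
  fin_cases i <;> fin_cases j <;>
    simp [G₃, G₃inv, Matrix.mul_apply, Fin.sum_univ_three, conj_om] <;> grind

theorem Tinv_mem : Tinv ∈ U21 := by
  change Tinvᴴ * formJ * Tinv = formJ
  ext i j
  fin_cases i <;> fin_cases j <;>
    simp [Tinv, formJ, Matrix.mul_apply, Fin.sum_univ_three, conj_om] <;> ring

theorem T_mem : T ∈ U21 := by
  change Tᴴ * formJ * T = formJ
  ext i j
  fin_cases i <;> fin_cases j <;>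
    simp [T, formJ, Matrix.mul_apply, Fin.sum_univ_three, conj_om] <;> ring

theorem K_mem : K ∈ U21 := by
  have := om_quad
  change Kᴴ * formJ * K = formJ
  ext i j
  fin_cases i <;> fin_cases j <;>
    simp [K, formJ, Matrix.mul_apply, Fin.sum_univ_three, conj_om] <;> grind

theorem Kinv_mem : Kinv ∈ U21 := by
  have := om_quad
  change Kinvᴴ * formJ * Kinv = formJ
  ext i j
  fin_cases i <;> fin_cases j <;>
    simp [Kinv, formJ, Matrix.mul_apply, Fin.sum_univ_three, conj_om] <;> grind

theorem G₁_mem : G₁ ∈ U21 := by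
  have := om_quad
  change G₁ᴴ * formJ * G₁ = formJ
  ext i j
  fin_cases i <;> fin_cases j <;>
    simp [G₁, formJ, Matrix.mul_apply, Fin.sum_univ_three, conj_om] <;> grind

theorem G₂_mem : G₂ ∈ U21 := by
  have := om_quad
  change G₂ᴴ * formJ * G₂ = formJ
  ext i j
  fin_cases i <;> fin_cases j <;>
    simp [G₂, formJ, Matrix.mul_apply, Fin.sum_univ_three, conj_om] <;> grind

theorem G₃_mem : G₃ ∈ U21 := by
  have := om_quad
  change G₃ᴴ * formJ * G₃ = formJ
  ext i j
  fin_cases i <;> fin_cases j <;>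
    simp [G₃, formJ, Matrix.mul_apply, Fin.sum_univ_three, conj_om] <;> grind

theorem G₃inv_mem : G₃inv ∈ U21 := by
  have := om_quad
  change G₃invᴴ * formJ * G₃inv = formJ
  ext i j
  fin_cases i <;> fin_cases j <;>
    simp [G₃inv, formJ, Matrix.mul_apply, Fin.sum_univ_three, conj_om] <;> grind

theorem G₄_mem : G₄ ∈ U21 := by
  have := om_quad
  change G₄ᴴ * formJ * G₄ = formJ
  ext i j
  fin_cases i <;> fin_cases j <;>
    simp [G₄, formJ, Matrix.mul_apply, Fin.sum_univ_three, conj_om] <;> grind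

/-- Crossing the slab face paired by `G₄` turns the development of the slab into that of the
tetrahedron; the scalar acts trivially. -/
theorem K_mul_G₄ : K * G₄ = (-om) • T := by
  have := om_quad
  ext i j
  fin_cases i <;> fin_cases j <;>
    simp [G₄, K, T, Matrix.mul_apply, Fin.sum_univ_three, conj_om] <;> grind

/-- An L-pairing, seen in the coordinates of the edge, is the rotation by -π/3 about the axis. This
makes every tetrahedron of type A contribute an angle of exactly π/3. -/
theorem G₃_mul_K_mul_G₁ : G₃ * K * G₁ = (-om) • K := by
  have := om_quad
  ext i j
  fin_cases i <;> fin_cases j <;>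
    simp [G₁, G₃, K, Matrix.mul_apply, Fin.sum_univ_three, conj_om] <;> grind

theorem G₃inv_mul_G₄ : G₃inv * G₄ = G₄ * G₃inv := by
  ext i j
  fin_cases i <;> fin_cases j <;>
    simp [G₄, G₃inv, Matrix.mul_apply, Fin.sum_univ_three]

/-- `G₂` fixes P₂ and ∞, and `T * G₃inv` sends P₂ to the origin while fixing ∞. It conjugates `G₂`
to the rotation inverse to `G₃`. -/
theorem G₃_mul_T_mul_G₂ : G₃ * (T * G₃inv) * G₂ = T * G₃inv := by
  have := om_quad
  ext i j
  fin_cases i <;> fin_cases j <;>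
    simp [G₂, G₃, T, G₃inv, Matrix.mul_apply, Fin.sum_univ_three, conj_om] <;> grind

theorem G₃_pow_mul_T_mul_G₂_pow (r : ℕ) : G₃ ^ r * (T * G₃inv) * G₂ ^ r = T * G₃inv := by
  induction r with
  | zero => simp
  | succ r ih =>
    rw [pow_succ, pow_succ']
    calc G₃ ^ r * G₃ * (T * G₃inv) * (G₂ * G₂ ^ r)
        = G₃ ^ r * (G₃ * (T * G₃inv) * G₂) * G₂ ^ r := by simp only [Matrix.mul_assoc]
      _ = _ := by rw [G₃_mul_T_mul_G₂, ih]

/-! ### Explicit formulas for the action -/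

theorem act_eq_of_mulVec {G : Matrix (Fin 3) (Fin 3) ℂ} {X Y : Heis} {c : ℂ} (hc : c ≠ 0)
    (h : G *ᵥ lift X = c • lift Y) : act G X = Y := by
  rw [act, h, proj_smul hc, proj_lift]

theorem act_cancel {G H : Matrix (Fin 3) (Fin 3) ℂ} (hH : H ∈ U21) (h : G * H = 1) (X : Heis) :
    act G (act H X) = X := by
  rw [← act_mul G hH, h, act_one]

/-- The first coordinate of the null vector of a finite point. -/
noncomputable def ht (p : ℂ × ℝ) : ℂ := (Complex.I * p.2 - (‖p.1‖ : ℂ) ^ 2) / 2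

theorem lift_coe' (p : ℂ × ℝ) : lift p = ![ht p, p.1, 1] := rfl

theorem ht_re (p : ℂ × ℝ) : (ht p).re = -(‖p.1‖ ^ 2 / 2) := by
  have : ((‖p.1‖ : ℂ) ^ 2).re = ‖p.1‖ ^ 2 := by rw [← Complex.ofReal_pow, Complex.ofReal_re]
  simp [ht, this]; ring

theorem ht_im (p : ℂ × ℝ) : (ht p).im = p.2 / 2 := by
  have : ((‖p.1‖ : ℂ) ^ 2).im = 0 := by rw [← Complex.ofReal_pow, Complex.ofReal_im]
  simp [ht, this]

theorem continuous_ht : Continuous ht := by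
  unfold ht; fun_prop

theorem norm_sq_eq (z : ℂ) : ‖z‖ ^ 2 = z.re ^ 2 + z.im ^ 2 := by
  rw [Complex.sq_norm, Complex.normSq_apply]; ring

theorem act_G₃ (z : ℂ) (t : ℝ) : act G₃ ((z, t) : ℂ × ℝ) = ((-om * z, t) : ℂ × ℝ) := by
  apply act_eq_of_mulVec one_ne_zero
  rw [lift_coe', lift_coe']
  ext i
  fin_cases i <;>
    simp [G₃, Matrix.mulVec, dotProduct, Fin.sum_univ_three, ht, norm_om]

theorem act_G₃inv (z : ℂ) (t : ℝ) :
    act G₃inv ((z, t) : ℂ × ℝ) = ((-star om * z, t) : ℂ × ℝ) := by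
  apply act_eq_of_mulVec one_ne_zero
  rw [lift_coe', lift_coe']
  ext i
  fin_cases i <;>
    simp [G₃inv, Matrix.mulVec, dotProduct, Fin.sum_univ_three, ht, norm_om]

theorem act_Tinv (z : ℂ) (t : ℝ) :
    act Tinv ((z, t) : ℂ × ℝ) = ((z + 1, t + Real.sqrt 3 - 2 * z.im) : ℂ × ℝ) := by
  apply act_eq_of_mulVec one_ne_zero
  rw [lift_coe', lift_coe']
  ext i
  fin_cases i
  · apply Complex.ext
    · simp [Tinv, Matrix.mulVec, dotProduct, Fin.sum_univ_three, ht_re, norm_sq_eq, om_re]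
      ring
    · simp [Tinv, Matrix.mulVec, dotProduct, Fin.sum_univ_three, ht_im, om_im]
      ring
  · simp [Tinv, Matrix.mulVec, dotProduct, Fin.sum_univ_three]
  · simp [Tinv, Matrix.mulVec, dotProduct, Fin.sum_univ_three]

/-- The last coordinate of the image of a null vector under `Kinv`. -/
noncomputable def Kden (p : ℂ × ℝ) : ℂ := ht p - p.1 + om

/-- The action of `Kinv` on finite points. -/
noncomputable def Kmap (p : ℂ × ℝ) : ℂ × ℝ :=
  (om * (p.1 + 1) / Kden p, 2 * ((Kden p)⁻¹).im)

theorem Kden_re (p : ℂ × ℝ) : (Kden p).re = -(‖p.1 + 1‖ ^ 2 / 2) := by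
  simp [Kden, ht_re, norm_sq_eq, om_re]; ring

/-- The real part is -|z+1|²/2, so a zero can occur only over z = -1. -/
theorem Kden_ne_zero {p : ℂ × ℝ} (hp : p.1 ≠ -1) : Kden p ≠ 0 := by
  intro h
  have h1 := Kden_re p
  rw [h, Complex.zero_re] at h1
  have h2 : ‖p.1 + 1‖ ^ 2 = 0 := by linarith
  have h3 : p.1 + 1 = 0 := by simpa using h2
  exact hp (eq_neg_of_add_eq_zero_left h3)

/-- The first row of `Kinv` reads off the last coordinate, which is 1 on a finite lift; normalising
then gives the inverse of the denominator. -/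
theorem ht_Kmap {p : ℂ × ℝ} (hp : p.1 ≠ -1) : ht (Kmap p) = (Kden p)⁻¹ := by
  have h := Kden_ne_zero hp
  apply Complex.ext
  · rw [ht_re, Complex.inv_re, Kden_re]
    simp only [Kmap, norm_div, norm_mul, norm_om, one_mul, Complex.normSq_eq_norm_sq, div_pow]
    ring
  · rw [ht_im]; simp only [Kmap]; ring

theorem act_Kinv {p : ℂ × ℝ} (hp : p.1 ≠ -1) : act Kinv (p : Heis) = (Kmap p : Heis) := by
  have h := Kden_ne_zero hp
  apply act_eq_of_mulVec h
  rw [lift_coe', lift_coe', ht_Kmap hp]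
  ext i
  fin_cases i
  · simp [Kinv, Matrix.mulVec, dotProduct, Fin.sum_univ_three, h]
  · simp [Kinv, Matrix.mulVec, dotProduct, Fin.sum_univ_three, Kmap]
    field_simp
  · simp [Kinv, Matrix.mulVec, dotProduct, Fin.sum_univ_three, Kden]
    ring

theorem continuous_Kden : Continuous Kden := by
  unfold Kden
  exact (continuous_ht.sub continuous_fst).add continuous_const

theorem continuousAt_Kmap {p : ℂ × ℝ} (hp : p.1 ≠ -1) : ContinuousAt Kmap p := by
  have h := Kden_ne_zero hp
  have hc := continuous_Kden.continuousAt (x := p)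
  unfold Kmap
  refine ContinuousAt.prodMk (ContinuousAt.div (by fun_prop) hc h) ?_
  exact continuousAt_const.mul (Complex.continuous_im.continuousAt.comp (hc.inv₀ h))

/-! ### Explicit descriptions of the edges and faces -/

theorem herm_add_left (x y z : Fin 3 → ℂ) : herm (x + y) z = herm x z + herm y z := by
  simp only [herm_apply, Pi.add_apply]; ring

theorem herm_add_right (x y z : Fin 3 → ℂ) : herm x (y + z) = herm x y + herm x z := by
  simp only [herm_apply, Pi.add_apply, star_add]; ring

theorem herm_comm (x y : Fin 3 → ℂ) : herm y x = star (herm x y) := by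
  simp only [herm_apply, star_add, star_mul', star_star]; ring

/-- The null vector over the point with parameter `s` of the edge `[P, Q]`. -/
noncomputable def arcVec (P Q : Heis) (s : ℝ) : Fin 3 → ℂ :=
  lift P + (Complex.I * s * herm (lift P) (lift Q)) • lift Q

/-- The two cross terms are opposite, because of the factor i and the pairing in the coefficient of
the second vector. -/
theorem herm_arcVec (P Q : Heis) (s : ℝ) : herm (arcVec P Q s) (arcVec P Q s) = 0 := by
  unfold arcVec
  simp only [herm_add_left, herm_add_right, herm_smul_left, herm_smul_right, herm_lift_self]
  rw [herm_comm (lift P) (lift Q)]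
  simp only [star_mul', Complex.star_def, Complex.conj_I, Complex.conj_ofReal]
  ring

theorem arcVec_ne_zero {P Q : Heis} (h : P ≠ Q) (s : ℝ) : arcVec P Q s ≠ 0 := by
  intro h0
  have h1 : herm (arcVec P Q s) (lift Q) = 0 := by rw [h0]; simp [herm_apply]
  unfold arcVec at h1
  rw [herm_add_left, herm_smul_left, herm_lift_self, mul_zero, add_zero] at h1
  exact h (eq_of_herm_lift_eq_zero h1)

/-- Replacing `proj` by proportionality of null vectors turns membership in an edge into linear
equations with an unknown scalar. -/
theorem mem_arc_iff {P Q X : Heis} (h : P ≠ Q) :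
    X ∈ arc P Q ↔ X = P ∨ X = Q ∨
      ∃ s : ℝ, 0 < s ∧ ∃ c : ℂ, c ≠ 0 ∧ arcVec P Q s = c • lift X := by
  have : ∀ s : ℝ, X = proj (arcVec P Q s) ↔ ∃ c : ℂ, c ≠ 0 ∧ arcVec P Q s = c • lift X := by
    intro s
    constructor
    · rintro rfl
      exact exists_smul_lift_proj (herm_arcVec P Q s) (arcVec_ne_zero h s)
    · rintro ⟨c, hc, e⟩
      rw [e, proj_smul hc, proj_lift]
  unfold arc
  simp only [Set.mem_union, Set.mem_insert_iff, Set.mem_singleton_iff, Set.mem_ofPred_eq, or_assoc]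
  simp only [← this]
  rfl

theorem coe_mem_arc_infty {p q : ℂ × ℝ} :
    (q : Heis) ∈ arc p P₄ ↔ q.1 = p.1 ∧ p.2 ≤ q.2 := by
  obtain ⟨z, t⟩ := p
  obtain ⟨z', t'⟩ := q
  have hP : ((z, t) : ℂ × ℝ) ≠ P₄ := OnePoint.coe_ne_infty _
  rw [mem_arc_iff hP]
  have hv : ∀ s : ℝ, arcVec ((z, t) : ℂ × ℝ) P₄ s = ![ht (z, t) + Complex.I * s, z, 1] := by
    intro s
    ext i
    fin_cases i <;> simp [arcVec, P₄, lift_infty, lift_coe', herm_apply]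
  simp only [hv, lift_coe']
  constructor
  · rintro (h | h | ⟨s, hs, c, hc, h⟩)
    · have := OnePoint.coe_injective h
      simp only [Prod.mk.injEq] at this
      exact ⟨this.1, this.2.ge⟩
    · exact absurd h (OnePoint.coe_ne_infty _)
    · have h2 : (1 : ℂ) = c := by simpa using congrFun h 2
      subst h2
      have h1 : z = z' := by simpa using congrFun h 1
      subst h1
      have h0 : ht (z, t) + Complex.I * s = ht (z, t') := by simpa using congrFun h 0
      have := congrArg Complex.im h0
      simp [ht_im] at this
      exact ⟨rfl, by linarith⟩
  · rintro ⟨h1, h2⟩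
    change z' = z at h1
    subst h1
    rcases h2.eq_or_lt with rfl | h2
    · exact Or.inl rfl
    · refine Or.inr (Or.inr ⟨(t' - t) / 2, by linarith, 1, one_ne_zero, ?_⟩)
      ext i
      fin_cases i
      · apply Complex.ext
        · simp [ht_re]
        · simp [ht_im]; ring
      · simp
      · simp

theorem coe_mem_arc_from_infty {p q : ℂ × ℝ} :
    (q : Heis) ∈ arc P₄ p ↔ q.1 = p.1 ∧ q.2 ≤ p.2 := by
  obtain ⟨z, t⟩ := p
  obtain ⟨z', t'⟩ := q
  have hP : P₄ ≠ ((z, t) : ℂ × ℝ) := OnePoint.infty_ne_coe _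
  rw [mem_arc_iff hP]
  have hv : ∀ s : ℝ, arcVec P₄ ((z, t) : ℂ × ℝ) s =
      ![1 + Complex.I * s * ht (z, t), Complex.I * s * z, Complex.I * s] := by
    intro s
    ext i
    fin_cases i <;> simp [arcVec, P₄, lift_infty, lift_coe', herm_apply]
  simp only [hv, lift_coe']
  constructor
  · rintro (h | h | ⟨s, hs, c, hc, h⟩)
    · exact absurd h (OnePoint.coe_ne_infty _)
    · have := OnePoint.coe_injective h
      simp only [Prod.mk.injEq] at this
      exact ⟨this.1, this.2.le⟩
    · have h2 : Complex.I * s = c := by simpa using congrFun h 2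
      subst h2
      have hs' : (s : ℂ) ≠ 0 := by exact_mod_cast hs.ne'
      have h1 : z = z' := by simpa [hs'] using congrFun h 1
      subst h1
      have h0 : 1 + Complex.I * s * ht (z, t) = Complex.I * s * ht (z, t') := by
        simpa using congrFun h 0
      have := congrArg Complex.re h0
      simp [ht_im, ht_re] at this
      refine ⟨rfl, ?_⟩
      nlinarith
  · rintro ⟨h1, h2⟩
    change z' = z at h1
    subst h1
    rcases h2.eq_or_lt with rfl | h2
    · exact Or.inr (Or.inl rfl)
    · have h3 : 0 < t - t' := by linarith
      have h4 : ((2 / (t - t') : ℝ) : ℂ) ≠ 0 := by exact_mod_cast (by positivity)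
      -- The last coordinate forces the scalar is; comparing the first coordinates then gives s(t -
      -- t')/2 = 1.
      refine Or.inr (Or.inr ⟨2 / (t - t'), by positivity, Complex.I * ((2 / (t - t') : ℝ) : ℂ),
        mul_ne_zero Complex.I_ne_zero h4, ?_⟩)
      ext i
      fin_cases i
      · apply Complex.ext
        · simp [ht_im, ht_re, -Complex.ofReal_div]
          field_simp
          ring
        · simp [ht_im, ht_re, -Complex.ofReal_div]
      · simp
      · simp

/-- The lifts of P₁ and P₂ both satisfy v₀ = ω̄v₂, so the ℂ-circle through them is the unit circle
at height √3. The two sign conditions cut out the arc with angles from 0 to π/3. -/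
theorem mem_arc_P₁_P₂ {X : Heis} :
    X ∈ arc P₁ P₂ ↔ ∃ ζ : ℂ, ‖ζ‖ = 1 ∧ 0 ≤ ζ.im ∧ (-star om * ζ).im ≤ 0 ∧
      X = ((ζ, Real.sqrt 3) : ℂ × ℝ) := by
  have hne : P₁ ≠ P₂ := by
    intro h
    have h1 := congrArg Prod.fst (OnePoint.coe_injective h)
    have h2 := congrArg Complex.im h1
    simp [om_im] at h2
    linarith [sqrt_three_pos]
  have s3 := sqrt_three_mul
  have hs3 := sqrt_three_pos
  have e1 : ht (1, Real.sqrt 3) = star om := by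
    apply Complex.ext <;> simp [ht_re, ht_im, om_re, om_im]
  have e2 : ht (-om, Real.sqrt 3) = star om := by
    apply Complex.ext <;> simp [ht_re, ht_im, om_re, om_im, norm_om]
  have hq := om_quad
  have hv : ∀ s : ℝ, arcVec P₁ P₂ s = ![star om + Complex.I * s, 1 + Complex.I * s * (1 + om),
      1 + Complex.I * s * om] := by
    intro s
    ext i
    fin_cases i <;>
      simp [arcVec, P₁, P₂, lift_coe', herm_apply, e1, e2, conj_om] <;> grind
  rw [mem_arc_iff hne]
  simp only [hv]
  constructor
  · rintro (h | h | ⟨s, hs, c, hc, h⟩)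
    · refine ⟨1, by simp, by simp, ?_, h⟩
      simp [om_im]; positivity
    · refine ⟨-om, by simp [norm_om], ?_, ?_, h⟩
      · simp [om_im]; positivity
      · simp [om_im, om_re]; linarith
    · induction X using OnePoint.rec with
      | infty =>
        have := congrArg Complex.re (congrFun h 2)
        simp [lift_infty, om_im] at this
        nlinarith
      | coe q =>
        obtain ⟨z, t⟩ := q
        rw [lift_coe'] at h
        have h2 : 1 + Complex.I * s * om = c := by simpa using congrFun h 2
        have h1 : 1 + Complex.I * s * (1 + om) = c * z := by simpa using congrFun h 1
        have h0 : star om + Complex.I * s = c * ht (z, t) := by simpa using congrFun h 0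
        have hc2 : c.re = 1 + Real.sqrt 3 / 2 * s ∧ c.im = -(s / 2) := by
          rw [← h2]; constructor <;> simp [om_re, om_im] <;> ring
        have hh : ht (z, t) = star om := by
          apply mul_left_cancel₀ hc
          rw [← h0, ← h2, star_om]; linear_combination (Complex.I * s) * hq
        have ht2 : t = Real.sqrt 3 := by
          have := congrArg Complex.im hh
          rw [ht_im] at this
          simp [om_im] at this
          linarith
        have hz1 : ‖z‖ ^ 2 = 1 := by
          have := congrArg Complex.re hh
          rw [ht_re] at this
          simp [om_re] at this
          linarith
        have hz : ‖z‖ = 1 := by nlinarith [norm_nonneg z]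
        have hcc : c * (starRingEnd ℂ) c = (Complex.normSq c : ℂ) := Complex.mul_conj c
        have hconj : (starRingEnd ℂ) c = 1 - Complex.I * s * star om := by
          rw [← h2]; simp; ring
        have hN : 0 < Complex.normSq c := Complex.normSq_pos.2 hc
        refine ⟨z, hz, ?_, ?_, by rw [ht2]⟩
        -- Multiplying by |c|² makes z a polynomial in s, so the sign of its imaginary part can be
        -- read off.
        · have e : z * (Complex.normSq c : ℂ) =
              1 - 2 * Complex.I * s * star om - (s : ℂ) ^ 2 * om := by
            rw [← hcc, ← mul_assoc, mul_comm z, ← h1, hconj, star_om]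
            have := Complex.I_sq
            grind
          have e' := congrArg Complex.im e
          rw [Complex.im_mul_ofReal] at e'
          simp [om_im, om_re, ← Complex.ofReal_pow] at e'
          by_contra hneg
          push Not at hneg
          nlinarith [mul_pos hs3 (pow_pos hs 2), mul_neg_of_neg_of_pos hneg hN]
        · have e : (-star om * z) * (Complex.normSq c : ℂ) =
              -star om + 2 * Complex.I * s * om + (s : ℂ) ^ 2 := by
            rw [← hcc, ← mul_assoc, mul_assoc _ z c, mul_comm z, ← h1, hconj, star_om]
            have := Complex.I_sq
            grind
          have e' := congrArg Complex.im e
          rw [Complex.im_mul_ofReal] at e'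
          simp only [Complex.add_im, Complex.neg_im, Complex.star_def, Complex.conj_im,
            Complex.mul_im, Complex.mul_re, Complex.I_re, Complex.I_im, om_re, om_im,
            Complex.ofReal_re, Complex.ofReal_im, Complex.re_ofNat, Complex.im_ofNat,
            ← Complex.ofReal_pow] at e' ⊢
          by_contra hneg
          push Not at hneg
          nlinarith [mul_pos hneg hN]
  · rintro ⟨ζ, h1, h2, h3, rfl⟩
    have hn : ζ.re ^ 2 + ζ.im ^ 2 = 1 := by rw [← norm_sq_eq, h1]; norm_num
    simp [om_re, om_im] at h3
    rcases h2.eq_or_lt with h2 | h2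
    · left
      have : ζ.re = 1 := by
        rw [← h2] at h3 hn
        nlinarith
      have : ζ = 1 := Complex.ext (by simpa using this) (by simpa using h2.symm)
      rw [this]; rfl
    rcases h3.eq_or_lt with h3 | h3
    · right; left
      have h4 : ζ.im = Real.sqrt 3 * ζ.re := by linarith
      have h5 : ζ.re = 1 / 2 := by
        have h6 : 0 < ζ.re := by
          by_contra hneg
          push Not at hneg
          nlinarith
        have h7 : 4 * ζ.re ^ 2 = 1 := by
          rw [h4] at hn; linear_combination hn - ζ.re ^ 2 * s3
        nlinarith
      have : ζ = -om := by
        apply Complex.ext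
        · simp [om_re, h5]
        · simp [om_im]; nlinarith
      rw [this]; rfl
    · right; right
      have hx : 1 / 2 < ζ.re := by
        have h6 : 0 < ζ.re := by
          by_contra hneg
          push Not at hneg
          nlinarith
        have h7 : ζ.im ^ 2 < 3 * ζ.re ^ 2 := by
          have : ζ.im < Real.sqrt 3 * ζ.re := by linarith
          have := pow_lt_pow_left₀ this h2.le two_ne_zero
          rwa [mul_pow, sqrt_three_sq] at this
        nlinarith
      have hden : 0 < 1 + ζ.re - Real.sqrt 3 * ζ.im := by
        have : Real.sqrt 3 * ζ.im < 1 + ζ.re := by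
          apply lt_of_pow_lt_pow_left₀ 2 (by linarith)
          rw [mul_pow, sqrt_three_sq]
          nlinarith
        linarith
      -- This solves the proportionality for the parameter. It is 0 at P₁, and its denominator
      -- vanishes at P₂.
      obtain ⟨σ, hσ⟩ : ∃ σ, σ = 2 * ζ.im / (1 + ζ.re - Real.sqrt 3 * ζ.im) := ⟨_, rfl⟩
      have hσ0 : 0 < σ := by rw [hσ]; positivity
      have hσd : σ * (1 + ζ.re - Real.sqrt 3 * ζ.im) = 2 * ζ.im := by
        rw [hσ, div_mul_cancel₀ _ hden.ne']
      refine ⟨σ, hσ0, 1 + Complex.I * σ * om, ?_, ?_⟩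
      · intro h
        have := congrArg Complex.re h
        simp [om_re, om_im] at this
        nlinarith
      · rw [lift_coe']
        have e3 : ht (ζ, Real.sqrt 3) = star om := by
          apply Complex.ext <;> simp [ht_re, ht_im, om_re, om_im, h1]
        ext i
        fin_cases i
        · simp [e3, conj_om]; linear_combination (Complex.I * σ) * hq
        · simp only [Fin.mk_one, Matrix.cons_val_one, Matrix.cons_val_zero, Pi.smul_apply,
            smul_eq_mul]
          apply Complex.ext
          · simp [om_re, om_im]
            apply mul_left_cancel₀ hden.ne'
            linear_combination (Real.sqrt 3 / 2 - Real.sqrt 3 / 2 * ζ.re - ζ.im / 2) * hσd - hn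
          · simp [om_re, om_im]
            apply mul_left_cancel₀ hden.ne'
            linear_combination (1 / 2 - Real.sqrt 3 / 2 * ζ.im + ζ.re / 2) * hσd
        · simp

theorem om_mul_star : om * star om = 1 := by
  rw [star_om]; linear_combination -om_quad

theorem ht_unit {ζ : ℂ} (h : ‖ζ‖ = 1) : ht (ζ, Real.sqrt 3) = star om := by
  apply Complex.ext <;> simp [ht_re, ht_im, om_re, om_im, h]

theorem arcVec_P₃ {ζ : ℂ} (h : ‖ζ‖ = 1) (s : ℝ) :
    arcVec P₃ ((ζ, Real.sqrt 3) : ℂ × ℝ) s =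
      ![Complex.I * s, Complex.I * s * om * ζ, 1 + Complex.I * s * om] := by
  have h0 : ht (0, 0) = 0 := by simp [ht]
  have hq := om_quad
  ext i
  fin_cases i <;> simp [arcVec, P₃, lift_coe', herm_apply, h0, ht_unit h, conj_om]
  grind

theorem P₃_ne (ζ : ℂ) : P₃ ≠ ((ζ, Real.sqrt 3) : ℂ × ℝ) := by
  intro h
  have := congrArg Prod.snd (OnePoint.coe_injective h)
  simp at this
  exact sqrt_three_pos.ne this

theorem one_add_ne_zero {s : ℝ} (hs : 0 ≤ s) : 1 + Complex.I * s * om ≠ 0 := by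
  intro h
  have := congrArg Complex.re h
  simp [om_re, om_im] at this
  nlinarith [sqrt_three_pos]

/-- The linear equation is the complex line through the two null vectors, hence the whole ℂ-circle;
the inequality selects the arc with positive parameter from P₃. -/
theorem mem_arc_P₃ {ζ : ℂ} (hζ : ‖ζ‖ = 1) {X : Heis} :
    X ∈ arc P₃ ((ζ, Real.sqrt 3) : ℂ × ℝ) ↔
      ∃ q : ℂ × ℝ, X = q ∧ ht q = star om * star ζ * q.1 ∧ Real.sqrt 3 * ‖q.1‖ ^ 2 ≤ q.2 := by
  have s3 := sqrt_three_mul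
  have hs3 := sqrt_three_pos
  have hq := om_quad
  have hζζ : star ζ * ζ = 1 := by
    have := Complex.conj_mul' ζ
    rw [hζ] at this
    simpa using this
  rw [mem_arc_iff (P₃_ne ζ)]
  simp only [arcVec_P₃ hζ]
  constructor
  · rintro (rfl | rfl | ⟨s, hs, c, hc, h⟩)
    · exact ⟨(0, 0), rfl, by simp [ht], by simp⟩
    · refine ⟨_, rfl, ?_, by simp [hζ]⟩
      rw [ht_unit hζ]; simp only [mul_assoc, hζζ, mul_one]
    · induction X using OnePoint.rec with
      | infty =>
        have : 1 + Complex.I * s * om = 0 := by simpa [lift_infty] using congrFun h 2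
        exact absurd this (one_add_ne_zero hs.le)
      | coe q =>
        obtain ⟨z, t⟩ := q
        rw [lift_coe'] at h
        have h2 : 1 + Complex.I * s * om = c := by simpa using congrFun h 2
        have h1 : Complex.I * s * om * ζ = c * z := by simpa using congrFun h 1
        have h0 : Complex.I * s = c * ht (z, t) := by simpa using congrFun h 0
        refine ⟨(z, t), rfl, ?_, ?_⟩
        · apply mul_left_cancel₀ hc
          rw [← h0]
          have : c * (star om * star ζ * z) = star om * star ζ * (c * z) := by ring
          simp only [this, ← h1]
          linear_combination (-Complex.I * s * (star om * om)) * hζζ - (Complex.I * s) * om_mul_star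
        · have hcre : c.re = 1 + Real.sqrt 3 / 2 * s := by
            rw [← h2]; simp [om_re, om_im]; ring
          have hN : 0 < Complex.normSq c := Complex.normSq_pos.2 hc
          have e1 : ‖z‖ ^ 2 * Complex.normSq c = s ^ 2 := by
            have := congrArg (fun x => ‖x‖ ^ 2) h1
            simp only [norm_mul, norm_om, hζ, Complex.norm_I, Complex.norm_real, one_mul,
              mul_one, mul_pow, Real.norm_eq_abs, sq_abs] at this
            rw [Complex.normSq_eq_norm_sq]; linarith
          have e2 : t / 2 * Complex.normSq c = s * c.re := by
            have e : ht (z, t) * (Complex.normSq c : ℂ) = Complex.I * s * (starRingEnd ℂ) c := by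
              rw [← Complex.mul_conj, ← mul_assoc, mul_comm _ c, ← h0]
            have := congrArg Complex.im e
            rw [Complex.im_mul_ofReal, ht_im] at this
            simpa using this
          simp only
          rw [hcre] at e2
          have : Real.sqrt 3 * ‖z‖ ^ 2 * Complex.normSq c ≤ t * Complex.normSq c := by
            rw [mul_assoc, e1]; nlinarith
          exact le_of_mul_le_mul_right this hN
  · rintro ⟨⟨z, t⟩, rfl, h1, h2⟩
    simp only at h1 h2
    -- A rotation reduces the computation to the edge ending at P₁.
    obtain ⟨g, hg⟩ : ∃ g, g = star ζ * z := ⟨_, rfl⟩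
    have hz : z = ζ * g := by rw [hg, ← mul_assoc, mul_comm ζ, hζζ, one_mul]
    have hzn : ‖z‖ ^ 2 = g.re ^ 2 + g.im ^ 2 := by
      rw [hz, norm_mul, hζ, one_mul, norm_sq_eq]
    rw [mul_assoc, ← hg] at h1
    have r0 := congrArg Complex.re h1
    have i0 := congrArg Complex.im h1
    rw [ht_re] at r0
    rw [ht_im] at i0
    simp [om_re, om_im] at r0 i0
    rw [hzn] at r0 h2
    by_cases hz0 : g = 0
    · left
      have : z = 0 := by rw [hz, hz0, mul_zero]
      subst this
      simp [hz0] at i0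
      rw [i0]; rfl
    by_cases hg1 : g = 1
    · right; left
      rw [hg1] at i0 hz
      simp at i0
      rw [hz, mul_one, show t = Real.sqrt 3 by linarith]
    · have hd : 0 < (1 - g.re) ^ 2 + g.im ^ 2 := by
        rcases (by positivity : 0 ≤ (1 - g.re) ^ 2 + g.im ^ 2).eq_or_lt with h | h
        · exfalso; apply hg1
          apply Complex.ext
          · simp; nlinarith [sq_nonneg (1 - g.re), sq_nonneg g.im]
          · simp; nlinarith [sq_nonneg (1 - g.re), sq_nonneg g.im]
        · exact h
      -- The parameter must satisfy iσ(1 - g) = ω̄g. Its numerator is half the gap in the assumed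
      -- inequality, so the sign of σ is exactly that hypothesis.
      obtain ⟨σ, hσ⟩ : ∃ σ, σ = (t / 2 - Real.sqrt 3 / 2 * (g.re ^ 2 + g.im ^ 2)) /
        ((1 - g.re) ^ 2 + g.im ^ 2) := ⟨_, rfl⟩
      have hσd : σ * ((1 - g.re) ^ 2 + g.im ^ 2) =
          t / 2 - Real.sqrt 3 / 2 * (g.re ^ 2 + g.im ^ 2) := by
        rw [hσ, div_mul_cancel₀ _ hd.ne']
      have hσ0 : 0 ≤ σ := by rw [hσ]; apply div_nonneg _ hd.le; linarith
      have r0' : g.im * Real.sqrt 3 = g.re ^ 2 + g.im ^ 2 - g.re := by linarith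
      have key : Complex.I * σ * (1 - g) = star om * g := by
        apply Complex.ext
        · simp [om_re, om_im]
          apply mul_left_cancel₀ hd.ne'
          have : σ * ((1 - g.re) ^ 2 + g.im ^ 2) * g.im = (t / 2 - Real.sqrt 3 / 2 * (g.re ^ 2 + g.im ^ 2)) * g.im := by
            rw [hσd]
          rw [i0] at this
          linear_combination this + (1 - g.re) / 2 * r0'
        · simp [om_re, om_im]
          apply mul_left_cancel₀ hd.ne'
          have : σ * ((1 - g.re) ^ 2 + g.im ^ 2) * (1 - g.re) = (t / 2 - Real.sqrt 3 / 2 * (g.re ^ 2 + g.im ^ 2)) * (1 - g.re) := by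
            rw [hσd]
          rw [i0] at this
          linear_combination this - g.im / 2 * r0'
      have hσ1 : 0 < σ := by
        rcases hσ0.eq_or_lt with h | h
        · exfalso
          rw [← h] at key
          simp [om_ne_zero, hz0] at key
        · exact h
      refine Or.inr (Or.inr ⟨σ, hσ1, _, one_add_ne_zero hσ0, ?_⟩)
      rw [lift_coe']
      ext i
      fin_cases i
      · simp only [Fin.zero_eta, Matrix.cons_val_zero, Pi.smul_apply, smul_eq_mul]
        rw [h1]
        linear_combination key - Complex.I * σ * g * om_mul_star
      · simp only [Fin.mk_one, Matrix.cons_val_one, Matrix.cons_val_zero, Pi.smul_apply,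
            smul_eq_mul]
        rw [hz]
        linear_combination om * ζ * key + ζ * g * om_mul_star
      · simp

/-! ### Faces and tetrahedra as conditions on coordinates. -/

theorem coe_mem_above {F : Set Heis} {q : ℂ × ℝ} :
    (q : Heis) ∈ above F ↔ ∃ s : ℝ, s ≤ q.2 ∧ ((q.1, s) : ℂ × ℝ) ∈ ((↑) ⁻¹' F : Set (ℂ × ℝ)) := by
  constructor
  · rintro (h | ⟨z, s, t, hst, hF, h⟩)
    · exact absurd h (OnePoint.coe_ne_infty _)
    · have := OnePoint.coe_injective h
      subst this
      exact ⟨s, hst, hF⟩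
  · rintro ⟨s, hs, hF⟩
    exact Or.inr ⟨q.1, s, q.2, hs, hF, rfl⟩

theorem mem_triMinus {P Q R X : Heis} : X ∈ triMinus P Q R ↔ ∃ Y ∈ arc Q R, X ∈ arc Y P := by
  simp [triMinus]

theorem mem_triPlus {P Q R X : Heis} : X ∈ triPlus P Q R ↔ ∃ Y ∈ arc Q R, X ∈ arc P Y := by
  simp [triPlus]

theorem mem_arc_P₃_P₁ {X : Heis} :
    X ∈ arc P₃ P₁ ↔
      ∃ q : ℂ × ℝ, X = q ∧ ht q = star om * q.1 ∧ Real.sqrt 3 * ‖q.1‖ ^ 2 ≤ q.2 := by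
  have : X ∈ arc P₃ P₁ ↔ _ := mem_arc_P₃ (ζ := 1) (by simp) (X := X)
  simpa using this

theorem coe_mem_triMinus_P₄_P₃_P₁ {q : ℂ × ℝ} :
    (q : Heis) ∈ triMinus P₄ P₃ P₁ ↔
      ∃ s : ℝ, s ≤ q.2 ∧ ht (q.1, s) = star om * q.1 ∧ Real.sqrt 3 * ‖q.1‖ ^ 2 ≤ s := by
  simp only [mem_triMinus, mem_arc_P₃_P₁]
  constructor
  · rintro ⟨Y, ⟨⟨z, s⟩, rfl, h1, h2⟩, h3⟩
    rw [coe_mem_arc_infty] at h3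
    obtain ⟨h3, h4⟩ := h3
    rw [h3]
    exact ⟨s, h4, h1, h2⟩
  · rintro ⟨s, h1, h2, h3⟩
    exact ⟨_, ⟨(q.1, s), rfl, h2, h3⟩, coe_mem_arc_infty.2 ⟨rfl, h1⟩⟩

theorem coe_mem_triPlus_P₄_P₁_P₂ {q : ℂ × ℝ} :
    (q : Heis) ∈ triPlus P₄ P₁ P₂ ↔
      ‖q.1‖ = 1 ∧ 0 ≤ q.1.im ∧ (-star om * q.1).im ≤ 0 ∧ q.2 ≤ Real.sqrt 3 := by
  simp only [mem_triPlus, mem_arc_P₁_P₂]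
  constructor
  · rintro ⟨Y, ⟨ζ, h1, h2, h3, rfl⟩, h4⟩
    rw [coe_mem_arc_from_infty] at h4
    obtain ⟨h4, h5⟩ := h4
    rw [h4]
    exact ⟨h1, h2, h3, h5⟩
  · rintro ⟨h1, h2, h3, h4⟩
    exact ⟨_, ⟨q.1, h1, h2, h3, rfl⟩, coe_mem_arc_from_infty.2 ⟨rfl, h4⟩⟩

theorem of_coe_mem_triMinus_P₄_P₁_P₂ {q : ℂ × ℝ} (h : (q : Heis) ∈ triMinus P₄ P₁ P₂) :
    ‖q.1‖ = 1 ∧ Real.sqrt 3 ≤ q.2 := by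
  simp only [mem_triMinus, mem_arc_P₁_P₂] at h
  obtain ⟨Y, ⟨ζ, h1, h2, h3, rfl⟩, h4⟩ := h
  rw [coe_mem_arc_infty] at h4
  obtain ⟨h4, h5⟩ := h4
  rw [h4]
  exact ⟨h1, h5⟩

theorem coe_mem_tetB {q : ℂ × ℝ} :
    (q : Heis) ∈ tetB ↔ ∃ s : ℝ, s ≤ q.2 ∧ ∃ ζ : ℂ, ‖ζ‖ = 1 ∧ 0 ≤ ζ.im ∧ (-star om * ζ).im ≤ 0 ∧
      ht (q.1, s) = star om * star ζ * q.1 ∧ Real.sqrt 3 * ‖q.1‖ ^ 2 ≤ s := by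
  unfold tetB
  simp only [coe_mem_above, Set.mem_preimage, mem_triPlus, mem_arc_P₁_P₂]
  constructor
  · rintro ⟨s, hs, Y, ⟨ζ, h1, h2, h3, rfl⟩, h4⟩
    obtain ⟨q', e, h5, h6⟩ := (mem_arc_P₃ h1).1 h4
    have := OnePoint.coe_injective e
    subst this
    exact ⟨s, hs, ζ, h1, h2, h3, h5, h6⟩
  · rintro ⟨s, hs, ζ, h1, h2, h3, h4, h5⟩
    exact ⟨s, hs, _, ⟨ζ, h1, h2, h3, rfl⟩, (mem_arc_P₃ h1).2 ⟨_, rfl, h4, h5⟩⟩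

theorem arcVec_P₂ {x : ℂ × ℝ} (hx : ht x = star om * x.1) (s : ℝ) :
    arcVec x P₂ s = ![star om * x.1 + Complex.I * s, x.1 - Complex.I * s * star om,
      1 + Complex.I * s * om] := by
  have e2 : ht (-om, Real.sqrt 3) = star om := by
    rw [ht_unit (by rw [norm_neg, norm_om])]
  have hq := om_quad
  have hx' : ht x = (-1 - om) * x.1 := by rw [hx, star_om]
  ext i
  fin_cases i <;> simp [arcVec, P₂, lift_coe', herm_apply, e2, conj_om, hx'] <;> grind

/-- The coordinate `t / 2 - Im (ω̄ z - ω)`, which vanishes at `P₂` and is up to a factor the vertical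
coordinate after the Heisenberg translation taking `P₂` to the origin. -/
noncomputable def vert (q : ℂ × ℝ) : ℝ := q.2 / 2 - (star om * q.1 - om).im

/-- The points of [P₃,P₁] project to the circle of radius 1 about -ω. Moving towards P₂ multiplies z
+ ω by the inverse of c = 1 + isω, so |c|²·|z+ω|² = 1, and eliminating s gives the equation of the
bottom face. -/
theorem of_coe_mem_triMinus_P₂_P₃_P₁ {q : ℂ × ℝ} (h : (q : Heis) ∈ triMinus P₂ P₃ P₁) :
    vert q ^ 2 = ‖q.1 + om‖ ^ 2 - (‖q.1 + om‖ ^ 2) ^ 2 / 4 ∧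
      vert q ≤ -(Real.sqrt 3 / 2 * ‖q.1 + om‖ ^ 2) := by
  have s3 := sqrt_three_mul
  have hs3 := sqrt_three_pos
  have hq := om_quad
  simp only [mem_triMinus, mem_arc_P₃_P₁] at h
  obtain ⟨Y, ⟨x, rfl, hx, hx2⟩, hY⟩ := h
  have e2 : ht (-om, Real.sqrt 3) = star om := by
    rw [ht_unit (by rw [norm_neg, norm_om])]
  have hne : (x : Heis) ≠ P₂ := by
    intro e
    have := OnePoint.coe_injective e
    rw [this, e2] at hx
    have := congrArg Complex.im hx
    simp [om_im, om_re] at this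
    linarith
  rw [mem_arc_iff hne] at hY
  simp only [arcVec_P₂ hx] at hY
  have hx1 : ‖x.1 + om‖ ^ 2 = 1 := by
    have := congrArg Complex.re hx
    rw [ht_re, norm_sq_eq] at this
    rw [norm_sq_eq]
    simp [om_re, om_im] at this ⊢
    nlinarith
  have main : (∃ s : ℝ, 0 ≤ s ∧ (1 + Complex.I * s * om) * q.1 = x.1 - Complex.I * s * star om ∧
      (1 + Complex.I * s * om) * ht q = star om * x.1 + Complex.I * s) →
      vert q ^ 2 = ‖q.1 + om‖ ^ 2 - (‖q.1 + om‖ ^ 2) ^ 2 / 4 ∧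
      vert q ≤ -(Real.sqrt 3 / 2 * ‖q.1 + om‖ ^ 2) := by
    rintro ⟨s, hs, h1, h0⟩
    obtain ⟨c, hc⟩ : ∃ c, c = 1 + Complex.I * s * om := ⟨_, rfl⟩
    have hc0 : c ≠ 0 := by rw [hc]; exact one_add_ne_zero hs
    rw [← hc] at h1 h0
    have hN : 0 < Complex.normSq c := Complex.normSq_pos.2 hc0
    have e1 : c * (q.1 + om) = x.1 + om := by
      rw [mul_add, h1, hc, star_om]; linear_combination (Complex.I * s) * hq
    have hD : Complex.normSq c * ‖q.1 + om‖ ^ 2 = 1 := by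
      rw [← hx1, ← e1, norm_mul, Complex.normSq_eq_norm_sq, mul_pow]
    have e3 : c * (ht q - star om * q.1 + om) = om := by
      have : c * (ht q - star om * q.1 + om) = c * ht q - star om * (c * q.1) + c * om := by ring
      rw [this, h0, h1, hc, star_om]
      linear_combination (2 * Complex.I * s) * hq
    have hv : (ht q - star om * q.1 + om).im = vert q := by
      simp [vert, ht_im]; ring
    have e4 : (ht q - star om * q.1 + om) * (Complex.normSq c : ℂ) = om * (starRingEnd ℂ) c := by
      rw [← Complex.mul_conj, ← mul_assoc, mul_comm _ c, e3]
    have e5 := congrArg Complex.im e4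
    have hcre : c.re = 1 + Real.sqrt 3 / 2 * s := by rw [hc]; simp [om_re, om_im]; ring
    have hcim : c.im = -(s / 2) := by rw [hc]; simp [om_re, om_im]; ring
    rw [Complex.im_mul_ofReal, hv] at e5
    simp only [Complex.mul_im, om_re, om_im, Complex.conj_re, Complex.conj_im, hcre, hcim] at e5
    have hnc : Complex.normSq c = 1 + Real.sqrt 3 * s + s ^ 2 := by
      rw [Complex.normSq_apply, hcre, hcim]; linear_combination s ^ 2 / 4 * s3
    -- This formula will also give the parameter back from the height, which is the source of `par`.
    have e6 : vert q = -(Real.sqrt 3 / 2 + s) * ‖q.1 + om‖ ^ 2 := by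
      apply mul_right_cancel₀ hN.ne'
      rw [e5]
      linear_combination (Real.sqrt 3 / 2 + s) * hD - s / 4 * s3
    constructor
    · rw [e6]
      rw [hnc] at hD
      linear_combination (‖q.1 + om‖ ^ 2) * hD + (‖q.1 + om‖ ^ 2) ^ 2 / 4 * s3
    · rw [e6]
      nlinarith [mul_nonneg hs (sq_nonneg ‖q.1 + om‖)]
  rcases hY with h | h | ⟨s, hs, c, hc, h⟩
  · have := OnePoint.coe_injective h
    subst this
    exact main ⟨0, le_rfl, by simp, by simp [hx]⟩
  · have := OnePoint.coe_injective h
    subst this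
    have : vert (-om, Real.sqrt 3) = 0 := by
      simp [vert, om_re, om_im]; ring
    simp [this]
  · rw [lift_coe'] at h
    have h2 : 1 + Complex.I * s * om = c := by simpa using congrFun h 2
    have h1 : x.1 - Complex.I * s * star om = c * q.1 := by simpa using congrFun h 1
    have h0 : star om * x.1 + Complex.I * s = c * ht q := by simpa using congrFun h 0
    exact main ⟨s, hs.le, by rw [h2, h1], by rw [h2, h0]⟩

theorem coe_mem_triMinus_P₂_P₃_P₁_of {q x : ℂ × ℝ} (hx : ht x = star om * x.1)
    (hx2 : Real.sqrt 3 * ‖x.1‖ ^ 2 ≤ x.2) {s : ℝ} (hs : 0 ≤ s)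
    (h1 : (1 + Complex.I * s * om) * q.1 = x.1 - Complex.I * s * star om)
    (h0 : (1 + Complex.I * s * om) * ht q = star om * x.1 + Complex.I * s) :
    (q : Heis) ∈ triMinus P₂ P₃ P₁ := by
  rw [mem_triMinus]
  refine ⟨x, mem_arc_P₃_P₁.2 ⟨x, rfl, hx, hx2⟩, ?_⟩
  -- The parametrised part of an edge is open, so the starting point s = 0 is treated separately.
  rcases hs.eq_or_lt with rfl | hs
  · simp at h1 h0
    have h2 := congrArg Complex.im (h0.trans hx.symm)
    rw [ht_im, ht_im] at h2
    have : q = x := Prod.ext h1 (by linarith)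
    rw [this]
    exact Or.inl (Or.inl rfl)
  · refine Or.inr ⟨s, hs, ?_⟩
    have h2 : arcVec x P₂ s = (1 + Complex.I * s * om) • lift q := by
      rw [arcVec_P₂ hx, lift_coe']
      ext i
      fin_cases i
      · simpa using h0.symm
      · simpa using h1.symm
      · simp
    change (q : Heis) = proj (arcVec x P₂ s)
    rw [h2, proj_smul (one_add_ne_zero hs.le), proj_lift]

/-! ### The tetrahedra near the edge `[P₃, P₁]` -/

/-- The finite points of the edge `[P₃, P₁]` other than its endpoints. -/
structure IsEdgePoint (q : ℂ × ℝ) : Prop where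
  ht_eq : ht q = star om * q.1
  lt : Real.sqrt 3 * ‖q.1‖ ^ 2 < q.2

theorem norm_add_om_sq (z : ℂ) : ‖z + om‖ ^ 2 = ‖z‖ ^ 2 + 2 * (star om * z).re + 1 := by
  rw [norm_sq_eq, norm_sq_eq]
  simp [om_re, om_im]
  linear_combination (1 / 4 : ℝ) * sqrt_three_mul

theorem norm_ht_sq (q : ℂ × ℝ) : ‖ht q‖ ^ 2 = q.2 ^ 2 / 4 + ‖q.1‖ ^ 4 / 4 := by
  rw [norm_sq_eq, ht_re, ht_im]; ring

theorem norm_star_om_mul (z : ℂ) : ‖star om * z‖ = ‖z‖ := by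
  rw [norm_mul, norm_star, norm_om, one_mul]

theorem IsEdgePoint.norm_eq {q : ℂ × ℝ} (h : IsEdgePoint q) : ‖q.1 + om‖ ^ 2 = 1 := by
  rw [norm_add_om_sq, ← h.ht_eq, ht_re]; ring

theorem IsEdgePoint.pos {q : ℂ × ℝ} (h : IsEdgePoint q) : 0 < q.2 :=
  lt_of_le_of_lt (mul_nonneg sqrt_three_pos.le (sq_nonneg _)) h.lt

theorem IsEdgePoint.norm_ht {q : ℂ × ℝ} (h : IsEdgePoint q) : ‖ht q‖ = ‖q.1‖ := by
  rw [h.ht_eq, norm_star_om_mul]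

theorem IsEdgePoint.sq_eq {q : ℂ × ℝ} (h : IsEdgePoint q) :
    q.2 ^ 2 = 4 * ‖q.1‖ ^ 2 - ‖q.1‖ ^ 4 := by
  have := norm_ht_sq q
  rw [h.norm_ht] at this; linarith

theorem IsEdgePoint.norm_pos {q : ℂ × ℝ} (h : IsEdgePoint q) : 0 < ‖q.1‖ := by
  rcases (norm_nonneg q.1).eq_or_lt with h0 | h0
  · have h1 := h.sq_eq
    have := h.pos
    rw [← h0] at h1
    nlinarith
  · exact h0

theorem IsEdgePoint.norm_lt_one {q : ℂ × ℝ} (h : IsEdgePoint q) : ‖q.1‖ < 1 := by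
  have h1 := h.sq_eq
  have h2 := h.lt
  have h3 : (Real.sqrt 3 * ‖q.1‖ ^ 2) ^ 2 < q.2 ^ 2 :=
    pow_lt_pow_left₀ h2 (mul_nonneg sqrt_three_pos.le (sq_nonneg _)) two_ne_zero
  rw [mul_pow, sqrt_three_sq, h1] at h3
  have h4 : 0 < ‖q.1‖ ^ 2 := pow_pos h.norm_pos 2
  have h5 : ‖q.1‖ ^ 2 < 1 := by nlinarith
  nlinarith [norm_nonneg q.1]

/-- On a circle in the upper half-plane, the larger first coordinate has the smaller argument; this
is written as a cross product to avoid angles. -/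
theorem circle_ineq {a b a₀ b₀ : ℝ} (hb : 0 < b) (ha₀ : 0 < a₀) (hb₀ : 0 < b₀)
    (h : a ^ 2 + b ^ 2 = a₀ ^ 2 + b₀ ^ 2) :
    (a₀ ≤ a → a₀ * b ≤ a * b₀) ∧ (a ≤ a₀ → a * b₀ ≤ a₀ * b) := by
  constructor
  · intro h1
    have : b ≤ b₀ := by
      apply le_of_sq_le_sq _ hb₀.le
      nlinarith
    nlinarith
  · intro h1
    by_cases h2 : a ≤ 0
    · nlinarith
    · push Not at h2
      have : b₀ ≤ b := by
        apply le_of_sq_le_sq _ hb.le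
        nlinarith
      nlinarith

/-- The height of the bottom face of the tetrahedron of type `B`. -/
noncomputable def bot (z : ℂ) : ℝ := ‖z‖ * Real.sqrt (4 - ‖z‖ ^ 2)

/-- The direction, relative to `P₁`, of the edge from `P₃` through a point of the bottom face. -/
noncomputable def dir (z : ℂ) : ℂ := star om * z / ht (z, bot z)

theorem bot_sq {z : ℂ} (h : ‖z‖ < 1) : bot z ^ 2 = 4 * ‖z‖ ^ 2 - ‖z‖ ^ 4 := by
  have : 0 ≤ 4 - ‖z‖ ^ 2 := by nlinarith [norm_nonneg z]
  rw [bot, mul_pow, Real.sq_sqrt this]; ring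

theorem bot_nonneg (z : ℂ) : 0 ≤ bot z := mul_nonneg (norm_nonneg _) (Real.sqrt_nonneg _)

theorem norm_ht_bot {z : ℂ} (h : ‖z‖ < 1) : ‖ht (z, bot z)‖ = ‖z‖ := by
  have h1 := norm_ht_sq (z, bot z)
  simp only [bot_sq h] at h1
  have : ‖ht (z, bot z)‖ ^ 2 = ‖z‖ ^ 2 := by rw [h1]; ring
  exact (sq_eq_sq₀ (norm_nonneg _) (norm_nonneg _)).1 this

theorem IsEdgePoint.bot_eq {q : ℂ × ℝ} (h : IsEdgePoint q) : bot q.1 = q.2 := by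
  have h1 := bot_sq h.norm_lt_one
  rw [← h.sq_eq] at h1
  exact (sq_eq_sq₀ (bot_nonneg _) h.pos.le).1 h1

theorem IsEdgePoint.dir_eq {q : ℂ × ℝ} (h : IsEdgePoint q) : dir q.1 = 1 := by
  have : ht q ≠ 0 := by
    rw [← norm_pos_iff, h.norm_ht]; exact h.norm_pos
  rw [dir, h.bot_eq, ← h.ht_eq]
  exact div_self this

theorem continuous_bot : Continuous bot := by
  unfold bot; fun_prop

theorem IsEdgePoint.continuousAt_dir {q : ℂ × ℝ} (h : IsEdgePoint q) : ContinuousAt dir q.1 := by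
  unfold dir
  refine ContinuousAt.div (by fun_prop) ?_ ?_
  · exact (continuous_ht.comp (continuous_id.prodMk continuous_bot)).continuousAt
  · rw [h.bot_eq, ← norm_pos_iff, h.norm_ht]; exact h.norm_pos

theorem norm_dir {z : ℂ} (h0 : 0 < ‖z‖) (h : ‖z‖ < 1) : ‖dir z‖ = 1 := by
  rw [dir, norm_div, norm_star_om_mul, norm_ht_bot h, div_self h0.ne']

/-- `dir` is obtained by solving the equation of the edge from P₃ for its end; it is a unit number
because at height `bot` the first coordinate of the lift has modulus |z|. -/
theorem ht_bot_eq {z : ℂ} (h0 : 0 < ‖z‖) (h : ‖z‖ < 1) :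
    ht (z, bot z) = star om * star (dir z) * z := by
  have h1 : ht (z, bot z) ≠ 0 := by
    rw [← norm_pos_iff, norm_ht_bot h]; exact h0
  have h2 : dir z * ht (z, bot z) = star om * z := by rw [dir, div_mul_cancel₀ _ h1]
  have h3 : star (dir z) * dir z = 1 := by
    have := Complex.conj_mul' (dir z)
    rw [norm_dir h0 h] at this
    simpa using this
  linear_combination star (dir z) * h2 - ht (z, bot z) * h3

/-- The numbers ω̄z and ht(z, bot z) both have modulus |z|, so their order on the circle is decided
by their real parts. That comparison is exactly |z+ω| ≤ 1 or ≥ 1. -/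
theorem dir_im {z : ℂ} (h0 : 0 < ‖z‖) (h : ‖z‖ < 1) (him : 0 < (star om * z).im) :
    (‖z + om‖ ≤ 1 → 0 ≤ (dir z).im) ∧ (1 ≤ ‖z + om‖ → (dir z).im ≤ 0) := by
  have h1 : ht (z, bot z) ≠ 0 := by
    rw [← norm_pos_iff, norm_ht_bot h]; exact h0
  have hN : 0 < Complex.normSq (ht (z, bot z)) := Complex.normSq_pos.2 h1
  have e : dir z * (Complex.normSq (ht (z, bot z)) : ℂ) =
      star om * z * (starRingEnd ℂ) (ht (z, bot z)) := by
    rw [← Complex.mul_conj, ← mul_assoc, dir, div_mul_cancel₀ _ h1]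
  have e' := congrArg Complex.im e
  rw [Complex.im_mul_ofReal, Complex.mul_im, Complex.conj_re, Complex.conj_im, ht_re, ht_im] at e'
  simp only at e'
  have hb0 : 0 < bot z := mul_pos h0 (Real.sqrt_pos.2 (by nlinarith))
  have hz2 : 0 < ‖z‖ ^ 2 := pow_pos h0 2
  have hg : (star om * z).re ^ 2 + (star om * z).im ^ 2 = ‖z‖ ^ 2 := by
    rw [← norm_sq_eq, norm_star_om_mul]
  obtain ⟨c1, c2⟩ := circle_ineq (a := -(star om * z).re) (a₀ := ‖z‖ ^ 2 / 2) (b₀ := bot z / 2)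
    him (by positivity) (by positivity) (by rw [div_pow, div_pow, bot_sq h]; linarith)
  have hD := norm_add_om_sq z
  constructor
  · intro h2
    have h3 : ‖z + om‖ ^ 2 ≤ 1 := pow_le_one₀ (norm_nonneg _) h2
    have := c1 (by linarith)
    by_contra hneg
    push Not at hneg
    nlinarith [mul_neg_of_neg_of_pos hneg hN]
  · intro h2
    have h3 : 1 ≤ ‖z + om‖ ^ 2 := one_le_pow₀ h2
    have := c2 (by linarith)
    by_contra hneg
    push Not at hneg
    nlinarith [mul_pos hneg hN]

theorem sqrt_three_le_bot {z : ℂ} (h : ‖z‖ < 1) : Real.sqrt 3 * ‖z‖ ^ 2 ≤ bot z := by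
  apply le_of_sq_le_sq _ (bot_nonneg z)
  rw [bot_sq h, mul_pow, sqrt_three_sq]
  have : ‖z‖ ^ 4 ≤ ‖z‖ ^ 2 := by
    have := norm_nonneg z
    have h2 : ‖z‖ ^ 2 ≤ 1 := pow_le_one₀ this h.le
    nlinarith [sq_nonneg ‖z‖]
  nlinarith

theorem bot_le_iff {q : ℂ × ℝ} (h : ‖q.1‖ < 1) (ht0 : 0 < q.2) : bot q.1 ≤ q.2 ↔ ‖q.1‖ ≤ ‖ht q‖ := by
  rw [← pow_le_pow_iff_left₀ (bot_nonneg _) ht0.le two_ne_zero,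
    ← pow_le_pow_iff_left₀ (norm_nonneg _) (norm_nonneg (ht q)) two_ne_zero, bot_sq h, norm_ht_sq]
  constructor <;> intro <;> linarith

/-- Each condition is strict at the edge point, where ω̄z has imaginary part t/2 and `dir` equals 1.
The last two keep the far end of the arc [P₁,P₂] out of play. -/
theorem IsEdgePoint.eventually_basic {q₀ : ℂ × ℝ} (h : IsEdgePoint q₀) :
    ∀ᶠ q in 𝓝 q₀, 0 < ‖q.1‖ ∧ ‖q.1‖ < 1 ∧ 0 < q.2 ∧ 0 < (star om * q.1).im ∧
      Real.sqrt 3 * ‖q.1‖ ^ 2 < 2 * (star om * q.1).im ∧ Real.sqrt 3 * ‖q.1‖ ^ 2 < q.2 ∧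
      (-star om * dir q.1).im < 0 ∧ 0 < (-om * dir q.1).im := by
  have him : (star om * q₀.1).im = q₀.2 / 2 := by rw [← h.ht_eq, ht_im]
  have hdir : ContinuousAt (fun q : ℂ × ℝ => dir q.1) q₀ :=
    ContinuousAt.comp (f := Prod.fst) h.continuousAt_dir continuousAt_fst
  have hpos := h.pos
  have hlt := h.lt
  have c1 : ContinuousAt (fun q : ℂ × ℝ => (-star om * dir q.1).im) q₀ :=
    Complex.continuous_im.continuousAt.comp (continuousAt_const.mul hdir)
  have c2 : ContinuousAt (fun q : ℂ × ℝ => (-om * dir q.1).im) q₀ :=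
    Complex.continuous_im.continuousAt.comp (continuousAt_const.mul hdir)
  have c3 : Continuous (fun q : ℂ × ℝ => (star om * q.1).im) :=
    Complex.continuous_im.comp (by fun_prop)
  refine Filter.Eventually.and ?_ (Filter.Eventually.and ?_ (Filter.Eventually.and ?_
    (Filter.Eventually.and ?_ (Filter.Eventually.and ?_ (Filter.Eventually.and ?_
    (Filter.Eventually.and ?_ ?_))))))
  · exact (by fun_prop : Continuous fun q : ℂ × ℝ => ‖q.1‖).continuousAt.eventually_const_lt
      h.norm_pos
  · exact (by fun_prop : Continuous fun q : ℂ × ℝ => ‖q.1‖).continuousAt.eventually_lt_const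
      h.norm_lt_one
  · exact continuous_snd.continuousAt.eventually_const_lt hpos
  · exact c3.continuousAt.eventually_const_lt (by beta_reduce; rw [him]; linarith)
  · refine ContinuousAt.eventually_lt (by fun_prop) (c3.const_mul 2).continuousAt ?_
    rw [him]; linarith
  · exact ContinuousAt.eventually_lt (by fun_prop) (by fun_prop) hlt
  · refine c1.eventually_lt_const ?_
    beta_reduce; rw [h.dir_eq]; simp [om_im]
  · refine c2.eventually_const_lt ?_
    beta_reduce; rw [h.dir_eq]; simp [om_im]

theorem le_norm_ht_of {q : ℂ × ℝ} {s : ℝ} (hs : s ≤ q.2) (hs0 : Real.sqrt 3 * ‖q.1‖ ^ 2 ≤ s)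
    (h : ‖ht (q.1, s)‖ = ‖q.1‖) : ‖q.1‖ ≤ ‖ht q‖ := by
  have h0 : 0 ≤ s := le_trans (mul_nonneg sqrt_three_pos.le (sq_nonneg _)) hs0
  rw [← h, ← pow_le_pow_iff_left₀ (norm_nonneg _) (norm_nonneg (ht q)) two_ne_zero, norm_ht_sq,
    norm_ht_sq]
  simp only
  nlinarith

/-- Only the two faces through [P₃,P₁] matter near it: the bottom face, where |ht q| = |z|, and the
vertical face over the circle |z+ω| = 1. -/
theorem IsEdgePoint.eventually_mem_tetB {q₀ : ℂ × ℝ} (h : IsEdgePoint q₀) :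
    ∀ᶠ q : ℂ × ℝ in 𝓝 q₀, ((q : Heis) ∈ tetB ↔ ‖q.1‖ ≤ ‖ht q‖ ∧ ‖q.1 + om‖ ≤ 1) := by
  filter_upwards [h.eventually_basic] with q ⟨h1, h2, h3, h4, h5, h6, h7, h8⟩
  rw [coe_mem_tetB]
  constructor
  · rintro ⟨s, hs, ζ, hζ, hi, hi', e, hs0⟩
    have hn : ‖ht (q.1, s)‖ = ‖q.1‖ := by
      rw [e, mul_assoc, norm_star_om_mul, norm_mul, norm_star, hζ, one_mul]
    refine ⟨le_norm_ht_of hs hs0 hn, ?_⟩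
    have hζζ : ζ * star ζ = 1 := by
      have := Complex.mul_conj' ζ
      rw [hζ] at this
      simpa using this
    have e2 : star om * q.1 = ζ * ht (q.1, s) := by
      rw [e]; linear_combination (-star om * q.1) * hζζ
    have e3 := congrArg Complex.re e2
    rw [Complex.mul_re ζ, ht_re, ht_im] at e3
    simp only at e3
    have hD := norm_add_om_sq q.1
    have hn1 : ζ.re ^ 2 + ζ.im ^ 2 = 1 := by rw [← norm_sq_eq, hζ]; norm_num
    have hi2 : ζ.im / 2 ≤ Real.sqrt 3 / 2 * ζ.re := by
      simp [om_re, om_im] at hi'; linarith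
    have ha : 0 ≤ ζ.re := by
      by_contra hneg
      push Not at hneg
      nlinarith [sqrt_three_pos]
    -- On a circular arc with angles from 0 to π/3, 1 - cos ≤ sin. Together with |z|² ≤ s this gives
    -- |z+ω| ≤ 1.
    have hle : 1 - ζ.re ≤ ζ.im := by
      apply le_of_sq_le_sq _ hi
      nlinarith
    have h3' : 1 ≤ Real.sqrt 3 := by
      rw [Real.one_le_sqrt]; norm_num
    have hsρ : ‖q.1‖ ^ 2 ≤ s := by nlinarith [sq_nonneg ‖q.1‖]
    have : ‖q.1 + om‖ ^ 2 ≤ 1 := by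
      rw [hD, e3]
      nlinarith [mul_le_mul hle hsρ (sq_nonneg ‖q.1‖) hi]
    nlinarith [norm_nonneg (q.1 + om)]
  · rintro ⟨h9, h10⟩
    exact ⟨bot q.1, (bot_le_iff h2 h3).2 h9, dir q.1, norm_dir h1 h2, (dir_im h1 h2 h4).1 h10,
      h7.le, ht_bot_eq h1 h2, sqrt_three_le_bot h2⟩

theorem ht_rot (z : ℂ) (s : ℝ) : ht (-om * z, s) = ht (z, s) := by
  simp [ht, norm_om]

/-- The rotation by -ω carries [P₃,P₁] to [P₃,P₂], where the same tetrahedron lies on the other side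
of its vertical face. The bottom condition is rotation invariant. -/
theorem IsEdgePoint.eventually_rot_mem_tetB {q₀ : ℂ × ℝ} (h : IsEdgePoint q₀) :
    ∀ᶠ q : ℂ × ℝ in 𝓝 q₀, ((((-om * q.1, q.2) : ℂ × ℝ) : Heis) ∈ tetB ↔
      ‖q.1‖ ≤ ‖ht q‖ ∧ 1 ≤ ‖q.1 + om‖) := by
  filter_upwards [h.eventually_basic] with q ⟨h1, h2, h3, h4, h5, h6, h7, h8⟩
  rw [coe_mem_tetB]
  have hno : ‖-om * q.1‖ = ‖q.1‖ := by rw [norm_mul, norm_neg, norm_om, one_mul]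
  simp only [ht_rot, hno]
  constructor
  · rintro ⟨s, hs, ζ, hζ, hi, hi', e, hs0⟩
    have hn : ‖ht (q.1, s)‖ = ‖q.1‖ := by
      rw [e, mul_assoc, norm_star_om_mul, norm_mul, norm_star, hζ, one_mul, hno]
    refine ⟨le_norm_ht_of hs hs0 hn, ?_⟩
    have hζζ : ζ * star ζ = 1 := by
      have := Complex.mul_conj' ζ
      rw [hζ] at this
      simpa using this
    have e2 : star om * q.1 = (-star om * ζ) * ht (q.1, s) := by
      rw [e]
      linear_combination (-star om * q.1 * (star om * om)) * hζζ - (star om * q.1) * om_mul_star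
    have e3 := congrArg Complex.re e2
    obtain ⟨ξ, hξ⟩ : ∃ ξ, ξ = -star om * ζ := ⟨_, rfl⟩
    rw [← hξ] at e3 hi'
    rw [Complex.mul_re ξ, ht_re, ht_im] at e3
    simp only at e3
    have hξ1 : ‖ξ‖ = 1 := by rw [hξ, neg_mul, norm_neg, norm_star_om_mul, hζ]
    have hn1 : ξ.re ^ 2 + ξ.im ^ 2 = 1 := by rw [← norm_sq_eq, hξ1]; norm_num
    have hD := norm_add_om_sq q.1
    have hre : ξ.re ≤ 1 := by nlinarith
    have hs1 : 0 ≤ s := le_trans (mul_nonneg sqrt_three_pos.le (sq_nonneg _)) hs0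
    have : 1 ≤ ‖q.1 + om‖ ^ 2 := by
      rw [hD, e3]
      nlinarith [mul_nonneg (neg_nonneg.2 hi') hs1, sq_nonneg ‖q.1‖]
    by_contra hneg
    push Not at hneg
    nlinarith [norm_nonneg (q.1 + om)]
  · rintro ⟨h9, h10⟩
    refine ⟨bot q.1, (bot_le_iff h2 h3).2 h9, -om * dir q.1, ?_, h8.le, ?_, ?_,
      sqrt_three_le_bot h2⟩
    · rw [norm_mul, norm_neg, norm_om, one_mul, norm_dir h1 h2]
    · have : -star om * (-om * dir q.1) = dir q.1 := by
        linear_combination dir q.1 * om_mul_star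
      rw [this]
      exact (dir_im h1 h2 h4).2 h10
    · rw [ht_bot_eq h1 h2]
      simp only [star_mul', star_neg]
      linear_combination (-star om * star (dir q.1) * q.1) * om_mul_star

/-- The face is the part of the cylinder |z+ω| = 1 above the edge; over that circle, the edge has
height 2 Im(ω̄z). -/
theorem IsEdgePoint.eventually_mem_triMinus {q₀ : ℂ × ℝ} (h : IsEdgePoint q₀) :
    ∀ᶠ q : ℂ × ℝ in 𝓝 q₀, ((q : Heis) ∈ triMinus P₄ P₃ P₁ ↔
      ‖q.1 + om‖ = 1 ∧ 0 ≤ (ht q - star om * q.1).im) := by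
  filter_upwards [h.eventually_basic] with q ⟨h1, h2, h3, h4, h5, h6, h7, h8⟩
  rw [coe_mem_triMinus_P₄_P₃_P₁, Complex.sub_im, ht_im]
  have hD := norm_add_om_sq q.1
  constructor
  · rintro ⟨s, hs, e, hs0⟩
    have e1 := congrArg Complex.re e
    have e2 := congrArg Complex.im e
    rw [ht_re] at e1
    rw [ht_im] at e2
    simp only at e1 e2
    refine ⟨?_, by linarith⟩
    rw [← e1] at hD
    have : ‖q.1 + om‖ ^ 2 = 1 := by rw [hD]; ring
    nlinarith [norm_nonneg (q.1 + om)]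
  · rintro ⟨h9, h10⟩
    refine ⟨2 * (star om * q.1).im, by linarith, ?_, h5.le⟩
    apply Complex.ext
    · rw [ht_re]; rw [h9] at hD; simp only; linarith
    · rw [ht_im]; simp only; linarith

/-! ### The tetrahedron of type `A` -/

theorem offset_re (q : ℂ × ℝ) : (ht q - star om * q.1 + om).re = -(‖q.1 + om‖ ^ 2 / 2) := by
  rw [Complex.add_re, Complex.sub_re, ht_re, norm_add_om_sq, om_re]; ring

theorem offset_im (q : ℂ × ℝ) : (ht q - star om * q.1 + om).im = vert q := by
  simp [vert, ht_im]; ring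

theorem norm_offset_sq (q : ℂ × ℝ) :
    ‖ht q - star om * q.1 + om‖ ^ 2 = vert q ^ 2 + (‖q.1 + om‖ ^ 2) ^ 2 / 4 := by
  rw [norm_sq_eq, offset_re, offset_im]; ring

theorem IsEdgePoint.vert_eq {q : ℂ × ℝ} (h : IsEdgePoint q) : vert q = -(Real.sqrt 3 / 2) := by
  rw [← offset_im, h.ht_eq]; simp [om_im]

/-- The parameter, on an edge ending at `P₂`, of a point of the bottom face of the tetrahedron of
type `A`. -/
noncomputable def par (z : ℂ) : ℝ :=
  -(Real.sqrt 3 / 2) + Real.sqrt (‖z + om‖ ^ 2 - (‖z + om‖ ^ 2) ^ 2 / 4) / ‖z + om‖ ^ 2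

/-- The projection of the starting point of that edge. -/
noncomputable def foot (z : ℂ) : ℂ := (1 + Complex.I * par z * om) * (z + om) - om

theorem IsEdgePoint.par_eq {q : ℂ × ℝ} (h : IsEdgePoint q) : par q.1 = 0 := by
  rw [par, h.norm_eq]
  have : (1 : ℝ) - 1 ^ 2 / 4 = (Real.sqrt 3 / 2) ^ 2 := by
    rw [div_pow, sqrt_three_sq]; norm_num
  rw [this, Real.sqrt_sq (by positivity)]; ring

theorem IsEdgePoint.foot_eq {q : ℂ × ℝ} (h : IsEdgePoint q) : foot q.1 = q.1 := by
  rw [foot, h.par_eq]; simp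

theorem IsEdgePoint.continuousAt_foot {q : ℂ × ℝ} (h : IsEdgePoint q) :
    ContinuousAt foot q.1 := by
  have h1 : ContinuousAt par q.1 := by
    unfold par
    refine continuousAt_const.add (ContinuousAt.div (by fun_prop) (by fun_prop) ?_)
    rw [h.norm_eq]; norm_num
  unfold foot
  have h2 : ContinuousAt (fun z => (par z : ℂ)) q.1 :=
    Complex.continuous_ofReal.continuousAt.comp h1
  fun_prop

theorem IsEdgePoint.eventually_foot {q₀ : ℂ × ℝ} (h : IsEdgePoint q₀) :
    ∀ᶠ q in 𝓝 q₀, 0 < ‖q.1 + om‖ ∧ vert q < 0 ∧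
      Real.sqrt 3 * ‖foot q.1‖ ^ 2 < 2 * (star om * foot q.1).im := by
  have hf : ContinuousAt (fun q : ℂ × ℝ => foot q.1) q₀ :=
    ContinuousAt.comp (f := Prod.fst) h.continuousAt_foot continuousAt_fst
  have him : (star om * q₀.1).im = q₀.2 / 2 := by rw [← h.ht_eq, ht_im]
  refine Filter.Eventually.and ?_ (Filter.Eventually.and ?_ ?_)
  · have : 0 < ‖q₀.1 + om‖ := by
      have := h.norm_eq
      by_contra hneg
      have h0 : ‖q₀.1 + om‖ = 0 := le_antisymm (not_lt.1 hneg) (norm_nonneg _)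
      rw [h0] at this; norm_num at this
    exact (by fun_prop : Continuous fun q : ℂ × ℝ => ‖q.1 + om‖).continuousAt.eventually_const_lt
      this
  · have hc : Continuous vert := by
      unfold vert
      exact (by fun_prop : Continuous fun q : ℂ × ℝ => q.2 / 2).sub
        (Complex.continuous_im.comp (by fun_prop))
    refine hc.continuousAt.eventually_lt_const ?_
    rw [h.vert_eq]
    have := sqrt_three_pos
    linarith
  · refine ContinuousAt.eventually_lt (continuousAt_const.mul (hf.norm.pow 2))
      (continuousAt_const.mul (Complex.continuous_im.continuousAt.comp
        (continuousAt_const.mul hf))) ?_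
    simp only [h.foot_eq, him]
    linarith [h.lt]

/-- The bottom face is the lower sheet of vert² = D - D²/4, with D = |z+ω|². Near the edge `vert` is
negative, so lying above that sheet amounts to vert² ≤ D - D²/4. -/
theorem IsEdgePoint.eventually_mem_tetA {q₀ : ℂ × ℝ} (h : IsEdgePoint q₀) :
    ∀ᶠ q : ℂ × ℝ in 𝓝 q₀, ((q : Heis) ∈ tetA ↔
      ‖q.1 + om‖ ≤ 1 ∧ ‖ht q - star om * q.1 + om‖ ≤ ‖q.1 + om‖) := by
  filter_upwards [h.eventually_foot] with q ⟨h1, h2, h3⟩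
  have s3 := sqrt_three_mul
  have hs3 := sqrt_three_pos
  unfold tetA
  simp only [coe_mem_above, Set.mem_preimage]
  obtain ⟨D, hD⟩ : ∃ D, D = ‖q.1 + om‖ ^ 2 := ⟨_, rfl⟩
  have hD0 : 0 < D := by rw [hD]; positivity
  have hle1 : ‖q.1 + om‖ ≤ 1 ↔ D ≤ 1 := by
    rw [hD, sq_le_one_iff₀ (norm_nonneg _)]
  have hle2 : ‖ht q - star om * q.1 + om‖ ≤ ‖q.1 + om‖ ↔ vert q ^ 2 + D ^ 2 / 4 ≤ D := by
    rw [← pow_le_pow_iff_left₀ (norm_nonneg _) (norm_nonneg (q.1 + om)) two_ne_zero,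
      norm_offset_sq, hD]
  rw [hle1, hle2]
  constructor
  · rintro ⟨s, hs, hF⟩
    obtain ⟨e1, e2⟩ := of_coe_mem_triMinus_P₂_P₃_P₁ hF
    simp only [← hD] at e1 e2
    have hvs : vert (q.1, s) ≤ vert q := by
      unfold vert; simp only; linarith
    constructor
    · have : (Real.sqrt 3 / 2 * D) ^ 2 ≤ vert (q.1, s) ^ 2 := by
        rw [← neg_sq (vert _)]
        exact pow_le_pow_left₀ (by positivity) (by linarith) 2
      rw [e1, mul_pow, div_pow, sqrt_three_sq] at this
      nlinarith
    · nlinarith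
  · rintro ⟨h4, h5⟩
    have hr0 : 0 ≤ D - D ^ 2 / 4 := by nlinarith
    obtain ⟨e, he⟩ : ∃ e, e = Real.sqrt (D - D ^ 2 / 4) := ⟨_, rfl⟩
    have he0 : 0 ≤ e := by rw [he]; exact Real.sqrt_nonneg _
    have he2 : e ^ 2 = D - D ^ 2 / 4 := by rw [he, Real.sq_sqrt hr0]
    -- The condition D ≤ 1 makes this parameter nonnegative, so the edge through the bottom point
    -- really starts on [P₃,P₁], at `foot`.
    obtain ⟨σ, hσ⟩ : ∃ σ, σ = par q.1 := ⟨_, rfl⟩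
    have hσe : e = D * (σ + Real.sqrt 3 / 2) := by
      rw [hσ, par, ← hD, ← he]; field_simp; ring
    have hσ0 : 0 ≤ σ := by
      have : Real.sqrt 3 / 2 * D ≤ e := by
        apply le_of_sq_le_sq _ he0
        rw [he2, mul_pow, div_pow, sqrt_three_sq]; nlinarith
      rw [hσe] at this
      by_contra hneg
      push Not at hneg
      nlinarith
    obtain ⟨c, hc⟩ : ∃ c, c = 1 + Complex.I * σ * om := ⟨_, rfl⟩
    have hc0 : c ≠ 0 := by rw [hc]; exact one_add_ne_zero hσ0
    have hcre : c.re = 1 + Real.sqrt 3 / 2 * σ := by rw [hc]; simp [om_re, om_im]; ring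
    have hcim : c.im = -(σ / 2) := by rw [hc]; simp [om_re, om_im]; ring
    have hnc : ‖c‖ ^ 2 = 1 + Real.sqrt 3 * σ + σ ^ 2 := by
      rw [norm_sq_eq, hcre, hcim]; linear_combination σ ^ 2 / 4 * s3
    have hcD : ‖c‖ ^ 2 * D = 1 := by
      rw [hσe] at he2
      apply mul_left_cancel₀ hD0.ne'
      rw [hnc]
      linear_combination he2 - D ^ 2 / 4 * s3
    obtain ⟨x, hx⟩ : ∃ x, x = foot q.1 := ⟨_, rfl⟩
    have hxc : x + om = c * (q.1 + om) := by rw [hx, foot, ← hσ, ← hc]; ring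
    have hx1 : ‖x + om‖ ^ 2 = 1 := by rw [hxc, norm_mul, mul_pow, ← hD, hcD]
    rw [← hx] at h3
    have hxht : ht (x, 2 * (star om * x).im) = star om * x := by
      have := norm_add_om_sq x
      apply Complex.ext
      · rw [ht_re]; simp only; linarith
      · rw [ht_im]; simp only; linarith
    -- This is the height over z at which `vert` takes the value -e of the lower sheet.
    obtain ⟨s, hs⟩ : ∃ s, s = 2 * (-e + (star om * q.1 - om).im) := ⟨_, rfl⟩
    have hvs : vert (q.1, s) = -e := by unfold vert; rw [hs]; simp only; ring
    have hst : s ≤ q.2 := by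
      have : -vert q ≤ e := by
        apply le_of_sq_le_sq _ he0
        rw [he2]; linarith
      unfold vert at this
      linarith
    refine ⟨s, hst, coe_mem_triMinus_P₂_P₃_P₁_of (x := (x, 2 * (star om * x).im)) hxht h3.le
      hσ0 ?_ ?_⟩
    · simp only
      rw [← hc]
      have : c * om = om + Complex.I * σ * star om := by
        rw [hc, star_om]; linear_combination (Complex.I * σ) * om_quad
      linear_combination -hxc - this
    · simp only
      rw [← hc]
      have ey : c * (ht (q.1, s) - star om * q.1 + om) = om := by
        have e1 : ht (q.1, s) - star om * q.1 + om = (D : ℂ) * om * (starRingEnd ℂ) c := by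
          apply Complex.ext
          · have := offset_re (q.1, s)
            simp only at this
            rw [this, ← hD]
            simp only [Complex.mul_re, Complex.mul_im, Complex.ofReal_re, Complex.ofReal_im,
              Complex.conj_re, Complex.conj_im, hcre, hcim, om_re, om_im]
            ring
          · have := offset_im (q.1, s)
            simp only at this
            rw [this, hvs, hσe]
            simp only [Complex.mul_re, Complex.mul_im, Complex.ofReal_re, Complex.ofReal_im,
              Complex.conj_re, Complex.conj_im, hcre, hcim, om_re, om_im]
            linear_combination (D * σ / 4) * s3
        have e2 : c * (starRingEnd ℂ) c = (‖c‖ ^ 2 : ℝ) := by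
          rw [Complex.mul_conj']; push_cast; rfl
        have e3 : ((‖c‖ ^ 2 : ℝ) : ℂ) * (D : ℂ) = 1 := by exact_mod_cast hcD
        rw [e1]
        linear_combination (D * om) * e2 + om * e3
      have e4 : c * om = om + Complex.I * σ * star om := by
        rw [hc, star_om]; linear_combination (Complex.I * σ) * om_quad
      have e5 : x = c * q.1 + Complex.I * σ * star om := by linear_combination hxc + e4
      rw [e5]
      rw [star_om] at *
      linear_combination ey - e4 - (Complex.I * σ) * om_quad

/-! ### The walls around the edge, in polar coordinates -/

/-- The deviation from the vertical of the circle of centre `-1` through the origin. -/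
noncomputable def circleDev (q : ℝ × ℝ) : ℝ := Real.arcsin (q.1 / 2)

noncomputable def wallAmp (q : ℝ × ℝ) : ℝ :=
  Real.sqrt ((1 + q.1 ^ 2) ^ 2 + (Real.sqrt 3 - q.2) ^ 2)

noncomputable def wallDev (q : ℝ × ℝ) : ℝ := Real.arcsin (2 * q.1 / wallAmp q)

noncomputable def wallAxis (q : ℝ × ℝ) : ℝ := Real.arctan ((Real.sqrt 3 - q.2) / (1 + q.1 ^ 2))

/-- The angle of the wall between two consecutive tetrahedra. -/
noncomputable def wallAngle (q : ℝ × ℝ) : ℝ := Real.pi / 2 + wallAxis q + wallDev q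

theorem wallAmp_sq (q : ℝ × ℝ) :
    wallAmp q ^ 2 = (1 + q.1 ^ 2) ^ 2 + (Real.sqrt 3 - q.2) ^ 2 :=
  Real.sq_sqrt (by positivity)

theorem wallAmp_pos (q : ℝ × ℝ) : 0 < wallAmp q := Real.sqrt_pos.2 (by positivity)

theorem continuous_circleDev : Continuous circleDev := by unfold circleDev; fun_prop

theorem continuous_wallAmp : Continuous wallAmp := by unfold wallAmp; fun_prop

theorem continuous_wallDev : Continuous wallDev :=
  Real.continuous_arcsin.comp
    ((continuous_const.mul continuous_fst).div continuous_wallAmp fun q => (wallAmp_pos q).ne')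

theorem continuous_wallAxis : Continuous wallAxis :=
  Real.continuous_arctan.comp
    ((continuous_const.sub continuous_snd).div (by fun_prop) fun q => by positivity)

theorem continuous_wallAngle : Continuous wallAngle :=
  (continuous_const.add continuous_wallAxis).add continuous_wallDev

theorem wallAmp_eq (q : ℝ × ℝ) :
    wallAmp q = (1 + q.1 ^ 2) *
      Real.sqrt (1 + ((Real.sqrt 3 - q.2) / (1 + q.1 ^ 2)) ^ 2) := by
  have h : 0 < 1 + q.1 ^ 2 := by positivity
  rw [← Real.sqrt_sq h.le, ← Real.sqrt_mul (by positivity), Real.sqrt_sq h.le, wallAmp]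
  congr 1
  field_simp

/-- Together with its companion for the sine, this is the amplitude–phase form of the linear
function with coefficients 1 + ρ² and √3 - t. -/
theorem wallAmp_mul_cos (q : ℝ × ℝ) : wallAmp q * Real.cos (wallAxis q) = 1 + q.1 ^ 2 := by
  have h : 0 < Real.sqrt (1 + ((Real.sqrt 3 - q.2) / (1 + q.1 ^ 2)) ^ 2) :=
    Real.sqrt_pos.2 (by positivity)
  rw [wallAxis, Real.cos_arctan, wallAmp_eq]
  field_simp

theorem wallAmp_mul_sin (q : ℝ × ℝ) :
    wallAmp q * Real.sin (wallAxis q) = Real.sqrt 3 - q.2 := by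
  have h : 0 < Real.sqrt (1 + ((Real.sqrt 3 - q.2) / (1 + q.1 ^ 2)) ^ 2) :=
    Real.sqrt_pos.2 (by positivity)
  rw [wallAxis, Real.sin_arctan, wallAmp_eq]
  have h2 : 0 < 1 + q.1 ^ 2 := by positivity
  field_simp

/-- The points that are so close to the edge that the walls around it are in their natural
order. -/
structure NearEdge (q : ℝ × ℝ) : Prop where
  nonneg : 0 ≤ q.1
  lt_half : q.1 < 1 / 2
  neg : q.2 < 0
  circle_lt : circleDev q < Real.pi / 12
  dev_lt : wallDev q < Real.pi / 12
  lt_axis : Real.pi / 3 < wallAxis q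

theorem tendsto_norm_snd (t₀ : ℝ) :
    Filter.Tendsto (fun p : ℂ × ℝ => (‖p.1‖, p.2)) (𝓝 (0, t₀)) (𝓝 (0, t₀)) := by
  have h : Continuous fun p : ℂ × ℝ => (‖p.1‖, p.2) := by fun_prop
  simpa using h.tendsto (0, t₀)

theorem circleDev_zero (t : ℝ) : circleDev (0, t) = 0 := by simp [circleDev]

theorem wallDev_zero (t : ℝ) : wallDev (0, t) = 0 := by simp [wallDev]

/-- Here the position of the edge on the negative half-axis enters: the slope √3 - t exceeds √3. -/
theorem lt_wallAxis_zero {t : ℝ} (ht : t < 0) : Real.pi / 3 < wallAxis (0, t) := by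
  rw [← Real.arctan_sqrt_three]
  apply Real.arctan_strictMono
  simp only
  rw [zero_pow two_ne_zero, add_zero, div_one]
  linarith

theorem eventually_nearEdge {t₀ : ℝ} (ht₀ : t₀ < 0) :
    ∀ᶠ q in 𝓝 ((0 : ℝ), t₀), 0 ≤ q.1 → NearEdge q := by
  have hpi := Real.pi_pos
  filter_upwards [continuous_fst.continuousAt.eventually_lt_const
      (show ((0 : ℝ), t₀).1 < 1 / 2 by norm_num),
    continuous_snd.continuousAt.eventually_lt_const (show ((0 : ℝ), t₀).2 < 0 from ht₀),
    continuous_circleDev.continuousAt.eventually_lt_const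
      (show circleDev (0, t₀) < Real.pi / 12 by rw [circleDev_zero]; positivity),
    continuous_wallDev.continuousAt.eventually_lt_const
      (show wallDev (0, t₀) < Real.pi / 12 by rw [wallDev_zero]; positivity),
    continuous_wallAxis.continuousAt.eventually_const_lt (lt_wallAxis_zero ht₀)]
    with q h1 h2 h3 h4 h5 h0
  exact ⟨h0, h1, h2, h3, h4, h5⟩

namespace NearEdge

theorem circle_nonneg {q : ℝ × ℝ} (h : NearEdge q) : 0 ≤ circleDev q :=
  Real.arcsin_nonneg.2 (by have := h.nonneg; positivity)

theorem dev_nonneg {q : ℝ × ℝ} (h : NearEdge q) : 0 ≤ wallDev q :=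
  Real.arcsin_nonneg.2 (div_nonneg (by have := h.nonneg; positivity) (wallAmp_pos q).le)

theorem sin_circleDev {q : ℝ × ℝ} (h : NearEdge q) : Real.sin (circleDev q) = q.1 / 2 :=
  Real.sin_arcsin (by linarith [h.nonneg]) (by linarith [h.lt_half])

/-- The argument of the arcsine is at most 1 because 2ρ ≤ 1 + ρ². -/
theorem sin_wallDev {q : ℝ × ℝ} (h : NearEdge q) : wallAmp q * Real.sin (wallDev q) = 2 * q.1 := by
  have hA := wallAmp_pos q
  have h1 : 2 * q.1 ≤ wallAmp q := by
    apply le_of_sq_le_sq _ hA.le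
    rw [wallAmp_sq]
    nlinarith [sq_nonneg (1 - q.1 ^ 2), sq_nonneg (Real.sqrt 3 - q.2)]
  have h2 := h.nonneg
  rw [wallDev, Real.sin_arcsin]
  · field_simp
  · have : 0 ≤ 2 * q.1 / wallAmp q := by positivity
    linarith
  · exact (div_le_one hA).2 h1

end NearEdge

/-! ### Sectors -/

/-- Since -sin b = cos(π/2 + b), this is monotonicity of the cosine in |x|; the lemmas on the
opposite sector fold the angle about π instead. -/
theorem neg_sin_le_cos {b x : ℝ} (hb' : b ≤ Real.pi / 2)
    (h1 : -(Real.pi / 2 + b) ≤ x) (h2 : x ≤ Real.pi / 2 + b) : -Real.sin b ≤ Real.cos x := by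
  rw [← Real.cos_abs x, ← Real.cos_add_pi_div_two, add_comm b]
  exact Real.cos_le_cos_of_nonneg_of_le_pi (abs_nonneg x) (by linarith) (abs_le.2 ⟨h1, h2⟩)

theorem neg_sin_lt_cos {b x : ℝ} (hb' : b ≤ Real.pi / 2)
    (h1 : -(Real.pi / 2 + b) < x) (h2 : x < Real.pi / 2 + b) : -Real.sin b < Real.cos x := by
  rw [← Real.cos_abs x, ← Real.cos_add_pi_div_two, add_comm b]
  exact Real.cos_lt_cos_of_nonneg_of_le_pi (abs_nonneg x) (by linarith) (abs_lt.2 ⟨h1, h2⟩)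

theorem cos_le_neg_sin {b x : ℝ} (hb : 0 ≤ b) (hb' : b ≤ Real.pi / 2)
    (h1 : Real.pi / 2 + b ≤ x) (h2 : x ≤ 3 * Real.pi / 2 - b) : Real.cos x ≤ -Real.sin b := by
  have e : Real.cos x = -Real.cos |x - Real.pi| := by
    rw [Real.cos_abs, Real.cos_sub_pi, neg_neg]
  rw [e, neg_le_neg_iff, ← Real.cos_pi_div_two_sub]
  exact Real.cos_le_cos_of_nonneg_of_le_pi (abs_nonneg _) (by linarith)
    (abs_le.2 ⟨by linarith, by linarith⟩)

theorem cos_lt_neg_sin {b x : ℝ} (hb : 0 ≤ b)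
    (h1 : Real.pi / 2 + b < x) (h2 : x < 3 * Real.pi / 2 - b) : Real.cos x < -Real.sin b := by
  have e : Real.cos x = -Real.cos |x - Real.pi| := by
    rw [Real.cos_abs, Real.cos_sub_pi, neg_neg]
  rw [e, neg_lt_neg_iff, ← Real.cos_pi_div_two_sub]
  exact Real.cos_lt_cos_of_nonneg_of_le_pi (abs_nonneg _) (by linarith)
    (abs_lt.2 ⟨by linarith, by linarith⟩)

theorem exists_polar (z : ℂ) (c : ℝ) :
    ∃ θ : ℝ, c ≤ θ ∧ θ < c + 2 * Real.pi ∧ z = ‖z‖ * Complex.exp (θ * Complex.I) := by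
  refine ⟨toIcoMod Real.two_pi_pos c z.arg, left_le_toIcoMod _ _ _,
    toIcoMod_lt_right _ _ _, ?_⟩
  have e : Complex.exp ((toIcoMod Real.two_pi_pos c z.arg : ℝ) * Complex.I) =
      Complex.exp (z.arg * Complex.I) := by
    rw [← self_sub_toIcoDiv_zsmul, Complex.exp_eq_exp_iff_exists_int]
    refine ⟨-toIcoDiv Real.two_pi_pos c z.arg, ?_⟩
    simp only [zsmul_eq_mul]
    push_cast
    ring
  rw [e, Complex.norm_mul_exp_arg_mul_I]

theorem polar_re {z : ℂ} {θ : ℝ} (h : z = ‖z‖ * Complex.exp (θ * Complex.I)) :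
    z.re = ‖z‖ * Real.cos θ := by
  conv_lhs => rw [h]
  rw [Complex.re_ofReal_mul, Complex.exp_ofReal_mul_I_re]

theorem polar_im {z : ℂ} {θ : ℝ} (h : z = ‖z‖ * Complex.exp (θ * Complex.I)) :
    z.im = ‖z‖ * Real.sin θ := by
  conv_lhs => rw [h]
  rw [Complex.im_ofReal_mul, Complex.exp_ofReal_mul_I_im]

theorem polar_of {z : ℂ} {θ : ℝ} (h1 : z.re = ‖z‖ * Real.cos θ) (h2 : z.im = ‖z‖ * Real.sin θ) :
    z = ‖z‖ * Complex.exp (θ * Complex.I) := by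
  apply Complex.ext
  · rw [h1, Complex.re_ofReal_mul, Complex.exp_ofReal_mul_I_re]
  · rw [h2, Complex.im_ofReal_mul, Complex.exp_ofReal_mul_I_im]

/-- The determination of a wall by the real part and the sign of the imaginary part. -/
theorem polar_iff_of_rotate {z : ℂ} {b c : ℝ} (hb : 0 ≤ Real.cos b) :
    (z = ‖z‖ * Complex.exp ((c + (Real.pi / 2 + b) : ℝ) * Complex.I)) ↔
      z.re * Real.cos c + z.im * Real.sin c = -(‖z‖ * Real.sin b) ∧
      0 ≤ z.im * Real.cos c - z.re * Real.sin c := by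
  have hc := Real.sin_sq_add_cos_sq c
  have hn := norm_sq_eq z
  have hbb := Real.sin_sq_add_cos_sq b
  have e1 : Real.cos (c + (Real.pi / 2 + b)) =
      -(Real.cos c * Real.sin b) - Real.sin c * Real.cos b := by
    rw [Real.cos_add, add_comm (Real.pi / 2), Real.cos_add_pi_div_two, Real.sin_add_pi_div_two]
    ring
  have e2 : Real.sin (c + (Real.pi / 2 + b)) =
      -(Real.sin c * Real.sin b) + Real.cos c * Real.cos b := by
    rw [Real.sin_add, add_comm (Real.pi / 2), Real.cos_add_pi_div_two, Real.sin_add_pi_div_two]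
    ring
  constructor
  · intro h
    rw [polar_re h, polar_im h, e1, e2]
    constructor
    · linear_combination (-(‖z‖ * Real.sin b)) * hc
    · have : ‖z‖ * Real.cos b ≥ 0 := mul_nonneg (norm_nonneg _) hb
      nlinarith
  · rintro ⟨h1, h2⟩
    have h3 : z.im * Real.cos c - z.re * Real.sin c = ‖z‖ * Real.cos b := by
      apply (sq_eq_sq₀ h2 (mul_nonneg (norm_nonneg _) hb)).1
      have h4 : (z.re * Real.cos c + z.im * Real.sin c) ^ 2 = (‖z‖ * Real.sin b) ^ 2 := by
        rw [h1]; ring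
      linear_combination (z.re ^ 2 + z.im ^ 2) * hc - h4 - hn - ‖z‖ ^ 2 * hbb
    apply polar_of
    · rw [e1]
      linear_combination Real.cos c * h1 - Real.sin c * h3 - z.re * hc
    · rw [e2]
      linear_combination Real.sin c * h1 + Real.cos c * h3 - z.im * hc

/-- The function whose sign tells the two sides of the wall between two tetrahedra. -/
noncomputable def wallFun (p : ℂ × ℝ) : ℝ :=
  (1 + ‖p.1‖ ^ 2) * p.1.re + (Real.sqrt 3 - p.2) * p.1.im + 2 * ‖p.1‖ ^ 2

/-- The function whose sign tells the two opposite walls. -/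
noncomputable def wallSide (p : ℂ × ℝ) : ℝ :=
  (1 + ‖p.1‖ ^ 2) * p.1.im - (Real.sqrt 3 - p.2) * p.1.re

/-- In polar coordinates the wall is a shifted cosine, deviating from its axis by `wallDev`; the
quadratic term 2|z|² produces the deviation. -/
theorem wallFun_polar {p : ℂ × ℝ} (h : NearEdge (‖p.1‖, p.2)) {θ : ℝ}
    (hθ : p.1 = ‖p.1‖ * Complex.exp (θ * Complex.I)) :
    wallFun p = ‖p.1‖ * wallAmp (‖p.1‖, p.2) *
      (Real.cos (θ - wallAxis (‖p.1‖, p.2)) + Real.sin (wallDev (‖p.1‖, p.2))) := by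
  have h1 := wallAmp_mul_cos (‖p.1‖, p.2)
  have h2 := wallAmp_mul_sin (‖p.1‖, p.2)
  have h3 := h.sin_wallDev
  simp only at h1 h2 h3
  rw [wallFun, polar_re hθ, polar_im hθ, ← h1, ← h2, Real.cos_sub]
  linear_combination -‖p.1‖ * h3

theorem circle_polar {p : ℂ × ℝ} (h : NearEdge (‖p.1‖, p.2)) {θ : ℝ}
    (hθ : p.1 = ‖p.1‖ * Complex.exp (θ * Complex.I)) :
    ‖p.1 + 1‖ ^ 2 = 1 + 2 * ‖p.1‖ * (Real.cos θ + Real.sin (circleDev (‖p.1‖, p.2))) := by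
  have h1 := norm_sq_eq p.1
  rw [h.sin_circleDev, norm_sq_eq, Complex.add_re, Complex.add_im, Complex.one_re, Complex.one_im]
  have := polar_re hθ
  simp only
  linear_combination 2 * this - h1

/-! ### Wedges described by inequalities -/

theorem mem_wedge_of_zero {a b : ℝ × ℝ → ℝ} {p : ℂ × ℝ} (h0 : p.1 = 0)
    (h : a (‖p.1‖, p.2) ≤ b (‖p.1‖, p.2)) : p ∈ Wedge a b :=
  ⟨_, le_rfl, h, by simp [h0]⟩

theorem wallFun_zero {p : ℂ × ℝ} (h0 : p.1 = 0) : wallFun p = 0 := by simp [wallFun, h0]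

section Signs

variable {p : ℂ × ℝ} {θ : ℝ}

theorem wallFun_nonneg_iff (h : NearEdge (‖p.1‖, p.2)) (h0 : p.1 ≠ 0)
    (hθ : p.1 = ‖p.1‖ * Complex.exp (θ * Complex.I)) :
    0 ≤ wallFun p ↔
      -Real.sin (wallDev (‖p.1‖, p.2)) ≤ Real.cos (θ - wallAxis (‖p.1‖, p.2)) := by
  rw [wallFun_polar h hθ, mul_nonneg_iff_of_pos_left
    (mul_pos (norm_pos_iff.2 h0) (wallAmp_pos _)), neg_le_iff_add_nonneg]

theorem wallFun_nonpos_iff (h : NearEdge (‖p.1‖, p.2)) (h0 : p.1 ≠ 0)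
    (hθ : p.1 = ‖p.1‖ * Complex.exp (θ * Complex.I)) :
    wallFun p ≤ 0 ↔
      Real.cos (θ - wallAxis (‖p.1‖, p.2)) ≤ -Real.sin (wallDev (‖p.1‖, p.2)) := by
  rw [wallFun_polar h hθ, ← neg_nonneg, ← mul_neg, mul_nonneg_iff_of_pos_left
    (mul_pos (norm_pos_iff.2 h0) (wallAmp_pos _)), neg_nonneg, le_neg_iff_add_nonpos_right]

theorem norm_add_one_le_iff (h : NearEdge (‖p.1‖, p.2)) (h0 : p.1 ≠ 0)
    (hθ : p.1 = ‖p.1‖ * Complex.exp (θ * Complex.I)) :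
    ‖p.1 + 1‖ ≤ 1 ↔ Real.cos θ ≤ -Real.sin (circleDev (‖p.1‖, p.2)) := by
  rw [← sq_le_one_iff₀ (norm_nonneg _), circle_polar h hθ, add_le_iff_nonpos_right,
    ← neg_nonneg, ← mul_neg, mul_nonneg_iff_of_pos_left
    (mul_pos two_pos (norm_pos_iff.2 h0)), neg_nonneg, le_neg_iff_add_nonpos_right]

theorem one_le_norm_add_one_iff (h : NearEdge (‖p.1‖, p.2)) (h0 : p.1 ≠ 0)
    (hθ : p.1 = ‖p.1‖ * Complex.exp (θ * Complex.I)) :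
    1 ≤ ‖p.1 + 1‖ ↔ -Real.sin (circleDev (‖p.1‖, p.2)) ≤ Real.cos θ := by
  rw [← one_le_sq_iff₀ (norm_nonneg _), circle_polar h hθ, le_add_iff_nonneg_right,
    mul_nonneg_iff_of_pos_left
    (mul_pos two_pos (norm_pos_iff.2 h0)), neg_le_iff_add_nonneg]

end Signs

/-- The first wall of the slab, counted anticlockwise. -/
noncomputable def arcAngle (q : ℝ × ℝ) : ℝ := Real.pi / 2 + circleDev q

noncomputable def arcAngle' (q : ℝ × ℝ) : ℝ := 3 * Real.pi / 2 - circleDev q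

theorem NearEdge.axis_lt {q : ℝ × ℝ} : wallAxis q < Real.pi / 2 := Real.arctan_lt_pi_div_two _

/-- One inequality bounds the angle from below by the circle, the other from above by the wall. -/
theorem mem_wedge_arc_wall {p : ℂ × ℝ} (h : NearEdge (‖p.1‖, p.2)) :
    p ∈ Wedge arcAngle wallAngle ↔ ‖p.1 + 1‖ ≤ 1 ∧ 0 ≤ wallFun p := by
  have hpi := Real.pi_pos
  have h1 := h.circle_nonneg
  have h2 := h.dev_nonneg
  have h3 := h.circle_lt
  have h4 := h.dev_lt
  have h5 := h.lt_axis
  have h6 : wallAxis (‖p.1‖, p.2) < Real.pi / 2 := NearEdge.axis_lt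
  by_cases h0 : p.1 = 0
  · exact iff_of_true (mem_wedge_of_zero h0 (by unfold arcAngle wallAngle; linarith))
      ⟨by simp [h0], (wallFun_zero h0).ge⟩
  constructor
  · rintro ⟨θ, t1, t2, hθ⟩
    unfold arcAngle at t1
    unfold wallAngle at t2
    rw [norm_add_one_le_iff h h0 hθ, wallFun_nonneg_iff h h0 hθ]
    exact ⟨cos_le_neg_sin h1 (by linarith) (by linarith) (by linarith),
      neg_sin_le_cos (by linarith) (by linarith) (by linarith)⟩
  · rintro ⟨e1, e2⟩
    -- The window of angles starts at the opposite wall, so that `wallFun` is nonnegative exactly on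
    -- its initial part.
    obtain ⟨θ, t1, t2, hθ⟩ :=
      exists_polar p.1 (wallAxis (‖p.1‖, p.2) - Real.pi / 2 - wallDev (‖p.1‖, p.2))
    rw [norm_add_one_le_iff h h0 hθ] at e1
    rw [wallFun_nonneg_iff h h0 hθ] at e2
    have t3 : θ ≤ wallAngle (‖p.1‖, p.2) := by
      by_contra hneg
      unfold wallAngle at hneg
      exact absurd e2 (not_le.2 (cos_lt_neg_sin h2 (by linarith) (by linarith)))
    refine ⟨θ, ?_, t3, hθ⟩
    by_contra hneg
    unfold arcAngle at hneg
    exact absurd e1 (not_le.2 (neg_sin_lt_cos (by linarith) (by linarith) (by linarith)))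

theorem mem_wedge_wall_arc {p : ℂ × ℝ} (h : NearEdge (‖p.1‖, p.2)) :
    p ∈ Wedge wallAngle arcAngle' ↔ ‖p.1 + 1‖ ≤ 1 ∧ wallFun p ≤ 0 := by
  have hpi := Real.pi_pos
  have h1 := h.circle_nonneg
  have h2 := h.dev_nonneg
  have h3 := h.circle_lt
  have h4 := h.dev_lt
  have h5 := h.lt_axis
  have h6 : wallAxis (‖p.1‖, p.2) < Real.pi / 2 := NearEdge.axis_lt
  by_cases h0 : p.1 = 0
  · exact iff_of_true (mem_wedge_of_zero h0 (by unfold arcAngle' wallAngle; linarith))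
      ⟨by simp [h0], (wallFun_zero h0).le⟩
  constructor
  · rintro ⟨θ, t1, t2, hθ⟩
    unfold arcAngle' at t2
    unfold wallAngle at t1
    rw [norm_add_one_le_iff h h0 hθ, wallFun_nonpos_iff h h0 hθ]
    exact ⟨cos_le_neg_sin h1 (by linarith) (by linarith) (by linarith),
      cos_le_neg_sin h2 (by linarith) (by linarith) (by linarith)⟩
  · rintro ⟨e1, e2⟩
    obtain ⟨θ, t1, t2, hθ⟩ :=
      exists_polar p.1 (-(Real.pi / 2) - circleDev (‖p.1‖, p.2))
    rw [norm_add_one_le_iff h h0 hθ] at e1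
    rw [wallFun_nonpos_iff h h0 hθ] at e2
    -- The left end of the window is itself on the circle; it represents the upper wall one turn too
    -- low and is shifted by 2π below.
    have t0 : Real.pi / 2 + circleDev (‖p.1‖, p.2) ≤ θ ∨
        θ = -(Real.pi / 2 + circleDev (‖p.1‖, p.2)) := by
      by_contra hneg
      push Not at hneg
      have : -(Real.pi / 2 + circleDev (‖p.1‖, p.2)) < θ :=
        lt_of_le_of_ne (by linarith) (Ne.symm hneg.2)
      exact absurd e1 (not_le.2 (neg_sin_lt_cos (by linarith) this hneg.1))
    rcases t0 with t0 | t0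
    · refine ⟨θ, ?_, by unfold arcAngle'; linarith, hθ⟩
      by_contra hneg
      unfold wallAngle at hneg
      exact absurd e2 (not_le.2 (neg_sin_lt_cos (by linarith) (by linarith) (by linarith)))
    · refine ⟨arcAngle' (‖p.1‖, p.2), by unfold arcAngle' wallAngle; linarith, le_rfl, ?_⟩
      rw [hθ]
      have : arcAngle' (‖p.1‖, p.2) = θ + 2 * Real.pi := by unfold arcAngle'; linarith
      rw [← hθ, this]
      push_cast
      rw [add_mul, Complex.exp_add, Complex.exp_two_pi_mul_I, mul_one, ← hθ]

theorem mul_exp_rot {z : ℂ} {θ : ℝ} (h : z = ‖z‖ * Complex.exp (θ * Complex.I)) :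
    -om * z = ‖-om * z‖ * Complex.exp ((θ + Real.pi / 3 : ℝ) * Complex.I) := by
  have e : Complex.exp ((Real.pi / 3 : ℝ) * Complex.I) = -om := by
    apply Complex.ext
    · rw [Complex.exp_ofReal_mul_I_re, Real.cos_pi_div_three]; simp [om_re]
    · rw [Complex.exp_ofReal_mul_I_im, Real.sin_pi_div_three]; simp [om_im]
  rw [norm_mul, norm_neg, norm_om, one_mul]
  push_cast
  push_cast at e
  rw [add_mul, Complex.exp_add, e]
  conv_lhs => rw [h]
  ring

theorem norm_rot (z : ℂ) : ‖-om * z‖ = ‖z‖ := by rw [norm_mul, norm_neg, norm_om, one_mul]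

/-- The second wall is the first rotated by -π/3, since rotating the point by π/3 preserves |z| and
t. -/
theorem mem_wedge_wall_wall {p : ℂ × ℝ} (h : NearEdge (‖p.1‖, p.2)) :
    p ∈ Wedge (fun q => wallAngle q - Real.pi / 3) wallAngle ↔
      0 ≤ wallFun p ∧ wallFun (-om * p.1, p.2) ≤ 0 := by
  have hpi := Real.pi_pos
  have h1 := h.circle_nonneg
  have h2 := h.dev_nonneg
  have h3 := h.circle_lt
  have h4 := h.dev_lt
  have h5 := h.lt_axis
  have h6 : wallAxis (‖p.1‖, p.2) < Real.pi / 2 := NearEdge.axis_lt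
  by_cases h0 : p.1 = 0
  · exact iff_of_true (mem_wedge_of_zero h0 (by linarith))
      ⟨(wallFun_zero h0).ge, (wallFun_zero (by simp [h0])).le⟩
  have h' : NearEdge (‖(-om * p.1, p.2).1‖, (-om * p.1, p.2).2) := by
    simp only [norm_rot]; exact h
  have h0' : (-om * p.1, p.2).1 ≠ 0 := by simp [om_ne_zero, h0]
  constructor
  · rintro ⟨θ, t1, t2, hθ⟩
    rw [wallFun_nonneg_iff h h0 hθ, wallFun_nonpos_iff h' h0' (mul_exp_rot hθ)]
    simp only [norm_rot]
    unfold wallAngle at t1 t2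
    exact ⟨neg_sin_le_cos (by linarith) (by linarith) (by linarith),
      cos_le_neg_sin h2 (by linarith) (by linarith) (by linarith)⟩
  · rintro ⟨e1, e2⟩
    obtain ⟨θ, t1, t2, hθ⟩ :=
      exists_polar p.1 (wallAxis (‖p.1‖, p.2) - Real.pi / 2 - wallDev (‖p.1‖, p.2))
    rw [wallFun_nonneg_iff h h0 hθ] at e1
    rw [wallFun_nonpos_iff h' h0' (mul_exp_rot hθ)] at e2
    simp only [norm_rot] at e2
    have t3 : θ ≤ wallAngle (‖p.1‖, p.2) := by
      by_contra hneg
      unfold wallAngle at hneg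
      exact absurd e1 (not_le.2 (cos_lt_neg_sin h2 (by linarith) (by linarith)))
    refine ⟨θ, ?_, t3, hθ⟩
    by_contra hneg
    unfold wallAngle at hneg
    exact absurd e2 (not_le.2 (neg_sin_lt_cos (by linarith) (by linarith) (by linarith)))

theorem mem_wedge_ray_arc {p : ℂ × ℝ} (h : NearEdge (‖p.1‖, p.2)) :
    p ∈ Wedge (fun _ => -(Real.pi / 6)) arcAngle ↔
      1 ≤ ‖p.1 + 1‖ ∧ 0 ≤ p.1.re + Real.sqrt 3 * p.1.im := by
  have hpi := Real.pi_pos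
  obtain ⟨h1, h2⟩ := And.intro h.circle_nonneg h.circle_lt
  by_cases h0 : p.1 = 0
  · exact iff_of_true (mem_wedge_of_zero h0 (by unfold arcAngle; linarith)) (by simp [h0])
  have hn := norm_pos_iff.2 h0
  have key : ∀ θ : ℝ, p.1 = ‖p.1‖ * Complex.exp (θ * Complex.I) →
      (0 ≤ p.1.re + Real.sqrt 3 * p.1.im ↔ -Real.sin 0 ≤ Real.cos (θ - Real.pi / 3)) := by
    intro θ hθ
    have : p.1.re + Real.sqrt 3 * p.1.im = 2 * ‖p.1‖ * Real.cos (θ - Real.pi / 3) := by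
      rw [Real.cos_sub, Real.cos_pi_div_three, Real.sin_pi_div_three]
      linear_combination polar_re hθ + Real.sqrt 3 * polar_im hθ
    rw [this, mul_nonneg_iff_of_pos_left (by positivity), Real.sin_zero, neg_zero]
  constructor
  · rintro ⟨θ, t1, t2, hθ⟩
    unfold arcAngle at t2
    rw [one_le_norm_add_one_iff h h0 hθ, key θ hθ]
    exact ⟨neg_sin_le_cos (by linarith) (by linarith) (by linarith),
      neg_sin_le_cos (by linarith) (by linarith) (by linarith)⟩
  · rintro ⟨e1, e2⟩
    obtain ⟨θ, t1, t2, hθ⟩ := exists_polar p.1 (-(Real.pi / 6))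
    rw [one_le_norm_add_one_iff h h0 hθ] at e1
    rw [key θ hθ] at e2
    refine ⟨θ, t1, ?_, hθ⟩
    have t3 : θ ≤ 5 * Real.pi / 6 := by
      by_contra hneg
      exact absurd e2 (not_le.2 (cos_lt_neg_sin le_rfl (by linarith) (by linarith)))
    by_contra hneg
    unfold arcAngle at hneg
    exact absurd e1 (not_le.2 (cos_lt_neg_sin h1 (by linarith) (by linarith)))

theorem mem_wedge_arc_vert {p : ℂ × ℝ} (h : NearEdge (‖p.1‖, p.2)) :
    p ∈ Wedge arcAngle' (fun _ => 3 * Real.pi / 2) ↔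
      1 ≤ ‖p.1 + 1‖ ∧ p.1.re ≤ 0 ∧ p.1.im ≤ 0 := by
  have hpi := Real.pi_pos
  obtain ⟨h1, h2⟩ := And.intro h.circle_nonneg h.circle_lt
  by_cases h0 : p.1 = 0
  · exact iff_of_true (mem_wedge_of_zero h0 (by unfold arcAngle'; linarith)) (by simp [h0])
  have hn := norm_pos_iff.2 h0
  constructor
  · rintro ⟨θ, t1, t2, hθ⟩
    unfold arcAngle' at t1
    have e := Real.cos_sub_two_pi θ
    rw [one_le_norm_add_one_iff h h0 hθ, polar_re hθ, polar_im hθ, ← e]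
    refine ⟨neg_sin_le_cos (by linarith) (by linarith) (by linarith),
      mul_nonpos_of_nonneg_of_nonpos hn.le ?_, mul_nonpos_of_nonneg_of_nonpos hn.le ?_⟩
    · rw [e]
      exact Real.cos_nonpos_of_pi_div_two_le_of_le (by linarith) (by linarith)
    · rw [← neg_nonneg, ← Real.sin_sub_pi]
      exact Real.sin_nonneg_of_nonneg_of_le_pi (by linarith) (by linarith)
  · rintro ⟨e1, e2, e3⟩
    obtain ⟨θ, t1, t2, hθ⟩ := exists_polar p.1 0
    rw [one_le_norm_add_one_iff h h0 hθ] at e1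
    rw [polar_re hθ, mul_nonpos_iff_pos_imp_nonpos] at e2
    rw [polar_im hθ, mul_nonpos_iff_pos_imp_nonpos] at e3
    have e2 := e2.1 hn
    have e3 := e3.1 hn
    have t3 : θ ≤ 3 * Real.pi / 2 := by
      by_contra hneg
      have : 0 < Real.cos (θ - 2 * Real.pi) :=
        Real.cos_pos_of_mem_Ioo ⟨by linarith, by linarith⟩
      rw [Real.cos_sub_two_pi] at this
      linarith
    have t4 : Real.pi / 2 ≤ θ := by
      by_contra hneg
      have : 0 < Real.cos θ := Real.cos_pos_of_mem_Ioo ⟨by linarith, by linarith⟩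
      linarith
    have t5 : Real.pi ≤ θ := by
      by_contra hneg
      have : 0 < Real.sin θ := Real.sin_pos_of_mem_Ioo ⟨by linarith, by linarith⟩
      linarith
    refine ⟨θ, ?_, t3, hθ⟩
    by_contra hneg
    unfold arcAngle' at hneg
    exact absurd e1 (not_le.2 (cos_lt_neg_sin h1 (by linarith) (by linarith)))

/-! ### Walls described by equations -/

theorem onWall_wallAngle_iff {p : ℂ × ℝ} (h : NearEdge (‖p.1‖, p.2)) :
    OnWall wallAngle p ↔ wallFun p = 0 ∧ 0 ≤ wallSide p := by
  have hpi := Real.pi_pos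
  have hb : 0 ≤ Real.cos (wallDev (‖p.1‖, p.2)) :=
    Real.cos_nonneg_of_neg_pi_div_two_le_of_le (by linarith [h.dev_nonneg]) (by linarith [h.dev_lt])
  have e : wallAngle (‖p.1‖, p.2) =
      wallAxis (‖p.1‖, p.2) + (Real.pi / 2 + wallDev (‖p.1‖, p.2)) := by unfold wallAngle; ring
  have h1 := wallAmp_mul_cos (‖p.1‖, p.2)
  have h2 := wallAmp_mul_sin (‖p.1‖, p.2)
  have h3 := h.sin_wallDev
  have hA := wallAmp_pos (‖p.1‖, p.2)
  simp only at h1 h2 h3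
  unfold OnWall
  rw [e, polar_iff_of_rotate hb]
  have e1 : wallFun p = wallAmp (‖p.1‖, p.2) * ((p.1.re * Real.cos (wallAxis (‖p.1‖, p.2)) +
      p.1.im * Real.sin (wallAxis (‖p.1‖, p.2))) +
      ‖p.1‖ * Real.sin (wallDev (‖p.1‖, p.2))) := by
    rw [wallFun]
    linear_combination -p.1.re * h1 - p.1.im * h2 - ‖p.1‖ * h3
  have e2 : wallSide p = wallAmp (‖p.1‖, p.2) * (p.1.im * Real.cos (wallAxis (‖p.1‖, p.2)) -
      p.1.re * Real.sin (wallAxis (‖p.1‖, p.2))) := by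
    rw [wallSide]
    linear_combination -p.1.im * h1 + p.1.re * h2
  rw [e1, e2, mul_nonneg_iff_of_pos_left hA, mul_eq_zero, or_iff_right hA.ne',
    ← eq_neg_iff_add_eq_zero]

theorem norm_add_one_eq_one_iff (z : ℂ) : ‖z + 1‖ = 1 ↔ ‖z‖ ^ 2 + 2 * z.re = 0 := by
  rw [← sq_eq_sq₀ (norm_nonneg _) zero_le_one, norm_sq_eq, norm_sq_eq z, Complex.add_re,
    Complex.add_im, Complex.one_re, Complex.one_im]
  constructor <;> intro h <;> linarith

theorem onWall_arcAngle_iff {p : ℂ × ℝ} (h : NearEdge (‖p.1‖, p.2)) :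
    OnWall arcAngle p ↔ ‖p.1 + 1‖ = 1 ∧ 0 ≤ p.1.im := by
  have hpi := Real.pi_pos
  have hb : 0 ≤ Real.cos (circleDev (‖p.1‖, p.2)) :=
    Real.cos_nonneg_of_neg_pi_div_two_le_of_le (by linarith [h.circle_nonneg])
      (by linarith [h.circle_lt])
  have := polar_iff_of_rotate (z := p.1) (c := 0) hb
  rw [zero_add] at this
  unfold OnWall arcAngle
  rw [this, h.sin_circleDev, norm_add_one_eq_one_iff]
  simp only [Real.cos_zero, Real.sin_zero, mul_one, mul_zero, add_zero, sub_zero]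
  refine and_congr ?_ Iff.rfl
  constructor <;> intro h <;> linarith

/-- Complex conjugation exchanges the two circle walls, up to a full turn. -/
theorem onWall_arcAngle'_iff {p : ℂ × ℝ} (h : NearEdge (‖p.1‖, p.2)) :
    OnWall arcAngle' p ↔ ‖p.1 + 1‖ = 1 ∧ p.1.im ≤ 0 := by
  have h' : NearEdge (‖((starRingEnd ℂ) p.1, p.2).1‖, ((starRingEnd ℂ) p.1, p.2).2) := by
    simp only [RCLike.norm_conj]; exact h
  have e := onWall_arcAngle_iff h'
  have e1 : ‖(starRingEnd ℂ) p.1 + 1‖ = ‖p.1 + 1‖ := by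
    rw [← RCLike.norm_conj (p.1 + 1), map_add, map_one]
  simp only [e1, Complex.conj_im, neg_nonneg] at e
  rw [← e]
  unfold OnWall
  simp only [RCLike.norm_conj]
  have e2 : arcAngle' (‖p.1‖, p.2) = -arcAngle (‖p.1‖, p.2) + 2 * Real.pi := by
    unfold arcAngle arcAngle'; ring
  have e3 : Complex.exp ((arcAngle' (‖p.1‖, p.2) : ℝ) * Complex.I) =
      (starRingEnd ℂ) (Complex.exp ((arcAngle (‖p.1‖, p.2) : ℝ) * Complex.I)) := by
    rw [e2, ← Complex.exp_conj]
    push_cast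
    rw [add_mul, Complex.exp_add, Complex.exp_two_pi_mul_I, mul_one]
    simp
  rw [e3]
  constructor
  · intro h2
    conv_lhs => rw [h2]
    simp
  · intro h2
    have := congrArg (starRingEnd ℂ) h2
    simpa using this

/-! ### The tetrahedra in the coordinates adapted to the edge -/

/-- The strict inequality defining an edge point reduces to √3 < √3 - t. -/
theorem isEdgePoint_Kmap {t : ℝ} (ht₀ : t < 0) : IsEdgePoint (Kmap (0, t)) := by
  have hne : ((0 : ℂ), t).1 ≠ -1 := by simp
  have hw := Kden_ne_zero hne
  refine ⟨?_, ?_⟩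
  · rw [ht_Kmap hne]
    simp only [Kmap, zero_add, mul_one]
    rw [← mul_div_assoc, mul_comm (star om), om_mul_star, one_div]
  · simp only [Kmap, zero_add, mul_one, norm_div, norm_om, Complex.inv_im, div_pow,
      Complex.normSq_eq_norm_sq]
    have h1 : (Kden (0, t)).im = t / 2 - Real.sqrt 3 / 2 := by
      simp [Kden, ht_im, om_im]; ring
    have h2 : 0 < ‖Kden (0, t)‖ ^ 2 := by have := norm_pos_iff.2 hw; positivity
    rw [h1, ← mul_div_assoc, ← mul_div_assoc, div_lt_div_iff_of_pos_right h2]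
    linarith

theorem Kden_im (p : ℂ × ℝ) : (Kden p).im = p.2 / 2 - p.1.im - Real.sqrt 3 / 2 := by
  simp [Kden, ht_im, om_im]; ring

/-- This is where `wallFun` comes from: it measures which of the two moduli in |z+ω| = |ht -
ω̄|/|Kden| is larger after applying `Kmap`. -/
theorem norm_Kden_sq (p : ℂ × ℝ) : ‖Kden p‖ ^ 2 = ‖ht p - star om‖ ^ 2 + wallFun p := by
  have h := norm_sq_eq p.1
  have e1 : (ht p - star om).re = -(‖p.1‖ ^ 2 / 2) + 1 / 2 := by
    rw [Complex.sub_re, ht_re]; simp [om_re]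
  have e2 : (ht p - star om).im = p.2 / 2 - Real.sqrt 3 / 2 := by
    rw [Complex.sub_im, ht_im]; simp [om_im]
  have e3 : ‖p.1 + 1‖ ^ 2 = ‖p.1‖ ^ 2 + 2 * p.1.re + 1 := by
    rw [norm_sq_eq, norm_sq_eq p.1]; simp; ring
  rw [norm_sq_eq, norm_sq_eq (ht p - star om), e1, e2, Kden_re, Kden_im, wallFun, e3]
  linear_combination -h

theorem Kmap_fst_add_om {p : ℂ × ℝ} (hp : p.1 ≠ -1) :
    (Kmap p).1 + om = om * (ht p - star om) / Kden p := by
  have hw := Kden_ne_zero hp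
  rw [eq_div_iff hw, add_mul, Kmap, div_mul_cancel₀ _ hw, Kden, star_om]
  ring

/-- The numerator is `Kden` at the rotated point, which explains why the bottom face of type A
becomes the vertical wall rotated by -π/3. -/
theorem Kmap_offset {p : ℂ × ℝ} (hp : p.1 ≠ -1) :
    ht (Kmap p) - star om * (Kmap p).1 + om = om * Kden (-om * p.1, p.2) / Kden p := by
  have hw := Kden_ne_zero hp
  have e : Kden (-om * p.1, p.2) = ht p + om * p.1 + om := by
    rw [Kden, ht_rot]; ring
  have hq := om_quad
  rw [eq_div_iff hw, ht_Kmap hp, add_mul, sub_mul, inv_mul_cancel₀ hw, Kmap, mul_assoc,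
    div_mul_cancel₀ _ hw, e, star_om, Kden]
  linear_combination hq

theorem norm_Kmap_le_iff {p : ℂ × ℝ} (hp : p.1 ≠ -1) :
    ‖(Kmap p).1‖ ≤ ‖ht (Kmap p)‖ ↔ ‖p.1 + 1‖ ≤ 1 := by
  have hw := norm_pos_iff.2 (Kden_ne_zero hp)
  rw [ht_Kmap hp, Kmap, norm_div, norm_mul, norm_om, one_mul, norm_inv, inv_eq_one_div,
    div_le_div_iff_of_pos_right hw]

theorem norm_Kmap_add_om {p : ℂ × ℝ} (hp : p.1 ≠ -1) :
    ‖(Kmap p).1 + om‖ = ‖ht p - star om‖ / ‖Kden p‖ := by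
  rw [Kmap_fst_add_om hp, norm_div, norm_mul, norm_om, one_mul]

theorem norm_Kmap_add_om_le_iff {p : ℂ × ℝ} (hp : p.1 ≠ -1) :
    ‖(Kmap p).1 + om‖ ≤ 1 ↔ 0 ≤ wallFun p := by
  have hw := norm_pos_iff.2 (Kden_ne_zero hp)
  rw [norm_Kmap_add_om hp, div_le_one hw,
    ← pow_le_pow_iff_left₀ (norm_nonneg _) hw.le two_ne_zero, norm_Kden_sq, le_add_iff_nonneg_right]

theorem le_norm_Kmap_add_om_iff {p : ℂ × ℝ} (hp : p.1 ≠ -1) :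
    1 ≤ ‖(Kmap p).1 + om‖ ↔ wallFun p ≤ 0 := by
  have hw := norm_pos_iff.2 (Kden_ne_zero hp)
  rw [norm_Kmap_add_om hp, one_le_div hw,
    ← pow_le_pow_iff_left₀ hw.le (norm_nonneg _) two_ne_zero, norm_Kden_sq, add_le_iff_nonpos_right]

theorem norm_Kmap_offset_le_iff {p : ℂ × ℝ} (hp : p.1 ≠ -1) :
    ‖ht (Kmap p) - star om * (Kmap p).1 + om‖ ≤ ‖(Kmap p).1 + om‖ ↔
      wallFun (-om * p.1, p.2) ≤ 0 := by
  have hw := norm_pos_iff.2 (Kden_ne_zero hp)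
  rw [norm_Kmap_add_om hp, Kmap_offset hp, norm_div, norm_mul, norm_om, one_mul,
    div_le_div_iff_of_pos_right hw,
    ← pow_le_pow_iff_left₀ (norm_nonneg _) (norm_nonneg (ht p - star om)) two_ne_zero,
    norm_Kden_sq, ht_rot, add_le_iff_nonpos_right]

/-- The sheet wallFun = 0 consists of two opposite walls; the height condition on the face selects
one of them. -/
theorem Kmap_side_nonneg_iff {p : ℂ × ℝ} (hp : p.1 ≠ -1) :
    0 ≤ (ht (Kmap p) - star om * (Kmap p).1).im ↔ 0 ≤ wallSide p := by
  have hw := Kden_ne_zero hp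
  have hN : 0 < Complex.normSq (Kden p) := Complex.normSq_pos.2 hw
  have e : (ht (Kmap p) - star om * (Kmap p).1) * (Complex.normSq (Kden p) : ℂ) =
      -p.1 * (starRingEnd ℂ) (Kden p) := by
    rw [← Complex.mul_conj, ← mul_assoc]
    congr 1
    rw [ht_Kmap hp, sub_mul, inv_mul_cancel₀ hw, Kmap, mul_assoc, div_mul_cancel₀ _ hw]
    linear_combination (-p.1 - 1) * om_mul_star
  have e1 := congrArg Complex.im e
  have h3 : ‖p.1 + 1‖ ^ 2 = ‖p.1‖ ^ 2 + 2 * p.1.re + 1 := by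
    rw [norm_sq_eq, norm_sq_eq p.1]; simp; ring
  rw [Complex.im_mul_ofReal, Complex.mul_im, Complex.neg_re, Complex.neg_im, Complex.conj_re,
    Complex.conj_im, Kden_re, Kden_im, h3] at e1
  have e2 : (ht (Kmap p) - star om * (Kmap p).1).im * Complex.normSq (Kden p) =
      wallSide p / 2 := by
    rw [e1, wallSide]; ring
  constructor
  · intro h
    have := mul_nonneg h hN.le
    linarith
  · intro h
    by_contra hneg
    have := mul_neg_of_neg_of_pos (not_le.1 hneg) hN
    linarith

theorem tendsto_Kmap (t : ℝ) :
    Filter.Tendsto Kmap (𝓝 ((0 : ℂ), t)) (𝓝 (Kmap (0, t))) :=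
  continuousAt_Kmap (by simp)

theorem eventually_ne_neg_one (t : ℝ) : ∀ᶠ p in 𝓝 ((0 : ℂ), t), p.1 ≠ -1 :=
  continuous_fst.continuousAt.eventually_ne (by simp)

theorem eventually_nearEdge_norm {t₀ : ℝ} (ht₀ : t₀ < 0) :
    ∀ᶠ p in 𝓝 ((0 : ℂ), t₀), NearEdge (‖p.1‖, p.2) := by
  filter_upwards [(tendsto_norm_snd t₀).eventually (eventually_nearEdge ht₀)] with p hp
  exact hp (norm_nonneg _)

theorem act_G₃_coe (p : ℂ × ℝ) : act G₃ p = ((-om * p.1, p.2) : ℂ × ℝ) := act_G₃ p.1 p.2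

/-- The vertices of the tetrahedra. -/
def tetVertices : Set Heis := {P₁, P₂, P₃, P₄}

/-- The vertices of the slabs. -/
def slabVertices : Set Heis := {P₁, P₂, P₄}

theorem coe_notMem_tetVertices {q : ℂ × ℝ} (h : Real.sqrt 3 * ‖q.1‖ ^ 2 < q.2) :
    (q : Heis) ∉ tetVertices := by
  rintro (h1 | h1 | h1 | h1)
  · have := OnePoint.coe_injective h1
    subst this
    simp at h
  · have := OnePoint.coe_injective h1
    subst this
    simp [norm_om] at h
  · have := OnePoint.coe_injective h1
    subst this
    simp at h
  · exact OnePoint.coe_ne_infty _ h1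

theorem coe_notMem_slabVertices {q : ℂ × ℝ} (h : q.2 < Real.sqrt 3) :
    (q : Heis) ∉ slabVertices := by
  rintro (h1 | h1 | h1)
  · have := OnePoint.coe_injective h1
    subst this
    simp at h
  · have := OnePoint.coe_injective h1
    subst this
    simp at h
  · exact OnePoint.coe_ne_infty _ h1

section Germs

variable {t₀ : ℝ}

theorem eventually_Kmap_basic (ht₀ : t₀ < 0) : ∀ᶠ p in 𝓝 ((0 : ℂ), t₀),
    p.1 ≠ -1 ∧ NearEdge (‖p.1‖, p.2) ∧ Real.sqrt 3 * ‖(Kmap p).1‖ ^ 2 < (Kmap p).2 := by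
  filter_upwards [eventually_ne_neg_one t₀, eventually_nearEdge_norm ht₀,
    (tendsto_Kmap t₀).eventually (isEdgePoint_Kmap ht₀).eventually_basic] with p h1 h2 h3
  exact ⟨h1, h2, h3.2.2.2.2.2.1⟩

theorem eventually_act_Kinv_mem_tetB (ht₀ : t₀ < 0) : ∀ᶠ p : ℂ × ℝ in 𝓝 ((0 : ℂ), t₀),
    (act Kinv p ∈ tetB \ tetVertices ↔ p ∈ Wedge arcAngle wallAngle) := by
  filter_upwards [eventually_Kmap_basic ht₀,
    (tendsto_Kmap t₀).eventually (isEdgePoint_Kmap ht₀).eventually_mem_tetB] with p ⟨h1, h2, h3⟩ h4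
  rw [act_Kinv h1, Set.mem_sdiff, and_iff_left (coe_notMem_tetVertices h3), h4,
    norm_Kmap_le_iff h1, norm_Kmap_add_om_le_iff h1, mem_wedge_arc_wall h2]

theorem eventually_act_Kinv_mem_tetA (ht₀ : t₀ < 0) : ∀ᶠ p : ℂ × ℝ in 𝓝 ((0 : ℂ), t₀),
    (act Kinv p ∈ tetA \ tetVertices ↔
      p ∈ Wedge (fun q => wallAngle q - Real.pi / 3) wallAngle) := by
  filter_upwards [eventually_Kmap_basic ht₀,
    (tendsto_Kmap t₀).eventually (isEdgePoint_Kmap ht₀).eventually_mem_tetA] with p ⟨h1, h2, h3⟩ h4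
  rw [act_Kinv h1, Set.mem_sdiff, and_iff_left (coe_notMem_tetVertices h3), h4,
    norm_Kmap_offset_le_iff h1, norm_Kmap_add_om_le_iff h1, mem_wedge_wall_wall h2]

theorem eventually_act_G₃_Kinv_mem_tetB (ht₀ : t₀ < 0) : ∀ᶠ p : ℂ × ℝ in 𝓝 ((0 : ℂ), t₀),
    (act G₃ (act Kinv p) ∈ tetB \ tetVertices ↔ p ∈ Wedge wallAngle arcAngle') := by
  filter_upwards [eventually_Kmap_basic ht₀, (tendsto_Kmap t₀).eventually
    (isEdgePoint_Kmap ht₀).eventually_rot_mem_tetB] with p ⟨h1, h2, h3⟩ h4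
  have h3' : Real.sqrt 3 * ‖(-om * (Kmap p).1, (Kmap p).2).1‖ ^ 2 <
      (-om * (Kmap p).1, (Kmap p).2).2 := by simp only [norm_rot]; exact h3
  rw [act_Kinv h1, act_G₃_coe, Set.mem_sdiff, and_iff_left (coe_notMem_tetVertices h3'), h4,
    norm_Kmap_le_iff h1, le_norm_Kmap_add_om_iff h1, mem_wedge_wall_arc h2]

theorem eventually_act_Kinv_mem_face (ht₀ : t₀ < 0) : ∀ᶠ p : ℂ × ℝ in 𝓝 ((0 : ℂ), t₀),
    (act Kinv p ∈ triMinus P₄ P₃ P₁ ↔ OnWall wallAngle p) := by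
  filter_upwards [eventually_Kmap_basic ht₀, (tendsto_Kmap t₀).eventually
    (isEdgePoint_Kmap ht₀).eventually_mem_triMinus] with p ⟨h1, h2, h3⟩ h4
  rw [act_Kinv h1, h4, Kmap_side_nonneg_iff h1, le_antisymm_iff,
    norm_Kmap_add_om_le_iff h1, le_norm_Kmap_add_om_iff h1, onWall_wallAngle_iff h2,
    le_antisymm_iff, and_comm (a := wallFun p ≤ 0)]

/-! ### Other faces of the tetrahedra -/

theorem eventually_act_Kinv_notMem_triMinus (ht₀ : t₀ < 0) : ∀ᶠ p : ℂ × ℝ in 𝓝 ((0 : ℂ), t₀),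
    act Kinv p ∉ triMinus P₄ P₁ P₂ ∧ act G₃ (act Kinv p) ∉ triMinus P₄ P₁ P₂ := by
  filter_upwards [eventually_Kmap_basic ht₀,
    (tendsto_Kmap t₀).eventually (isEdgePoint_Kmap ht₀).eventually_basic] with p ⟨h1, h2, h3⟩ h4
  rw [act_Kinv h1, act_G₃_coe]
  constructor
  · intro h
    exact h4.2.1.ne (of_coe_mem_triMinus_P₄_P₁_P₂ h).1
  · intro h
    have := (of_coe_mem_triMinus_P₄_P₁_P₂ h).1
    simp only [norm_rot] at this
    exact h4.2.1.ne this

/-- On projections, `G₂` is a rotation by -π/3 about -ω, the projection of P₂. -/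
theorem act_G₂_coe_eq {X : Heis} {q : ℂ × ℝ} (h : act G₂ X = q) :
    ∃ x : ℂ × ℝ, X = x ∧ q.1 + om = -star om * (x.1 + om) := by
  obtain ⟨c, hc, e⟩ := exists_mulVec_lift G₂_mem X
  rw [h, lift_coe'] at e
  induction X using OnePoint.rec with
  | infty =>
    rw [lift_infty] at e
    have := congrFun e 2
    simp [G₂, Matrix.mulVec, dotProduct, Fin.sum_univ_three] at this
    exact absurd this.symm hc
  | coe x =>
    refine ⟨x, rfl, ?_⟩
    rw [lift_coe'] at e
    have e2 := congrFun e 2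
    have e1 := congrFun e 1
    simp [G₂, Matrix.mulVec, dotProduct, Fin.sum_univ_three] at e1 e2
    rw [← e2, one_mul] at e1
    have h3 : om * star om = 1 := om_mul_star
    have h4 : star om = -1 - om := star_om
    simp only [RCLike.star_def] at *
    linear_combination -e1 + h3 + h4

theorem norm_add_om_of_mem_triMinus {q : ℂ × ℝ} (h : (q : Heis) ∈ triMinus P₄ P₃ P₁) :
    ‖q.1 + om‖ = 1 := by
  obtain ⟨s, -, e, -⟩ := coe_mem_triMinus_P₄_P₃_P₁.1 h
  have e1 := congrArg Complex.re e
  rw [ht_re] at e1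
  have h2 := norm_add_om_sq q.1
  simp only at e1
  rw [← e1] at h2
  rw [← sq_eq_sq₀ (norm_nonneg _) zero_le_one, h2]
  ring

/-- The images of the vertical faces under `G₂` and `G₃` both lie over the circle about ω̄, and the
preimage under `G₃` of the face over [P₃,P₁] lies over the circle about 1. Interior points of
[P₃,P₁] avoid both. -/
theorem IsEdgePoint.norm_sub_ne {q : ℂ × ℝ} (h : IsEdgePoint q) :
    ‖q.1 - star om‖ ≠ 1 ∧ ‖q.1 - 1‖ ≠ 1 := by
  have e := h.ht_eq
  have e1 := congrArg Complex.re e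
  have e2 := congrArg Complex.im e
  have h1 := h.lt
  have h2 := pow_pos h.norm_pos 2
  have hn := norm_sq_eq q.1
  have s3 := sqrt_three_mul
  have hs := sqrt_three_pos
  rw [ht_re] at e1
  rw [ht_im] at e2
  simp [om_re, om_im] at e1 e2
  have h3 := mul_lt_mul_of_pos_left h1 hs
  constructor
  · intro h'
    rw [← sq_eq_sq₀ (norm_nonneg _) zero_le_one, norm_sq_eq] at h'
    simp [om_re, om_im] at h'
    nlinarith
  · intro h'
    rw [← sq_eq_sq₀ (norm_nonneg _) zero_le_one, norm_sq_eq] at h'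
    simp at h'
    nlinarith

theorem eventually_Kmap_norm_sub_ne (ht₀ : t₀ < 0) : ∀ᶠ p : ℂ × ℝ in 𝓝 ((0 : ℂ), t₀),
    p.1 ≠ -1 ∧ ‖(Kmap p).1 - star om‖ ≠ 1 ∧ ‖(Kmap p).1 - 1‖ ≠ 1 := by
  obtain ⟨h1, h2⟩ := (isEdgePoint_Kmap ht₀).norm_sub_ne
  filter_upwards [eventually_ne_neg_one t₀,
    (tendsto_Kmap t₀).eventually ((by fun_prop : Continuous fun q : ℂ × ℝ =>
      ‖q.1 - star om‖).continuousAt.eventually_ne h1),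
    (tendsto_Kmap t₀).eventually ((by fun_prop : Continuous fun q : ℂ × ℝ =>
      ‖q.1 - 1‖).continuousAt.eventually_ne h2)] with p h3 h4 h5
  exact ⟨h3, h4, h5⟩

theorem eventually_act_G₂_ne_act_Kinv (ht₀ : t₀ < 0) : ∀ᶠ p : ℂ × ℝ in 𝓝 ((0 : ℂ), t₀),
    ∀ x ∈ triMinus P₄ P₁ P₂, act G₂ x ≠ act Kinv p := by
  filter_upwards [eventually_Kmap_norm_sub_ne ht₀] with p ⟨h1, h2, h3⟩ x hx h4
  rw [act_Kinv h1] at h4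
  obtain ⟨x, rfl, h5⟩ := act_G₂_coe_eq h4
  apply h2
  have h6 := (of_coe_mem_triMinus_P₄_P₁_P₂ hx).1
  have : (Kmap p).1 - star om = -star om * x.1 := by
    rw [star_om] at h5 ⊢
    linear_combination h5 + om_quad
  rw [this, norm_mul, norm_neg, norm_star, norm_om, h6, one_mul]

theorem eventually_act_G₃_ne_act_Kinv (ht₀ : t₀ < 0) : ∀ᶠ p : ℂ × ℝ in 𝓝 ((0 : ℂ), t₀),
    ∀ x ∈ triMinus P₄ P₃ P₁, act G₃ x ≠ act Kinv p := by
  filter_upwards [eventually_Kmap_norm_sub_ne ht₀] with p ⟨h1, h2, h3⟩ x hx h4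
  rw [act_Kinv h1] at h4
  have h5 : x = act G₃inv (Kmap p : Heis) := by rw [← h4, act_cancel G₃_mem G₃inv_mul_G₃]
  rw [act_G₃inv] at h5
  rw [h5] at hx
  apply h2
  rw [← norm_add_om_of_mem_triMinus hx]
  have : -star om * (Kmap p).1 + om = -star om * ((Kmap p).1 - star om) := by
    rw [star_om]
    linear_combination -om_quad
  simp only
  rw [this, norm_mul, norm_neg, norm_star, norm_om, one_mul]

theorem eventually_act_G₃_Kinv_notMem_triMinus (ht₀ : t₀ < 0) :
    ∀ᶠ p : ℂ × ℝ in 𝓝 ((0 : ℂ), t₀), act G₃ (act Kinv p) ∉ triMinus P₄ P₃ P₁ := by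
  filter_upwards [eventually_Kmap_norm_sub_ne ht₀] with p ⟨h1, h2, h3⟩ hx
  rw [act_Kinv h1, act_G₃_coe] at hx
  apply h3
  rw [← norm_add_om_of_mem_triMinus hx]
  have : -om * (Kmap p).1 + om = -om * ((Kmap p).1 - 1) := by ring
  simp only
  rw [this, norm_rot]

/-- The two edges of a tetrahedron that may both lie on e_j have disjoint neighbourhoods: their
projections differ by the factor -ω and are not 0. -/
theorem eventually_act_G₃_Kinv_ne_Kinv (ht₀ : t₀ < 0) :
    ∀ᶠ x : (ℂ × ℝ) × (ℂ × ℝ) in 𝓝 ((0 : ℂ), t₀) ×ˢ 𝓝 ((0 : ℂ), t₀),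
      act G₃ (act Kinv x.1) ≠ act Kinv x.2 := by
  have h1 : Filter.Tendsto (fun x : (ℂ × ℝ) × (ℂ × ℝ) => -om * (Kmap x.1).1 - (Kmap x.2).1)
      (𝓝 ((0 : ℂ), t₀) ×ˢ 𝓝 ((0 : ℂ), t₀)) (𝓝 (-om * (Kmap (0, t₀)).1 - (Kmap (0, t₀)).1)) := by
    have := ((continuous_fst.tendsto _).comp (tendsto_Kmap t₀))
    exact ((this.comp Filter.tendsto_fst).const_mul (-om)).sub (this.comp Filter.tendsto_snd)
  have h2 : -om * (Kmap (0, t₀)).1 - (Kmap (0, t₀)).1 ≠ 0 := by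
    have h3 : (Kmap (0, t₀)).1 ≠ 0 := norm_pos_iff.1 (isEdgePoint_Kmap ht₀).norm_pos
    have h4 : -om * (Kmap (0, t₀)).1 - (Kmap (0, t₀)).1 = star om * (Kmap (0, t₀)).1 := by
      rw [star_om]; ring
    rw [h4]
    exact mul_ne_zero (star_ne_zero.2 om_ne_zero) h3
  filter_upwards [h1.eventually_ne h2,
    Filter.tendsto_fst.eventually (eventually_ne_neg_one t₀),
    Filter.tendsto_snd.eventually (eventually_ne_neg_one t₀)] with x h5 h6 h7 h8
  rw [act_Kinv h6, act_Kinv h7, act_G₃_coe] at h8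
  have := congrArg Prod.fst (OnePoint.coe_injective h8)
  exact h5 (sub_eq_zero.2 this)

end Germs

/-! ### The slabs in the coordinates adapted to the edge -/

/-- The proof uses the orthonormal directions e^{iπ/3} and e^{-iπ/6}: the strip is 1/2 ≤ u ≤ 1 in
the first, beyond the arc in the second. -/
theorem mem_strip_iff (z : ℂ) :
    (∃ θ a : ℝ, 0 ≤ θ ∧ θ ≤ Real.pi / 3 ∧ 0 ≤ a ∧
      z = Complex.exp (θ * Complex.I) + a * Complex.exp (-(Real.pi / 6 : ℝ) * Complex.I)) ↔
    1 ≤ z.re + Real.sqrt 3 * z.im ∧ z.re + Real.sqrt 3 * z.im ≤ 2 ∧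
      0 ≤ Real.sqrt 3 * z.re - z.im ∧ 1 ≤ ‖z‖ := by
  have hpi := Real.pi_pos
  have s3 := sqrt_three_mul
  have e6 : Complex.exp (-(Real.pi / 6 : ℝ) * Complex.I) =
      Complex.exp ((-(Real.pi / 6) : ℝ) * Complex.I) := by push_cast; rfl
  have hn : ‖z‖ ^ 2 = ((z.re + Real.sqrt 3 * z.im) / 2) ^ 2 +
      ((Real.sqrt 3 * z.re - z.im) / 2) ^ 2 := by
    rw [norm_sq_eq]; linear_combination (-(z.re ^ 2 + z.im ^ 2) / 4) * s3
  rw [← one_le_sq_iff₀ (norm_nonneg z), hn]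
  simp only [e6]
  have comp : ∀ θ a : ℝ,
      (z = Complex.exp (θ * Complex.I) + a * Complex.exp ((-(Real.pi / 6) : ℝ) * Complex.I)) ↔
      (z.re + Real.sqrt 3 * z.im) / 2 = Real.cos (Real.pi / 3 - θ) ∧
        (Real.sqrt 3 * z.re - z.im) / 2 = Real.sin (Real.pi / 3 - θ) + a := by
    intro θ a
    rw [Complex.ext_iff, Complex.add_re, Complex.add_im, Complex.re_ofReal_mul,
      Complex.im_ofReal_mul, Complex.exp_ofReal_mul_I_re, Complex.exp_ofReal_mul_I_im,
      Complex.exp_ofReal_mul_I_re, Complex.exp_ofReal_mul_I_im, Real.cos_neg, Real.sin_neg,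
      Real.cos_pi_div_six, Real.sin_pi_div_six, Real.cos_sub, Real.sin_sub, Real.cos_pi_div_three,
      Real.sin_pi_div_three]
    constructor
    · rintro ⟨h1, h2⟩
      constructor
      · rw [h1, h2]; ring
      · rw [h1, h2]; linear_combination (a / 4) * s3
    · rintro ⟨h1, h2⟩
      constructor
      · linear_combination h1 / 2 + Real.sqrt 3 / 2 * h2 -
          (z.re / 4 - Real.cos θ / 4) * s3
      · linear_combination Real.sqrt 3 / 2 * h1 - h2 / 2 -
          (z.im / 4 - Real.sin θ / 4) * s3
  simp only [comp]
  constructor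
  · rintro ⟨θ, a, h1, h2, h3, h4, h5⟩
    have h6 : 1 / 2 ≤ Real.cos (Real.pi / 3 - θ) := by
      rw [← Real.cos_pi_div_three]
      exact Real.cos_le_cos_of_nonneg_of_le_pi (by linarith) (by linarith) (by linarith)
    have h7 : 0 ≤ Real.sin (Real.pi / 3 - θ) :=
      Real.sin_nonneg_of_nonneg_of_le_pi (by linarith) (by linarith)
    have h8 := Real.cos_le_one (Real.pi / 3 - θ)
    have h9 := Real.sin_sq_add_cos_sq (Real.pi / 3 - θ)
    refine ⟨by linarith, by linarith, by linarith, ?_⟩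
    rw [h4, h5]
    nlinarith
  · rintro ⟨h1, h2, h3, h4⟩
    -- The coordinate u is the cosine of the angle measured back from e^{iπ/3}, so the arc parameter
    -- is π/3 - arccos u.
    obtain ⟨u, hu⟩ : ∃ u, u = (z.re + Real.sqrt 3 * z.im) / 2 := ⟨_, rfl⟩
    rw [← hu] at h4 ⊢
    have h5 : Real.arccos u ≤ Real.pi / 3 := by
      have : Real.pi / 3 = Real.arccos (1 / 2) := by
        rw [← Real.cos_pi_div_three, Real.arccos_cos (by linarith) (by linarith)]
      rw [this]
      exact Real.arccos_le_arccos (by linarith)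
    refine ⟨Real.pi / 3 - Real.arccos u, (Real.sqrt 3 * z.re - z.im) / 2 - Real.sqrt (1 - u ^ 2),
      by linarith, by linarith [Real.arccos_nonneg u], ?_, ?_, ?_⟩
    · rw [sub_nonneg]
      exact Real.sqrt_le_iff.2 ⟨by linarith, by linarith⟩
    · rw [sub_sub_cancel, Real.cos_arccos (by linarith) (by linarith)]
    · rw [sub_sub_cancel, Real.sin_arccos]; ring

theorem emod_six_nonneg (k : ℤ) : 0 ≤ (((1 - k) % 6 : ℤ) : ℝ) := by
  exact_mod_cast Int.emod_nonneg _ (by norm_num)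

theorem emod_six_le (k : ℤ) : (((1 - k) % 6 : ℤ) : ℝ) ≤ 5 := by
  have := Int.emod_lt_of_pos (1 - k) (show (0 : ℤ) < 6 by norm_num)
  exact_mod_cast (by omega : (1 - k) % 6 ≤ 5)

/-- The sector with apex -ω stays at distance at least 1/2 from 1, so near 1 only the strip is seen,
whatever k is. This is the reason for the radius 1/2 in `NearEdge`. -/
theorem one_add_mem_slabBase {z : ℂ} (hz : ‖z‖ < 1 / 2) (k : ℤ) :
    z + 1 ∈ slabBase k ↔ 1 ≤ ‖z + 1‖ ∧ 0 ≤ z.re + Real.sqrt 3 * z.im := by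
  have hpi := Real.pi_pos
  have s3 := sqrt_three_mul
  have hs3 := sqrt_three_pos
  have hn := norm_sq_eq z
  have hz2 : ‖z‖ ^ 2 < 1 / 4 := by nlinarith [norm_nonneg z]
  unfold slabBase
  rw [Set.mem_union, or_iff_left, Set.mem_ofPred_eq, mem_strip_iff]
  · simp only [Complex.add_re, Complex.add_im, Complex.one_re, Complex.one_im, add_zero]
    have e : ‖z‖ ^ 2 = ((z.re + Real.sqrt 3 * z.im) / 2) ^ 2 +
        ((Real.sqrt 3 * z.re - z.im) / 2) ^ 2 := by
      rw [hn]; linear_combination (-(z.re ^ 2 + z.im ^ 2) / 4) * s3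
    constructor
    · rintro ⟨h1, h2, h3, h4⟩
      exact ⟨h4, by linarith⟩
    · rintro ⟨h1, h2⟩
      refine ⟨by linarith, by nlinarith, ?_, h1⟩
      have h5 : -1 ≤ Real.sqrt 3 * z.re - z.im := by nlinarith
      have : 1 ≤ Real.sqrt 3 := by rw [Real.one_le_sqrt]; norm_num
      linarith
  · rintro ⟨r, α, h1, h2, h3, h4⟩
    have hk := emod_six_le k
    have h3' : α ≤ 3 * Real.pi / 2 := by nlinarith
    -- From the apex, 1 is seen in direction -π/3, and the sector keeps an angle of at least π/6
    -- from it because (1-k) mod 6 ≤ 5.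
    have hcos : Real.cos (α + Real.pi / 3) ≤ Real.sqrt 3 / 2 := by
      have e : Real.cos (α + Real.pi / 3) = -Real.cos |α + Real.pi / 3 - Real.pi| := by
        rw [Real.cos_abs, Real.cos_sub_pi, neg_neg]
      have e2 : Real.sqrt 3 / 2 = -Real.cos (Real.pi - Real.pi / 6) := by
        rw [Real.cos_pi_sub, Real.cos_pi_div_six, neg_neg]
      rw [e, e2, neg_le_neg_iff]
      exact Real.cos_le_cos_of_nonneg_of_le_pi (abs_nonneg _) (by linarith)
        (abs_le.2 ⟨by linarith, by linarith⟩)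
    rw [Complex.ext_iff, Complex.add_re, Complex.add_im, Complex.add_re, Complex.add_im,
      Complex.re_ofReal_mul, Complex.im_ofReal_mul, Complex.exp_ofReal_mul_I_re,
      Complex.exp_ofReal_mul_I_im, Complex.neg_re, Complex.neg_im, Complex.one_re, Complex.one_im,
      om_re, om_im] at h4
    obtain ⟨h4, h5⟩ := h4
    have hX : r * Real.cos (α + Real.pi / 3) = 1 + (z.re - Real.sqrt 3 * z.im) / 2 := by
      rw [Real.cos_add, Real.cos_pi_div_three, Real.sin_pi_div_three]
      linear_combination -h4 / 2 + Real.sqrt 3 / 2 * h5 + s3 / 4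
    have hY : r * Real.sin (α + Real.pi / 3) = (z.im + Real.sqrt 3 * z.re) / 2 := by
      rw [Real.sin_add, Real.cos_pi_div_three, Real.sin_pi_div_three]
      linear_combination -h5 / 2 - Real.sqrt 3 / 2 * h4
    have hcs := Real.sin_sq_add_cos_sq (α + Real.pi / 3)
    obtain ⟨X, hXd⟩ : ∃ X, X = 1 + (z.re - Real.sqrt 3 * z.im) / 2 := ⟨_, rfl⟩
    obtain ⟨Y, hYd⟩ : ∃ Y, Y = (z.im + Real.sqrt 3 * z.re) / 2 := ⟨_, rfl⟩
    rw [← hXd] at hX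
    rw [← hYd] at hY
    have hXY : (1 - X) ^ 2 + Y ^ 2 = ‖z‖ ^ 2 := by
      rw [hn, hXd, hYd]; linear_combination ((z.re ^ 2 + z.im ^ 2) / 4) * s3
    have hX0 : 0 < X := by nlinarith [sq_nonneg Y]
    have hr : X ^ 2 + Y ^ 2 = r ^ 2 := by rw [← hX, ← hY]; linear_combination r ^ 2 * hcs
    have hle : X ≤ Real.sqrt 3 / 2 * r := by rw [← hX]; nlinarith
    have hle2 : X ^ 2 ≤ (Real.sqrt 3 / 2 * r) ^ 2 := pow_le_pow_left₀ hX0.le hle 2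
    rw [mul_pow, div_pow, sqrt_three_sq] at hle2
    nlinarith [sq_nonneg (2 * X - 3 / 2)]

/-- Near the edge 42 both pieces of the base are seen: in the rotated frame the strip ends at angle
3π/2 and the sector continues from there. -/
theorem rot_mem_slabBase {p : ℂ × ℝ} (hz : ‖p.1‖ < 1 / 2) (k : ℤ) :
    -om * (p.1 + 1) ∈ slabBase k ↔ (1 ≤ ‖p.1 + 1‖ ∧ p.1.re ≤ 0 ∧ p.1.im ≤ 0) ∨
      p ∈ Wedge (fun _ => 3 * Real.pi / 2)
        (fun _ => 3 * Real.pi / 2 + Real.pi / 3 * (((1 - k) % 6 : ℤ) : ℝ)) := by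
  have s3 := sqrt_three_mul
  unfold slabBase
  rw [Set.mem_union, Set.mem_ofPred_eq, mem_strip_iff]
  refine or_congr ?_ ?_
  · have hre : (-om * (p.1 + 1)).re + Real.sqrt 3 * (-om * (p.1 + 1)).im = 2 * (1 + p.1.re) := by
      simp [om_re, om_im]; linear_combination ((1 + p.1.re) / 2) * s3
    have him : Real.sqrt 3 * (-om * (p.1 + 1)).re - (-om * (p.1 + 1)).im = -2 * p.1.im := by
      simp [om_re, om_im]; linear_combination (-(p.1.im) / 2) * s3
    rw [hre, him, norm_rot]
    have h2 : |p.1.re| ≤ ‖p.1‖ := Complex.abs_re_le_norm _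
    have h3 := neg_le_of_abs_le h2
    constructor
    · rintro ⟨h4, h5, h6, h7⟩
      exact ⟨h7, by linarith, by linarith⟩
    · rintro ⟨h4, h5, h6⟩
      exact ⟨by linarith, by linarith, by linarith, h4⟩
  · have e3 : Complex.exp ((Real.pi / 3 : ℝ) * Complex.I) = -om := by
      apply Complex.ext
      · rw [Complex.exp_ofReal_mul_I_re, Real.cos_pi_div_three]; simp [om_re]
      · rw [Complex.exp_ofReal_mul_I_im, Real.sin_pi_div_three]; simp [om_im]
    have key : ∀ α θ r : ℝ, α = θ + Real.pi / 3 - 2 * Real.pi →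
        (-om * (p.1 + 1) = -om + r * Complex.exp (α * Complex.I) ↔
          p.1 = r * Complex.exp (θ * Complex.I)) := by
      intro α θ r h
      have e : Complex.exp (α * Complex.I) = -om * Complex.exp (θ * Complex.I) := by
        rw [h, ← e3, ← Complex.exp_add, Complex.exp_eq_exp_iff_exists_int]
        exact ⟨-1, by push_cast; ring⟩
      rw [e]
      have hne : -om ≠ 0 := neg_ne_zero.2 om_ne_zero
      constructor
      · intro h2
        apply mul_left_cancel₀ hne
        linear_combination h2
      · intro h2
        rw [h2]; ring
    constructor
    · rintro ⟨r, α, h1, h2, h3, h4⟩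
      rw [key α (α - Real.pi / 3 + 2 * Real.pi) r (by ring)] at h4
      refine ⟨α - Real.pi / 3 + 2 * Real.pi, by simp only; linarith, by simp only; linarith, ?_⟩
      have : ‖p.1‖ = r := by
        rw [h4, norm_mul, Complex.norm_exp_ofReal_mul_I, mul_one, Complex.norm_real,
          Real.norm_of_nonneg h1]
      rw [this, h4]
    · rintro ⟨θ, h1, h2, h3⟩
      refine ⟨‖p.1‖, θ + Real.pi / 3 - 2 * Real.pi, norm_nonneg _, by simp only at h1; linarith,
        by simp only at h2; linarith, ?_⟩
      rw [key _ θ _ rfl]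
      exact h3

theorem mem_wedge_union {a b c : ℝ × ℝ → ℝ} {p : ℂ × ℝ} (h1 : a (‖p.1‖, p.2) ≤ b (‖p.1‖, p.2))
    (h2 : b (‖p.1‖, p.2) ≤ c (‖p.1‖, p.2)) :
    p ∈ Wedge a c ↔ p ∈ Wedge a b ∨ p ∈ Wedge b c := by
  constructor
  · rintro ⟨θ, h3, h4, h5⟩
    rcases le_total θ (b (‖p.1‖, p.2)) with h | h
    · exact Or.inl ⟨θ, h3, h, h5⟩
    · exact Or.inr ⟨θ, h, h4, h5⟩
  · rintro (⟨θ, h3, h4, h5⟩ | ⟨θ, h3, h4, h5⟩)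
    · exact ⟨θ, h3, h4.trans h2, h5⟩
    · exact ⟨θ, h1.trans h3, h4, h5⟩

theorem coe_mem_slabSet {q : ℂ × ℝ} {k : ℤ} : (q : Heis) ∈ slabSet k ↔ q.1 ∈ slabBase k := by
  constructor
  · rintro (h | ⟨z, t, h1, h2⟩)
    · exact absurd h (OnePoint.coe_ne_infty _)
    · rw [OnePoint.coe_injective h2]; exact h1
  · intro h
    exact Or.inr ⟨q.1, q.2, h, rfl⟩

theorem coe_mem_bigonB' {q : ℂ × ℝ} : (q : Heis) ∈ bigonB' ↔
    ∃ a : ℝ, 0 ≤ a ∧ q.1 = 1 + a * Complex.exp (-(Real.pi / 6 : ℝ) * Complex.I) := by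
  constructor
  · rintro (h | ⟨a, t, h1, h2⟩)
    · exact absurd h (OnePoint.coe_ne_infty _)
    · rw [OnePoint.coe_injective h2]; exact ⟨a, h1, rfl⟩
  · rintro ⟨a, h1, h2⟩
    exact Or.inr ⟨a, q.2, h1, by rw [← h2]⟩

theorem act_Tinv_coe (p : ℂ × ℝ) :
    act Tinv p = ((p.1 + 1, p.2 + Real.sqrt 3 - 2 * p.1.im) : ℂ × ℝ) := act_Tinv p.1 p.2

theorem act_Tinv_mem_bigonB' (p : ℂ × ℝ) :
    act Tinv p ∈ bigonB' ↔ OnWall (fun _ => -(Real.pi / 6)) p := by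
  rw [act_Tinv_coe, coe_mem_bigonB']
  unfold OnWall
  have e6 : Complex.exp (-(Real.pi / 6 : ℝ) * Complex.I) =
      Complex.exp ((-(Real.pi / 6) : ℝ) * Complex.I) := by push_cast; rfl
  rw [e6]
  constructor
  · rintro ⟨a, h1, h2⟩
    simp only at h2
    have h3 : p.1 = a * Complex.exp ((-(Real.pi / 6) : ℝ) * Complex.I) := by
      linear_combination h2
    have : ‖p.1‖ = a := by
      rw [h3, norm_mul, Complex.norm_exp_ofReal_mul_I, mul_one, Complex.norm_real,
        Real.norm_of_nonneg h1]
    rw [this, h3]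
  · intro h
    exact ⟨‖p.1‖, norm_nonneg _, by simp only; rw [← h, add_comm]⟩

section Germs

variable {t₀ : ℝ}

theorem eventually_basic_slab (ht₀ : t₀ < 0) : ∀ᶠ p : ℂ × ℝ in 𝓝 ((0 : ℂ), t₀),
    NearEdge (‖p.1‖, p.2) ∧ p.2 + Real.sqrt 3 - 2 * p.1.im < Real.sqrt 3 := by
  refine (eventually_nearEdge_norm ht₀).and ?_
  have hc : Continuous fun p : ℂ × ℝ => p.2 + Real.sqrt 3 - 2 * p.1.im :=
    (by fun_prop : Continuous fun p : ℂ × ℝ => p.2 + Real.sqrt 3).sub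
      (continuous_const.mul (Complex.continuous_im.comp continuous_fst))
  exact hc.continuousAt.eventually_lt_const (by simp [ht₀])

theorem eventually_act_Tinv_mem_slab (ht₀ : t₀ < 0) :
    ∀ᶠ p : ℂ × ℝ in 𝓝 ((0 : ℂ), t₀), ∀ k : ℤ,
      (act Tinv p ∈ slabSet k \ slabVertices ↔ p ∈ Wedge (fun _ => -(Real.pi / 6)) arcAngle) := by
  filter_upwards [eventually_basic_slab ht₀] with p ⟨h1, h2⟩ k
  rw [act_Tinv_coe, Set.mem_sdiff, and_iff_left (coe_notMem_slabVertices h2), coe_mem_slabSet,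
    one_add_mem_slabBase h1.lt_half, mem_wedge_ray_arc h1]

theorem eventually_act_G₃_Tinv_mem_slab (ht₀ : t₀ < 0) :
    ∀ᶠ p : ℂ × ℝ in 𝓝 ((0 : ℂ), t₀), ∀ k : ℤ,
      (act G₃ (act Tinv p) ∈ slabSet k \ slabVertices ↔ p ∈ Wedge arcAngle'
        (fun _ => 3 * Real.pi / 2 + Real.pi / 3 * (((1 - k) % 6 : ℤ) : ℝ))) := by
  filter_upwards [eventually_basic_slab ht₀] with p ⟨h1, h2⟩ k
  rw [act_Tinv_coe, act_G₃_coe, Set.mem_sdiff, and_iff_left (coe_notMem_slabVertices h2),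
    coe_mem_slabSet, rot_mem_slabBase h1.lt_half,
    mem_wedge_union (a := arcAngle') (b := fun _ => 3 * Real.pi / 2), mem_wedge_arc_vert h1]
  · unfold arcAngle'; linarith [h1.circle_nonneg]
  · have := mul_nonneg (div_pos Real.pi_pos three_pos).le (emod_six_nonneg k)
    linarith

theorem eventually_act_Tinv_mem_face (ht₀ : t₀ < 0) : ∀ᶠ p : ℂ × ℝ in 𝓝 ((0 : ℂ), t₀),
    (act Tinv p ∈ triPlus P₄ P₁ P₂ ↔ OnWall arcAngle p) := by
  have hc : Continuous fun p : ℂ × ℝ => (-star om * (p.1 + 1)).im :=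
    Complex.continuous_im.comp (by fun_prop)
  filter_upwards [eventually_basic_slab ht₀, hc.continuousAt.eventually_lt_const
    (show (-star om * (((0 : ℂ), t₀).1 + 1)).im < 0 by simp [om_im])] with p ⟨h1, h2⟩ h3
  rw [act_Tinv_coe, coe_mem_triPlus_P₄_P₁_P₂, onWall_arcAngle_iff h1]
  simp only [Complex.add_im, Complex.one_im, add_zero]
  exact ⟨fun h => ⟨h.1, h.2.1⟩, fun h => ⟨h.1, h.2, h3.le, h2.le⟩⟩

theorem eventually_act_G₃_Tinv_mem_face (ht₀ : t₀ < 0) : ∀ᶠ p : ℂ × ℝ in 𝓝 ((0 : ℂ), t₀),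
    (act G₃ (act Tinv p) ∈ triPlus P₄ P₁ P₂ ↔ OnWall arcAngle' p) := by
  have hc : Continuous fun p : ℂ × ℝ => (-om * (p.1 + 1)).im :=
    Complex.continuous_im.comp (by fun_prop)
  filter_upwards [eventually_basic_slab ht₀, hc.continuousAt.eventually_const_lt
    (show 0 < (-om * (((0 : ℂ), t₀).1 + 1)).im by simp [om_im])] with p ⟨h1, h2⟩ h3
  rw [act_Tinv_coe, act_G₃_coe, coe_mem_triPlus_P₄_P₁_P₂, onWall_arcAngle'_iff h1]
  have e : -star om * (-om * (p.1 + 1)) = p.1 + 1 := by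
    linear_combination (p.1 + 1) * om_mul_star
  simp only [norm_rot, e, Complex.add_im, Complex.one_im, add_zero]
  exact ⟨fun h => ⟨h.1, h.2.2.1⟩, fun h => ⟨h.1, h3.le, h.2, h2.le⟩⟩

/-! ### Other faces of the slabs -/

theorem eventually_act_Tinv_notMem_triMinus (ht₀ : t₀ < 0) : ∀ᶠ p : ℂ × ℝ in 𝓝 ((0 : ℂ), t₀),
    act Tinv p ∉ triMinus P₄ P₁ P₂ ∧ act G₃ (act Tinv p) ∉ triMinus P₄ P₁ P₂ := by
  filter_upwards [eventually_basic_slab ht₀] with p ⟨h1, h2⟩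
  rw [act_Tinv_coe, act_G₃_coe]
  exact ⟨fun h => not_le.2 h2 (of_coe_mem_triMinus_P₄_P₁_P₂ h).2,
    fun h => not_le.2 h2 (of_coe_mem_triMinus_P₄_P₁_P₂ h).2⟩

theorem star_om_pow_six : (-star om) ^ 6 = 1 := by
  have hq := om_quad
  rw [star_om]
  grind

/-- The sixth power of z + ω is invariant under the rotation `G₂`, so all its powers are controlled
at once. -/
theorem act_G₂_pow_coe_eq (n : ℕ) {X : Heis} {q : ℂ × ℝ} (h : act (G₂ ^ n) X = q) :
    ∃ x : ℂ × ℝ, X = x ∧ (q.1 + om) ^ 6 = (x.1 + om) ^ 6 := by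
  induction n generalizing X with
  | zero =>
    rw [pow_zero, act_one] at h
    exact ⟨q, h, rfl⟩
  | succ n ih =>
    rw [pow_succ, act_mul _ G₂_mem] at h
    obtain ⟨y, hy, e⟩ := ih h
    obtain ⟨x, hx, e2⟩ := act_G₂_coe_eq hy
    exact ⟨x, hx, by rw [e, e2, mul_pow, star_om_pow_six, one_mul]⟩

/-- The direction of the half-plane is e^{-iπ/6}, whose sixth power is -1. -/
theorem bigonB'_sub_pow_six {q : ℂ × ℝ} (h : (q : Heis) ∈ bigonB') :
    ((q.1 - 1) ^ 6).re ≤ 0 := by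
  obtain ⟨a, h1, h2⟩ := coe_mem_bigonB'.1 h
  have e : (q.1 - 1) ^ 6 = ((-(a ^ 6) : ℝ) : ℂ) := by
    rw [h2, add_sub_cancel_left, mul_pow, ← Complex.exp_nat_mul]
    have : ((6 : ℕ) : ℂ) * (-(Real.pi / 6 : ℝ) * Complex.I) = -(Real.pi * Complex.I) := by
      push_cast; ring
    rw [this, Complex.exp_neg, Complex.exp_pi_mul_I]
    push_cast
    norm_num
  rw [e, Complex.ofReal_re]
  have := pow_nonneg h1 6
  linarith

theorem eventually_pow_six_pos {f : ℂ × ℝ → ℂ} (hf : Continuous f) {p₀ : ℂ × ℝ}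
    (h : f p₀ ^ 6 = 1) : ∀ᶠ p in 𝓝 p₀, 0 < (f p ^ 6).re := by
  have hc : Continuous fun p => (f p ^ 6).re := Complex.continuous_re.comp (hf.pow 6)
  have h2 : (f p₀ ^ 6).re = 1 := by rw [h, Complex.one_re]
  exact hc.continuousAt.eventually_const_lt (by simp only [h2]; exact one_pos)

/-- At the projection of P₁ the sixth power of z + ω is 1, whereas points of the image bigon have
sixth powers with nonpositive real part. One neighbourhood thus works for every n. -/
theorem eventually_act_bigon_ne_act_Tinv : ∀ᶠ p : ℂ × ℝ in 𝓝 ((0 : ℂ), t₀),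
    ∀ n : ℕ, ∀ x ∈ bigonB', act (G₂ ^ n * G₃) x ≠ act Tinv p := by
  have e : (0 : ℂ) + 1 + om = -star om := by rw [star_om]; ring
  filter_upwards [eventually_pow_six_pos (f := fun p => p.1 + 1 + om) (p₀ := ((0 : ℂ), t₀))
    (by fun_prop) (by rw [e, star_om_pow_six])] with p h1 n x hx h2
  rw [act_mul _ G₃_mem, act_Tinv_coe] at h2
  obtain ⟨y, hy, e2⟩ := act_G₂_pow_coe_eq n h2
  have h5 : x = act G₃inv (y : Heis) := by rw [← hy, act_cancel G₃_mem G₃inv_mul_G₃]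
  rw [act_G₃inv] at h5
  rw [h5] at hx
  have h6 := bigonB'_sub_pow_six hx
  have h7 : -star om * y.1 - 1 = -star om * (y.1 + om) := by
    linear_combination om_mul_star
  simp only at h6 e2
  rw [h7, mul_pow, star_om_pow_six, one_mul, ← e2] at h6
  exact not_le.2 h1 h6

theorem eventually_act_G₃_Tinv_notMem_bigonB' : ∀ᶠ p : ℂ × ℝ in 𝓝 ((0 : ℂ), t₀),
    act G₃ (act Tinv p) ∉ bigonB' := by
  have e : -om * ((0 : ℂ) + 1) - 1 = star om := by rw [star_om]; ring
  have e6 : (star om) ^ 6 = 1 := by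
    have h := star_om_pow_six
    have h2 : Even 6 := ⟨3, rfl⟩
    rwa [h2.neg_pow] at h
  filter_upwards [eventually_pow_six_pos (f := fun p => -om * (p.1 + 1) - 1)
    (p₀ := ((0 : ℂ), t₀)) (by fun_prop) (by simp only [e, e6])] with p h1 hx
  rw [act_Tinv_coe, act_G₃_coe] at hx
  have h2 := bigonB'_sub_pow_six hx
  linarith

theorem eventually_act_G₃_Tinv_ne_Tinv :
    ∀ᶠ x : (ℂ × ℝ) × (ℂ × ℝ) in 𝓝 ((0 : ℂ), t₀) ×ˢ 𝓝 ((0 : ℂ), t₀),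
      act G₃ (act Tinv x.1) ≠ act Tinv x.2 := by
  have hc : Continuous fun x : (ℂ × ℝ) × (ℂ × ℝ) => -om * (x.1.1 + 1) - (x.2.1 + 1) := by fun_prop
  have h2 : -om * ((0 : ℂ) + 1) - (0 + 1) ≠ 0 := by
    have h4 : -om * ((0 : ℂ) + 1) - (0 + 1) = star om := by rw [star_om]; ring
    rw [h4]
    exact star_ne_zero.2 om_ne_zero
  rw [← nhds_prod_eq]
  filter_upwards [(hc.tendsto (((0 : ℂ), t₀), ((0 : ℂ), t₀))).eventually_ne h2] with x h5 h8
  rw [act_Tinv_coe, act_Tinv_coe, act_G₃_coe] at h8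
  have := congrArg Prod.fst (OnePoint.coe_injective h8)
  exact h5 (sub_eq_zero.2 this)

end Germs

/-! ### A neighbourhood on which all the local descriptions hold -/

theorem exists_Cyl_subset {t₀ : ℝ} {s : Set (ℂ × ℝ)} (hs : s ∈ 𝓝 ((0 : ℂ), t₀)) :
    ∃ ε > 0, Cyl ε t₀ ⊆ s := by
  obtain ⟨ε, hε, h⟩ := Metric.mem_nhds_iff.1 hs
  refine ⟨ε, hε, fun p hp => h ?_⟩
  rw [Metric.mem_ball, Prod.dist_eq, max_lt_iff, dist_zero_right, Real.dist_eq]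
  exact hp

/-- A radius such that the cells have their local description in the cylinder around a point of
the edge. -/
structure GoodRadius (ε t₀ : ℝ) : Prop where
  pos : 0 < ε
  nearEdge : ∀ p ∈ Cyl ε t₀, NearEdge (‖p.1‖, p.2)
  mem_tetB : ∀ p ∈ Cyl ε t₀,
    (act Kinv p ∈ tetB \ tetVertices ↔ p ∈ Wedge arcAngle wallAngle)
  mem_tetA : ∀ p ∈ Cyl ε t₀, (act Kinv p ∈ tetA \ tetVertices ↔
    p ∈ Wedge (fun q => wallAngle q - Real.pi / 3) wallAngle)
  rot_mem_tetB : ∀ p ∈ Cyl ε t₀,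
    (act G₃ (act Kinv p) ∈ tetB \ tetVertices ↔ p ∈ Wedge wallAngle arcAngle')
  mem_slab : ∀ p ∈ Cyl ε t₀, ∀ k : ℤ,
    (act Tinv p ∈ slabSet k \ slabVertices ↔ p ∈ Wedge (fun _ => -(Real.pi / 6)) arcAngle)
  rot_mem_slab : ∀ p ∈ Cyl ε t₀, ∀ k : ℤ,
    (act G₃ (act Tinv p) ∈ slabSet k \ slabVertices ↔ p ∈ Wedge arcAngle'
      (fun _ => 3 * Real.pi / 2 + Real.pi / 3 * (((1 - k) % 6 : ℤ) : ℝ)))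
  mem_tetFace : ∀ p ∈ Cyl ε t₀, (act Kinv p ∈ triMinus P₄ P₃ P₁ ↔ OnWall wallAngle p)
  mem_slabFace : ∀ p ∈ Cyl ε t₀, (act Tinv p ∈ triPlus P₄ P₁ P₂ ↔ OnWall arcAngle p)
  rot_mem_slabFace : ∀ p ∈ Cyl ε t₀,
    (act G₃ (act Tinv p) ∈ triPlus P₄ P₁ P₂ ↔ OnWall arcAngle' p)
  tet_notMem : ∀ p ∈ Cyl ε t₀,
    act Kinv p ∉ triMinus P₄ P₁ P₂ ∧ act G₃ (act Kinv p) ∉ triMinus P₄ P₁ P₂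
  tet_G₂_ne : ∀ p ∈ Cyl ε t₀, ∀ x ∈ triMinus P₄ P₁ P₂, act G₂ x ≠ act Kinv p
  tet_G₃_ne : ∀ p ∈ Cyl ε t₀, ∀ x ∈ triMinus P₄ P₃ P₁, act G₃ x ≠ act Kinv p
  rot_tet_notMem : ∀ p ∈ Cyl ε t₀, act G₃ (act Kinv p) ∉ triMinus P₄ P₃ P₁
  slab_notMem : ∀ p ∈ Cyl ε t₀,
    act Tinv p ∉ triMinus P₄ P₁ P₂ ∧ act G₃ (act Tinv p) ∉ triMinus P₄ P₁ P₂
  slab_bigon_ne : ∀ p ∈ Cyl ε t₀, ∀ n : ℕ, ∀ x ∈ bigonB', act (G₂ ^ n * G₃) x ≠ act Tinv p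
  rot_slab_notMem : ∀ p ∈ Cyl ε t₀, act G₃ (act Tinv p) ∉ bigonB'
  tet_ne : ∀ p ∈ Cyl ε t₀, ∀ p' ∈ Cyl ε t₀, act G₃ (act Kinv p) ≠ act Kinv p'
  slab_ne : ∀ p ∈ Cyl ε t₀, ∀ p' ∈ Cyl ε t₀, act G₃ (act Tinv p) ≠ act Tinv p'

/-- The last two separations concern pairs of points, so each first gives a neighbourhood used for
both points of the pair. -/
theorem exists_goodRadius {t₀ : ℝ} (ht₀ : t₀ < 0) : ∃ ε, GoodRadius ε t₀ := by
  obtain ⟨U, hU, hU'⟩ := Filter.eventually_prod_self_iff'.1 (eventually_act_G₃_Kinv_ne_Kinv ht₀)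
  obtain ⟨V, hV, hV'⟩ := Filter.eventually_prod_self_iff'.1
    (eventually_act_G₃_Tinv_ne_Tinv (t₀ := t₀))
  have h := (eventually_nearEdge_norm ht₀).and <| (eventually_act_Kinv_mem_tetB ht₀).and <|
    (eventually_act_Kinv_mem_tetA ht₀).and <| (eventually_act_G₃_Kinv_mem_tetB ht₀).and <|
    (eventually_act_Tinv_mem_slab ht₀).and <| (eventually_act_G₃_Tinv_mem_slab ht₀).and <|
    (eventually_act_Kinv_mem_face ht₀).and <| (eventually_act_Tinv_mem_face ht₀).and <|
    (eventually_act_G₃_Tinv_mem_face ht₀).and <| (eventually_act_Kinv_notMem_triMinus ht₀).and <|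
    (eventually_act_G₂_ne_act_Kinv ht₀).and <| (eventually_act_G₃_ne_act_Kinv ht₀).and <|
    (eventually_act_G₃_Kinv_notMem_triMinus ht₀).and <|
    (eventually_act_Tinv_notMem_triMinus ht₀).and <| eventually_act_bigon_ne_act_Tinv.and <|
    eventually_act_G₃_Tinv_notMem_bigonB'.and <| (Filter.eventually_mem_set.2 hU).and
    (Filter.eventually_mem_set.2 hV)
  obtain ⟨ε, hε, hsub⟩ := exists_Cyl_subset h
  have h' := fun p (hp : p ∈ Cyl ε t₀) => hsub hp
  refine ⟨ε, hε, fun p hp => (h' p hp).1, fun p hp => (h' p hp).2.1, fun p hp => (h' p hp).2.2.1,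
    fun p hp => (h' p hp).2.2.2.1, fun p hp => (h' p hp).2.2.2.2.1,
    fun p hp => (h' p hp).2.2.2.2.2.1, fun p hp => (h' p hp).2.2.2.2.2.2.1,
    fun p hp => (h' p hp).2.2.2.2.2.2.2.1, fun p hp => (h' p hp).2.2.2.2.2.2.2.2.1,
    fun p hp => (h' p hp).2.2.2.2.2.2.2.2.2.1, fun p hp => (h' p hp).2.2.2.2.2.2.2.2.2.2.1,
    fun p hp => (h' p hp).2.2.2.2.2.2.2.2.2.2.2.1,
    fun p hp => (h' p hp).2.2.2.2.2.2.2.2.2.2.2.2.1,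
    fun p hp => (h' p hp).2.2.2.2.2.2.2.2.2.2.2.2.2.1,
    fun p hp => (h' p hp).2.2.2.2.2.2.2.2.2.2.2.2.2.2.1,
    fun p hp => (h' p hp).2.2.2.2.2.2.2.2.2.2.2.2.2.2.2.1, fun p hp p' hp' => ?_,
    fun p hp p' hp' => ?_⟩
  · exact hU' p (h' p hp).2.2.2.2.2.2.2.2.2.2.2.2.2.2.2.2.1 p'
      (h' p' hp').2.2.2.2.2.2.2.2.2.2.2.2.2.2.2.2.1
  · exact hV' p (h' p hp).2.2.2.2.2.2.2.2.2.2.2.2.2.2.2.2.2 p'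
      (h' p' hp').2.2.2.2.2.2.2.2.2.2.2.2.2.2.2.2.2

/-! ### Rotations around the edge -/

/-- The rotation by `-nπ/3` around the vertical axis. -/
noncomputable def rotBack (n : ℕ) (p : ℂ × ℝ) : ℂ × ℝ := ((-star om) ^ n * p.1, p.2)

theorem act_G₃inv_pow (n : ℕ) (p : ℂ × ℝ) : act (G₃inv ^ n) p = rotBack n p := by
  induction n with
  | zero => simp [rotBack, act_one]
  | succ n ih =>
    rw [pow_succ', act_mul _ (U21_pow G₃inv_mem n), ih, rotBack, act_G₃inv, rotBack, pow_succ',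
      mul_assoc]

theorem norm_rotBack (n : ℕ) (p : ℂ × ℝ) : ‖(rotBack n p).1‖ = ‖p.1‖ := by
  rw [rotBack, norm_mul, norm_pow, norm_neg, norm_star, norm_om, one_pow, one_mul]

theorem rotBack_mem_Cyl {n : ℕ} {p : ℂ × ℝ} {ε t₀ : ℝ} (hp : p ∈ Cyl ε t₀) :
    rotBack n p ∈ Cyl ε t₀ :=
  ⟨by rw [norm_rotBack]; exact hp.1, hp.2⟩

theorem rotBack_polar_iff (n : ℕ) (p : ℂ × ℝ) (θ : ℝ) :
    (rotBack n p).1 = ‖(rotBack n p).1‖ * Complex.exp (θ * Complex.I) ↔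
      p.1 = ‖p.1‖ * Complex.exp ((θ + n * (Real.pi / 3) : ℝ) * Complex.I) := by
  have e : Complex.exp ((Real.pi / 3 : ℝ) * Complex.I) = -om := by
    apply Complex.ext
    · rw [Complex.exp_ofReal_mul_I_re, Real.cos_pi_div_three]; simp [om_re]
    · rw [Complex.exp_ofReal_mul_I_im, Real.sin_pi_div_three]; simp [om_im]
  have e2 : Complex.exp ((θ + n * (Real.pi / 3) : ℝ) * Complex.I) =
      (-om) ^ n * Complex.exp (θ * Complex.I) := by
    rw [← e, ← Complex.exp_nat_mul, ← Complex.exp_add]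
    congr 1
    push_cast; ring
  have e3 : (-om) ^ n * (-star om) ^ n = 1 := by
    rw [← mul_pow, neg_mul_neg, om_mul_star, one_pow]
  rw [norm_rotBack, e2]
  simp only [rotBack]
  constructor
  · intro h
    linear_combination (-om) ^ n * h - p.1 * e3
  · intro h
    linear_combination (-star om) ^ n * h + (‖p.1‖ * Complex.exp (θ * Complex.I)) * e3

theorem rotBack_mem_wedge {n : ℕ} {p : ℂ × ℝ} {a b : ℝ × ℝ → ℝ} :
    rotBack n p ∈ Wedge a b ↔
      p ∈ Wedge (fun q => a q + n * (Real.pi / 3)) (fun q => b q + n * (Real.pi / 3)) := by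
  simp only [Wedge, Set.mem_ofPred_eq, rotBack_polar_iff]
  simp only [norm_rotBack]
  constructor
  · rintro ⟨θ, h1, h2, h3⟩
    exact ⟨θ + n * (Real.pi / 3), add_le_add_left h1 _, add_le_add_left h2 _, h3⟩
  · rintro ⟨θ, h1, h2, h3⟩
    refine ⟨θ - n * (Real.pi / 3), ?_, ?_, ?_⟩
    · change a (‖p.1‖, p.2) ≤ _
      linarith
    · change _ ≤ b (‖p.1‖, p.2)
      linarith
    · rw [sub_add_cancel]; exact h3

theorem onWall_rotBack {n : ℕ} {p : ℂ × ℝ} {a : ℝ × ℝ → ℝ} :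
    OnWall a (rotBack n p) ↔ OnWall (fun q => a q + n * (Real.pi / 3)) p := by
  unfold OnWall
  rw [rotBack_polar_iff, norm_rotBack]
  rfl

/-! ### The walls around an edge -/

/-- The walls around an edge of the cell decomposition: `r + 4` cells meet at the edge, in this
order: a slab, a tetrahedron of type `B`, `r` tetrahedra of type `A`, a tetrahedron of type `B`,
and a slab. -/
noncomputable def ringWall (r i : ℕ) (q : ℝ × ℝ) : ℝ :=
  if i = 0 then -(Real.pi / 6)
  else if i = 1 then arcAngle q
  else if i ≤ r + 2 then wallAngle q + ((i : ℝ) - 2) * (Real.pi / 3)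
  else if i = r + 3 then arcAngle' q + r * (Real.pi / 3)
  else 3 * Real.pi / 2 + Real.pi / 3 * (((1 - (r : ℤ)) % 6 : ℤ) : ℝ) + r * (Real.pi / 3)

theorem ringWall_zero (r : ℕ) (q : ℝ × ℝ) : ringWall r 0 q = -(Real.pi / 6) := rfl

theorem ringWall_one (r : ℕ) (q : ℝ × ℝ) : ringWall r 1 q = arcAngle q := rfl

theorem ringWall_mid {r i : ℕ} (h : 2 ≤ i) (h' : i ≤ r + 2) (q : ℝ × ℝ) :
    ringWall r i q = wallAngle q + ((i : ℝ) - 2) * (Real.pi / 3) := by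
  rw [ringWall, if_neg (by omega), if_neg (by omega), if_pos h']

theorem ringWall_penultimate (r : ℕ) (q : ℝ × ℝ) :
    ringWall r (r + 3) q = arcAngle' q + r * (Real.pi / 3) := by
  rw [ringWall, if_neg (by omega), if_neg (by omega), if_neg (by omega), if_pos rfl]

theorem ringWall_last (r : ℕ) (q : ℝ × ℝ) : ringWall r (r + 4) q =
    3 * Real.pi / 2 + Real.pi / 3 * (((1 - (r : ℤ)) % 6 : ℤ) : ℝ) + r * (Real.pi / 3) := by
  rw [ringWall, if_neg (by omega), if_neg (by omega), if_neg (by omega), if_neg (by omega)]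

theorem ring_index_cases {r i : ℕ} (hi : i < r + 4) :
    i = 0 ∨ i = 1 ∨ (2 ≤ i ∧ i ≤ r + 1) ∨ i = r + 2 ∨ i = r + 3 := by omega

theorem continuous_arcAngle : Continuous arcAngle := continuous_const.add continuous_circleDev

theorem continuous_arcAngle' : Continuous arcAngle' := continuous_const.sub continuous_circleDev

theorem continuous_ringWall {r i : ℕ} (hi : i ≤ r + 4) : Continuous (ringWall r i) := by
  obtain rfl | rfl | ⟨h, h'⟩ | rfl | rfl : i = 0 ∨ i = 1 ∨ (2 ≤ i ∧ i ≤ r + 2) ∨ i = r + 3 ∨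
    i = r + 4 := by omega
  · exact continuous_const
  · exact continuous_arcAngle
  · rw [funext (ringWall_mid h h')]
    exact continuous_wallAngle.add continuous_const
  · rw [funext (ringWall_penultimate r)]
    exact continuous_arcAngle'.add continuous_const
  · rw [funext (ringWall_last r)]
    exact continuous_const

/-- The number of turns around the edge. -/
def turns (r : ℕ) : ℕ := (r + 5 + ((1 - (r : ℤ)) % 6).toNat) / 6

/-- The division is exact because 1 - r ≡ -(r + 5) modulo 6. -/
theorem six_mul_turns (r : ℕ) : 6 * (turns r : ℤ) = r + 5 + (1 - (r : ℤ)) % 6 := by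
  unfold turns
  omega

theorem one_le_turns (r : ℕ) : 1 ≤ turns r := by
  have := six_mul_turns r
  omega

theorem ceil_eq_turns (r : ℕ) : ⌈((r : ℚ) + 5) / 6⌉₊ = turns r := by
  have h := six_mul_turns r
  have h1 : (6 : ℤ) * turns r < r + 11 := by omega
  have h2 : (r : ℤ) + 5 ≤ 6 * turns r := by omega
  have h1' : (6 : ℚ) * turns r < r + 11 := by exact_mod_cast h1
  have h2' : (r : ℚ) + 5 ≤ 6 * turns r := by exact_mod_cast h2
  apply le_antisymm
  · rw [Nat.ceil_le]; linarith
  · have := Nat.le_ceil (((r : ℚ) + 5) / 6)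
    have h3 : (turns r : ℚ) < ⌈((r : ℚ) + 5) / 6⌉₊ + 1 := by linarith
    exact Nat.lt_succ_iff.1 (by exact_mod_cast h3)

/-- This is the angle count: the closing wall is the opening one after `turns r` full turns. -/
theorem ringWall_last_eq (r : ℕ) (q : ℝ × ℝ) :
    ringWall r (r + 4) q = ringWall r 0 q + 2 * Real.pi * turns r := by
  rw [ringWall_last, ringWall_zero]
  have h : (6 : ℝ) * turns r = r + 5 + (((1 - (r : ℤ)) % 6 : ℤ) : ℝ) := by
    exact_mod_cast six_mul_turns r
  linear_combination (-(Real.pi / 3)) * h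

theorem ringWall_le {r i : ℕ} (hi : i < r + 4) {q : ℝ × ℝ} (h : NearEdge q) :
    ringWall r i q ≤ ringWall r (i + 1) q := by
  have hpi := Real.pi_pos
  have h1 := h.circle_nonneg
  have h2 := h.dev_nonneg
  have h3 := h.circle_lt
  have h4 := h.dev_lt
  have h5 := h.lt_axis
  have h6 : wallAxis q < Real.pi / 2 := NearEdge.axis_lt
  obtain rfl | rfl | ⟨h, h'⟩ | rfl | rfl := ring_index_cases hi
  · rw [ringWall_zero, ringWall_one, arcAngle]; linarith
  · rw [ringWall_one, ringWall_mid le_rfl (by omega), arcAngle, wallAngle]; push_cast; linarith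
  · rw [ringWall_mid h (by omega), ringWall_mid (by omega) (by omega)]; push_cast; linarith
  · rw [ringWall_mid (by omega) le_rfl, ringWall_penultimate, arcAngle', wallAngle]
    push_cast; linarith
  · rw [ringWall_penultimate, ringWall_last, arcAngle']
    have := mul_nonneg (div_pos Real.pi_pos three_pos).le (emod_six_nonneg r)
    linarith

theorem ringWall_lt {r i : ℕ} (hi : i < r + 4) {q : ℝ × ℝ} (h : NearEdge q) (h0 : 0 < q.1) :
    ringWall r i q < ringWall r (i + 1) q := by
  have hpi := Real.pi_pos
  -- Needed for the last slab when r ≡ 1 mod 6: its two walls are then tangent on the axis and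
  -- separate only through the deviation of the circle. Hence the assumption ρ > 0.
  have h1 : 0 < circleDev q := Real.arcsin_pos.2 (by positivity)
  have h2 := h.dev_nonneg
  have h3 := h.circle_lt
  have h4 := h.dev_lt
  have h5 := h.lt_axis
  have h6 : wallAxis q < Real.pi / 2 := NearEdge.axis_lt
  obtain rfl | rfl | ⟨h, h'⟩ | rfl | rfl := ring_index_cases hi
  · rw [ringWall_zero, ringWall_one, arcAngle]; linarith
  · rw [ringWall_one, ringWall_mid le_rfl (by omega), arcAngle, wallAngle]; push_cast; linarith
  · rw [ringWall_mid h (by omega), ringWall_mid (by omega) (by omega)]; push_cast; linarith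
  · rw [ringWall_mid (by omega) le_rfl, ringWall_penultimate, arcAngle', wallAngle]
    push_cast; linarith
  · rw [ringWall_penultimate, ringWall_last, arcAngle']
    have := mul_nonneg (div_pos Real.pi_pos three_pos).le (emod_six_nonneg r)
    linarith

/-- A direction in the middle of each of the wedges. -/
noncomputable def ringCenter (r i : ℕ) : ℝ :=
  if i = 0 then Real.pi / 6
  else if i = 1 then Real.pi
  else if i ≤ r + 2 then Real.pi + ((i : ℝ) - 2) * (Real.pi / 3)
  else 7 * Real.pi / 3 + r * (Real.pi / 3)

/-- Every wedge is narrower than 2π, even the last slab, whose sector can reach 5π/3; so one branch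
of the root serves each. -/
theorem ringWall_near_center {r i : ℕ} (hi : i < r + 4) {q : ℝ × ℝ} (h : NearEdge q) :
    ringCenter r i - Real.pi < ringWall r i q ∧
      ringWall r (i + 1) q < ringCenter r i + Real.pi := by
  have hpi := Real.pi_pos
  have h1 := h.circle_nonneg
  have h2 := h.dev_nonneg
  have h3 := h.circle_lt
  have h4 := h.dev_lt
  have h5 := h.lt_axis
  have h6 : wallAxis q < Real.pi / 2 := NearEdge.axis_lt
  obtain rfl | rfl | ⟨h, h'⟩ | rfl | rfl := ring_index_cases hi
  · rw [ringWall_zero, ringWall_one, arcAngle, ringCenter, if_pos rfl]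
    constructor <;> linarith
  · rw [ringWall_one, ringWall_mid le_rfl (by omega), arcAngle, wallAngle, ringCenter,
      if_neg (by omega), if_pos rfl]
    push_cast
    constructor <;> linarith
  · rw [ringWall_mid h (by omega), ringWall_mid (by omega) (by omega), ringCenter,
      if_neg (by omega), if_neg (by omega), if_pos (by omega), wallAngle]
    push_cast
    constructor <;> linarith
  · rw [ringWall_mid (by omega) le_rfl, ringWall_penultimate, arcAngle', wallAngle, ringCenter,
      if_neg (by omega), if_neg (by omega), if_pos (by omega)]
    push_cast
    constructor <;> linarith
  · rw [ringWall_penultimate, ringWall_last, arcAngle', ringCenter,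
      if_neg (by omega), if_neg (by omega), if_neg (by omega)]
    have := mul_le_mul_of_nonneg_left (emod_six_le r) (div_pos Real.pi_pos three_pos).le
    constructor <;> linarith

/-! ### The developing matrices -/

theorem G₄_mul_Tinv : G₄ * Tinv = (-om) • Kinv := by
  calc G₄ * Tinv = Kinv * (K * G₄) * Tinv := by
        rw [← Matrix.mul_assoc, Kinv_mul_K, Matrix.one_mul]
    _ = (-om) • Kinv := by
        rw [K_mul_G₄, Matrix.mul_smul, Matrix.smul_mul, Matrix.mul_assoc, T_mul_Tinv,
          Matrix.mul_one]

theorem G₁_mul_Kinv : G₁ * Kinv = (-om) • (Kinv * G₃inv * 1) := by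
  calc G₁ * Kinv = Kinv * (G₃inv * (G₃ * K * G₁)) * Kinv := by
        rw [Matrix.mul_assoc G₃, ← Matrix.mul_assoc G₃inv, G₃inv_mul_G₃, Matrix.one_mul,
          ← Matrix.mul_assoc Kinv, Kinv_mul_K, Matrix.one_mul]
    _ = (-om) • (Kinv * G₃inv * 1) := by
        rw [G₃_mul_K_mul_G₁, Matrix.mul_smul, Matrix.mul_smul, Matrix.smul_mul, ← K_mul_Kinv]
        simp only [Matrix.mul_assoc]

theorem G₄_mul_G₃ : G₄ * G₃ = G₃ * G₄ := by
  calc G₄ * G₃ = G₃ * (G₃inv * G₄) * G₃ := by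
        rw [← Matrix.mul_assoc, G₃_mul_G₃inv, Matrix.one_mul]
    _ = G₃ * G₄ := by
        rw [G₃inv_mul_G₄, Matrix.mul_assoc, Matrix.mul_assoc, G₃inv_mul_G₃, Matrix.mul_one]

theorem G₃inv_pow_mul_G₃_pow (n : ℕ) : G₃inv ^ n * G₃ ^ n = 1 := by
  induction n with
  | zero => simp
  | succ n ih =>
    rw [pow_succ, pow_succ', Matrix.mul_assoc, ← Matrix.mul_assoc G₃inv, G₃inv_mul_G₃,
      Matrix.one_mul, ih]

theorem G₃_pow_mul_G₃inv_pow (n : ℕ) : G₃ ^ n * G₃inv ^ n = 1 := by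
  induction n with
  | zero => simp
  | succ n ih =>
    rw [pow_succ, pow_succ', Matrix.mul_assoc, ← Matrix.mul_assoc G₃, G₃_mul_G₃inv,
      Matrix.one_mul, ih]

/-- In the frame of the last slab, `G₂ ^ r` is the rotation by -rπ/3. This undoes the r rotations of
the tetrahedra of type A and closes the ring consistently. -/
theorem G₂_pow_mul_G₃_mul_Tinv (r : ℕ) :
    G₂ ^ r * G₃ * Tinv = G₃ * Tinv * G₃inv ^ r := by
  have h : G₃ * (Tinv * (G₃inv ^ r * (G₃ ^ r * (T * (G₃inv * (G₂ ^ r * (G₃ * Tinv))))))) =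
      G₃ * (Tinv * (G₃inv ^ r * (T * (G₃inv * (G₃ * Tinv))))) := by
    have := G₃_pow_mul_T_mul_G₂_pow r
    have h2 : G₃ ^ r * (T * (G₃inv * (G₂ ^ r * (G₃ * Tinv)))) = T * (G₃inv * (G₃ * Tinv)) := by
      rw [← Matrix.mul_assoc T G₃inv (G₃ * Tinv), ← this]
      simp only [Matrix.mul_assoc]
    rw [h2]
  rw [← Matrix.mul_assoc (G₃inv ^ r), G₃inv_pow_mul_G₃_pow, Matrix.one_mul,
    ← Matrix.mul_assoc Tinv, Tinv_mul_T, Matrix.one_mul, ← Matrix.mul_assoc G₃, G₃_mul_G₃inv,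
    Matrix.one_mul, ← Matrix.mul_assoc G₃inv, G₃inv_mul_G₃, Matrix.one_mul, T_mul_Tinv,
    Matrix.mul_one] at h
  simp only [Matrix.mul_assoc]
  exact h

theorem neg_om_ne_zero : -om ≠ 0 := neg_ne_zero.2 om_ne_zero

theorem act_G₄_act_Tinv (X : Heis) : act G₄ (act Tinv X) = act Kinv X := by
  rw [← act_mul _ Tinv_mem, G₄_mul_Tinv, act_smul neg_om_ne_zero]

theorem act_G₁_act_Kinv (X : Heis) : act G₁ (act Kinv X) = act Kinv (act G₃inv X) := by
  rw [← act_mul _ Kinv_mem, G₁_mul_Kinv, act_smul neg_om_ne_zero, Matrix.mul_one,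
    act_mul _ G₃inv_mem]

theorem act_G₄_act_G₃ (X : Heis) : act G₄ (act G₃ X) = act G₃ (act G₄ X) := by
  rw [← act_mul _ G₃_mem, G₄_mul_G₃, act_mul _ G₄_mem]

theorem act_bigon_act_Tinv (r : ℕ) (X : Heis) :
    act (G₂ ^ r * G₃) (act Tinv X) = act G₃ (act Tinv (act (G₃inv ^ r) X)) := by
  rw [← act_mul _ Tinv_mem, G₂_pow_mul_G₃_mul_Tinv, act_mul _ (U21_pow G₃inv_mem r),
    act_mul _ Tinv_mem]

theorem act_G₃inv_rotBack (n : ℕ) (p : ℂ × ℝ) :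
    act G₃inv (rotBack n p : Heis) = rotBack (n + 1) p := by
  rw [← act_G₃inv_pow, ← act_G₃inv_pow, pow_succ', act_mul _ (U21_pow G₃inv_mem n)]

/-- The number of rotations relating a cell around the edge to the standard one. -/
def ringRot (r i : ℕ) : ℕ := if i ≤ r + 1 then i - 1 else r

/-- The inverses of the developing maps of the standard cells around the edge. -/
noncomputable def ringBase (r i : ℕ) : Matrix (Fin 3) (Fin 3) ℂ :=
  if i = 0 then Tinv else if i ≤ r + 1 then Kinv else if i = r + 2 then G₃ * Kinv else G₃ * Tinv

/-- The developing maps of the standard cells around the edge. -/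
noncomputable def ringBaseInv (r i : ℕ) : Matrix (Fin 3) (Fin 3) ℂ :=
  if i = 0 then T else if i ≤ r + 1 then K else if i = r + 2 then K * G₃inv else T * G₃inv

/-- The developing maps of the cells around the edge. -/
noncomputable def ringDev (r i : ℕ) : Matrix (Fin 3) (Fin 3) ℂ :=
  G₃ ^ ringRot r i * ringBaseInv r i

/-- The inverses of the developing maps of the cells around the edge. -/
noncomputable def ringInv (r i : ℕ) : Matrix (Fin 3) (Fin 3) ℂ :=
  ringBase r i * G₃inv ^ ringRot r i

theorem ringBase_mem (r i : ℕ) : ringBase r i ∈ U21 := by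
  unfold ringBase
  split_ifs
  exacts [Tinv_mem, Kinv_mem, U21_mul G₃_mem Kinv_mem, U21_mul G₃_mem Tinv_mem]

theorem ringBaseInv_mem (r i : ℕ) : ringBaseInv r i ∈ U21 := by
  unfold ringBaseInv
  split_ifs
  exacts [T_mem, K_mem, U21_mul K_mem G₃inv_mem, U21_mul T_mem G₃inv_mem]

theorem ringBaseInv_mul_ringBase (r i : ℕ) : ringBaseInv r i * ringBase r i = 1 := by
  unfold ringBase ringBaseInv
  split_ifs
  · exact T_mul_Tinv
  · exact K_mul_Kinv
  · rw [Matrix.mul_assoc, ← Matrix.mul_assoc G₃inv, G₃inv_mul_G₃, Matrix.one_mul, K_mul_Kinv]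
  · rw [Matrix.mul_assoc, ← Matrix.mul_assoc G₃inv, G₃inv_mul_G₃, Matrix.one_mul, T_mul_Tinv]

theorem ringDev_mem (r i : ℕ) : ringDev r i ∈ U21 :=
  U21_mul (U21_pow G₃_mem _) (ringBaseInv_mem r i)

theorem ringInv_mem (r i : ℕ) : ringInv r i ∈ U21 :=
  U21_mul (ringBase_mem r i) (U21_pow G₃inv_mem _)

theorem act_ringDev_act_ringInv (r i : ℕ) (X : Heis) :
    act (ringDev r i) (act (ringInv r i) X) = X := by
  apply act_cancel (ringInv_mem r i)
  rw [ringDev, ringInv, Matrix.mul_assoc, ← Matrix.mul_assoc (ringBaseInv r i),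
    ringBaseInv_mul_ringBase, Matrix.one_mul, G₃_pow_mul_G₃inv_pow]

theorem act_injective {G : Matrix (Fin 3) (Fin 3) ℂ} (hG : G ∈ U21) :
    Function.Injective (act G) := by
  intro X Y h
  have := U21_left_inv hG
  have h2 := congrArg (act (formJ * Gᴴ * formJ)) h
  rwa [act_cancel hG this, act_cancel hG this] at h2

theorem act_ringInv_act_ringDev (r i : ℕ) (X : Heis) :
    act (ringInv r i) (act (ringDev r i) X) = X :=
  act_injective (ringDev_mem r i) (act_ringDev_act_ringInv r i _)

theorem act_ringInv (r i : ℕ) (p : ℂ × ℝ) :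
    act (ringInv r i) p = act (ringBase r i) (rotBack (ringRot r i) p) := by
  rw [ringInv, act_mul _ (U21_pow G₃inv_mem _), act_G₃inv_pow]

theorem rotBack_zero (p : ℂ × ℝ) : rotBack 0 p = p := by simp [rotBack]

theorem act_ringInv_zero (r : ℕ) (p : ℂ × ℝ) : act (ringInv r 0) p = act Tinv p := by
  rw [act_ringInv]
  simp [ringBase, ringRot, rotBack_zero]

theorem act_ringInv_tet {r n : ℕ} (h : n ≤ r) (p : ℂ × ℝ) :
    act (ringInv r (n + 1)) p = act Kinv (rotBack n p) := by
  rw [act_ringInv, ringBase, ringRot, if_neg (by omega), if_pos (by omega), if_pos (by omega),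
    Nat.add_sub_cancel]

theorem act_ringInv_rot_tet (r : ℕ) (p : ℂ × ℝ) :
    act (ringInv r (r + 2)) p = act G₃ (act Kinv (rotBack r p)) := by
  have h1 : ringBase r (r + 2) = G₃ * Kinv := by simp [ringBase]
  have h2 : ringRot r (r + 2) = r := by simp [ringRot]
  rw [act_ringInv, h1, h2, act_mul _ Kinv_mem]

theorem act_ringInv_rot_slab (r : ℕ) (p : ℂ × ℝ) :
    act (ringInv r (r + 3)) p = act G₃ (act Tinv (rotBack r p)) := by
  have h1 : ringBase r (r + 3) = G₃ * Tinv := by simp [ringBase]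
  have h2 : ringRot r (r + 3) = r := by simp [ringRot]
  rw [act_ringInv, h1, h2, act_mul _ Tinv_mem]

/-! ### The cells around an edge -/

section Ring

variable {m : ℕ} [NeZero m] {w : ZMod m → Letter}

/-- The cells around the edge `41` of a slab. -/
noncomputable def ringCell (j : ZMod m) (hj : w j = Letter.R) (i : ℕ) : Cell w :=
  if i = 0 then .slab j hj
  else if i ≤ run w j + 2 then .tet (j + i)
  else .slab (j + run w j + 1) (run_spec w j hj)

variable {j : ZMod m} {hj : w j = Letter.R}

theorem ringCell_zero : ringCell j hj 0 = .slab j hj := rfl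

theorem ringCell_tet {n : ℕ} (h : n ≤ run w j + 1) :
    ringCell j hj (n + 1) = .tet (j + (n + 1 : ℕ)) := by
  rw [ringCell, if_neg (by omega), if_pos (by omega)]

theorem ringCell_last :
    ringCell j hj (run w j + 3) = .slab (j + run w j + 1) (run_spec w j hj) := by
  rw [ringCell, if_neg (by omega), if_neg (by omega)]

theorem idealSet_tet_of_R {k : ZMod m} (h : w (k - 1) = Letter.R) :
    (Cell.tet k : Cell w).idealSet = tetB \ tetVertices := by
  have : (Cell.tet k : Cell w).closedSet = tetB := by
    simp only [Cell.closedSet, h]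
  rw [Cell.idealSet, this]
  rfl

theorem idealSet_tet_of_L {k : ZMod m} (h : w (k - 1) = Letter.L) :
    (Cell.tet k : Cell w).idealSet = tetA \ tetVertices := by
  have : (Cell.tet k : Cell w).closedSet = tetA := by
    simp only [Cell.closedSet, h]
  rw [Cell.idealSet, this]
  rfl

theorem idealSet_slab {k : ZMod m} (hk : w k = Letter.R) :
    (Cell.slab k hk : Cell w).idealSet =
      slabSet ((valence w (.slab k hk .e24) : ℤ) - 4) \ slabVertices := rfl

theorem letter_at_run (hj : w j = Letter.R) : w (j + (run w j + 1 : ℕ)) = Letter.R := by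
  have := run_spec w j hj
  rwa [Nat.cast_add, Nat.cast_one, ← add_assoc]

variable {ε t₀ : ℝ}

/-- Each case is a local description from `GoodRadius`, transported by the rotations accumulated up
to that cell. -/
theorem act_ringInv_mem_idealSet (hj : w j = Letter.R) (g : GoodRadius ε t₀) {i : ℕ}
    (hi : i < run w j + 4) {p : ℂ × ℝ} (hp : p ∈ Cyl ε t₀) :
    act (ringInv (run w j) i) p ∈ (ringCell j hj i).idealSet ↔
      p ∈ Wedge (ringWall (run w j) i) (ringWall (run w j) (i + 1)) := by
  have hidx : ∀ n : ℕ, j + ((n + 1 : ℕ) : ZMod m) - 1 = j + n := by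
    intro n; push_cast; ring
  obtain rfl | rfl | ⟨h, h'⟩ | rfl | rfl := ring_index_cases hi
  · rw [ringCell_zero, idealSet_slab, act_ringInv_zero, g.mem_slab p hp]
    rfl
  · rw [ringCell_tet (by omega), idealSet_tet_of_R (by rw [hidx]; simpa using hj),
      act_ringInv_tet (by omega), rotBack_zero, g.mem_tetB p hp,
      funext (ringWall_mid (r := run w j) (i := 1 + 1) le_rfl (by omega))]
    have e : (fun q => wallAngle q + (((1 + 1 : ℕ) : ℝ) - 2) * (Real.pi / 3)) = wallAngle := by
      ext q; push_cast; ring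
    rw [e]
    rfl
  · obtain ⟨n, rfl⟩ : ∃ n, i = n + 1 := ⟨i - 1, by omega⟩
    rw [ringCell_tet (by omega), idealSet_tet_of_L
        (by rw [hidx]; exact eq_L_of_pos_of_le_run w (by omega) (by omega)),
      act_ringInv_tet (by omega), g.mem_tetA _ (rotBack_mem_Cyl hp), rotBack_mem_wedge,
      funext (ringWall_mid (r := run w j) (i := n + 1) h (by omega)),
      funext (ringWall_mid (r := run w j) (i := n + 1 + 1) (by omega) (by omega))]
    have e : (fun q => wallAngle q - Real.pi / 3 + n * (Real.pi / 3)) =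
        fun q => wallAngle q + (((n + 1 : ℕ) : ℝ) - 2) * (Real.pi / 3) := by
      ext q; push_cast; ring
    have e2 : (fun q => wallAngle q + n * (Real.pi / 3)) =
        fun q => wallAngle q + (((n + 1 + 1 : ℕ) : ℝ) - 2) * (Real.pi / 3) := by
      ext q; push_cast; ring
    rw [e, e2]
  · rw [ringCell_tet (n := run w j + 1) le_rfl, idealSet_tet_of_R
        (by rw [hidx]; exact letter_at_run hj),
      act_ringInv_rot_tet, g.rot_mem_tetB _ (rotBack_mem_Cyl hp), rotBack_mem_wedge,
      funext (ringWall_mid (r := run w j) (i := run w j + 2) (by omega) le_rfl),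
      funext (ringWall_penultimate (run w j))]
    have e : (fun q => wallAngle q + run w j * (Real.pi / 3)) =
        fun q => wallAngle q + (((run w j + 2 : ℕ) : ℝ) - 2) * (Real.pi / 3) := by
      ext q; push_cast; ring
    rw [e]
  -- Here the index of the last slab is computed to be r, which fixes the closing angle.
  · rw [ringCell_last, idealSet_slab, valence_slab24 w j hj, act_ringInv_rot_slab,
      g.rot_mem_slab _ (rotBack_mem_Cyl hp), rotBack_mem_wedge,
      funext (ringWall_penultimate (run w j)), funext (ringWall_last (run w j))]
    have e : (((run w j + 4 : ℕ) : ℤ) - 4) = (run w j : ℤ) := by push_cast; ring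
    rw [e]

/-! ### The face pairings around an edge -/

theorem pairing_mat_mem (P : Pairing w) : P.mat ∈ U21 := by
  cases P
  exacts [G₁_mem, G₂_mem, G₃_mem, U21_one, G₄_mem, U21_mul (U21_pow G₂_mem _) G₃_mem]

/-- The pairing `P` identifies the `i`-th and the `i'`-th cell around the edge along the `k`-th
wall. -/
structure IsLink (ε t₀ : ℝ) (j : ZMod m) (hj : w j = Letter.R) (P : Pairing w)
    (i i' k : ℕ) : Prop where
  src_eq : P.src = ringCell j hj i
  tgt_eq : P.tgt = ringCell j hj i'
  act_eq : ∀ p : ℂ × ℝ, act P.mat (act (ringInv (run w j) i) p) = act (ringInv (run w j) i') p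
  mem_face_iff : ∀ p ∈ Cyl ε t₀,
    (act (ringInv (run w j) i) p ∈ P.face ↔ OnWall (ringWall (run w j) k) p)

theorem isLink_slab (g : GoodRadius ε t₀) : IsLink ε t₀ j hj (.slab124 j hj) 0 1 1 where
  src_eq := rfl
  tgt_eq := by rw [ringCell_tet (by omega)]; simp [Pairing.tgt]
  act_eq p := by
    rw [act_ringInv_zero, act_ringInv_tet (by omega), rotBack_zero]
    exact act_G₄_act_Tinv _
  mem_face_iff p hp := by
    rw [act_ringInv_zero]
    exact g.mem_slabFace p hp

theorem isLink_tet (g : GoodRadius ε t₀) {n : ℕ} (hn : n + 1 ≤ run w j)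
    (h : w (j + (n + 1 : ℕ)) = Letter.L) :
    IsLink ε t₀ j hj (.tetL134 (j + (n + 1 : ℕ)) h) (n + 1) (n + 2) (n + 2) where
  src_eq := by rw [ringCell_tet (by omega)]; rfl
  tgt_eq := by
    rw [ringCell_tet (by omega)]
    change Cell.tet _ = Cell.tet _
    congr 1
    push_cast; ring
  act_eq p := by
    rw [act_ringInv_tet (by omega), act_ringInv_tet (by omega), ← act_G₃inv_rotBack]
    exact act_G₁_act_Kinv _
  mem_face_iff p hp := by
    rw [act_ringInv_tet (by omega), funext (ringWall_mid (i := n + 2) (by omega) (by omega))]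
    refine (g.mem_tetFace _ (rotBack_mem_Cyl hp)).trans ?_
    rw [onWall_rotBack]
    push_cast
    rw [add_sub_cancel_right]

theorem isLink_last_tet (g : GoodRadius ε t₀) (h : w (j + (run w j + 1 : ℕ)) = Letter.R) :
    IsLink ε t₀ j hj (.tetR134 (j + (run w j + 1 : ℕ)) h) (run w j + 1) (run w j + 2)
      (run w j + 2) where
  src_eq := by rw [ringCell_tet (by omega)]; rfl
  tgt_eq := by
    rw [ringCell_tet (n := run w j + 1) (by omega)]
    change Cell.tet _ = Cell.tet _
    congr 1
    push_cast; ring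
  act_eq p := by
    rw [act_ringInv_tet le_rfl, act_ringInv_rot_tet]
    rfl
  mem_face_iff p hp := by
    rw [act_ringInv_tet le_rfl, funext (ringWall_mid (i := run w j + 2) (by omega) le_rfl)]
    refine (g.mem_tetFace _ (rotBack_mem_Cyl hp)).trans ?_
    rw [onWall_rotBack]
    push_cast
    rw [add_sub_cancel_right]

/-- The pairing runs from the slab to the tetrahedron, against the cyclic order, so the two indices
appear reversed. -/
theorem isLink_last_slab (g : GoodRadius ε t₀) :
    IsLink ε t₀ j hj (.slab124 (j + run w j + 1) (run_spec w j hj)) (run w j + 3) (run w j + 2)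
      (run w j + 3) where
  src_eq := by rw [ringCell_last]; rfl
  tgt_eq := by
    rw [ringCell_tet (n := run w j + 1) (by omega)]
    change Cell.tet _ = Cell.tet _
    congr 1
    push_cast; ring
  act_eq p := by
    rw [act_ringInv_rot_slab, act_ringInv_rot_tet]
    change act G₄ _ = _
    rw [act_G₄_act_G₃, act_G₄_act_Tinv]
  mem_face_iff p hp := by
    rw [act_ringInv_rot_slab, funext (ringWall_penultimate (run w j))]
    refine (g.rot_mem_slabFace _ (rotBack_mem_Cyl hp)).trans ?_
    rw [onWall_rotBack]

/-- The closing wall: it is expressed at the opening angle -π/6, on the side of the first slab. -/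
theorem isLink_bigon : IsLink ε t₀ j hj (.bigon j hj) 0 (run w j + 3) 0 where
  src_eq := rfl
  tgt_eq := by rw [ringCell_last]; rfl
  act_eq p := by
    rw [act_ringInv_zero, act_ringInv_rot_slab, ← act_G₃inv_pow]
    exact act_bigon_act_Tinv _ _
  mem_face_iff p hp := by
    rw [act_ringInv_zero]
    exact act_Tinv_mem_bigonB' p

theorem src_eq_slab {P : Pairing w} {k : ZMod m} {hk : w k = Letter.R}
    (h : P.src = .slab k hk) : P = .slab124 k hk ∨ P = .bigon k hk := by
  cases P <;> simp only [Pairing.src, Cell.slab.injEq, reduceCtorEq] at h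
  · subst h; exact Or.inl rfl
  · subst h; exact Or.inr rfl

theorem src_eq_tet {P : Pairing w} {k : ZMod m} (h : P.src = .tet k) :
    (∃ hk, P = .tetL134 k hk) ∨ (∃ hk, P = .tetL124 k hk) ∨ (∃ hk, P = .tetR134 k hk) ∨
      ∃ hk, P = .tetR124 k hk := by
  cases P <;> simp only [Pairing.src, Cell.tet.injEq, reduceCtorEq] at h <;> subst h <;> simp <;>
    assumption

theorem tgt_eq_slab {P : Pairing w} {k : ZMod m} {hk : w k = Letter.R}
    (h : P.tgt = .slab k hk) :
    P = .tetR124 k hk ∨ ∃ l hl, l + run w l + 1 = k ∧ P = .bigon l hl := by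
  cases P <;> simp only [Pairing.tgt, Cell.slab.injEq, reduceCtorEq] at h
  · subst h; exact Or.inl rfl
  · exact Or.inr ⟨_, _, h, rfl⟩

theorem tgt_eq_tet {P : Pairing w} {k : ZMod m} (h : P.tgt = .tet (k + 1)) :
    (∃ hk, P = .tetL134 k hk) ∨ (∃ hk, P = .tetL124 k hk) ∨ (∃ hk, P = .tetR134 k hk) ∨
      ∃ hk, P = .slab124 k hk := by
  cases P <;> simp only [Pairing.tgt, Cell.tet.injEq, reduceCtorEq, add_left_inj] at h <;>
    subst h <;> simp <;> assumption

/-- The cells `i` and `i'` around the edge are separated by the wall `k`. -/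
def RingAdj (M i i' k : ℕ) : Prop :=
  (i' = i + 1 ∧ k = i') ∨ (i = i' + 1 ∧ k = i) ∨ (i + 1 = M ∧ i' = 0 ∧ k = 0) ∨
    (i = 0 ∧ i' + 1 = M ∧ k = 0)

/-- The letter at a cell decides which pairings start there. Those whose face does not contain the
edge are excluded by the separation clauses of `GoodRadius`. -/
theorem exists_isLink_src (g : GoodRadius ε t₀) {i : ℕ} (hi : i < run w j + 4) {p : ℂ × ℝ}
    (hp : p ∈ Cyl ε t₀) {P : Pairing w} (hP : P.src = ringCell j hj i)
    (hface : act (ringInv (run w j) i) p ∈ P.face) :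
    ∃ i' k, i' < run w j + 4 ∧ RingAdj (run w j + 4) i i' k ∧ IsLink ε t₀ j hj P i i' k := by
  obtain rfl | ⟨n, hn, rfl⟩ | rfl | rfl :
      i = 0 ∨ (∃ n ≤ run w j, i = n + 1) ∨ i = run w j + 2 ∨ i = run w j + 3 := by
    rcases i with _ | i
    · exact Or.inl rfl
    · by_cases h : i ≤ run w j
      · exact Or.inr (Or.inl ⟨i, h, rfl⟩)
      · omega
  · rcases src_eq_slab hP with rfl | rfl
    · exact ⟨1, 1, by omega, Or.inl ⟨rfl, rfl⟩, isLink_slab g⟩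
    · exact ⟨run w j + 3, 0, by omega, Or.inr (Or.inr (Or.inr ⟨rfl, rfl, rfl⟩)), isLink_bigon⟩
  · rw [ringCell_tet (by omega)] at hP
    rw [act_ringInv_tet hn] at hface
    have hp' := rotBack_mem_Cyl (n := n) hp
    rcases src_eq_tet hP with ⟨hk, rfl⟩ | ⟨hk, rfl⟩ | ⟨hk, rfl⟩ | ⟨hk, rfl⟩
    · have hne : n ≠ run w j := by
        rintro rfl
        rw [letter_at_run hj] at hk
        exact Letter.R_ne_L hk
      exact ⟨n + 2, n + 2, by omega, Or.inl ⟨rfl, rfl⟩, isLink_tet g (by omega) hk⟩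
    · exact absurd hface (g.tet_notMem _ hp').1
    · have hne : n = run w j := by
        by_contra hne
        rw [eq_L_of_pos_of_le_run w (by omega) (by omega)] at hk
        exact Letter.R_ne_L hk.symm
      subst hne
      exact ⟨run w j + 2, run w j + 2, by omega, Or.inl ⟨rfl, rfl⟩, isLink_last_tet g hk⟩
    · exact absurd hface (g.tet_notMem _ hp').1
  · rw [ringCell_tet (n := run w j + 1) le_rfl] at hP
    rw [act_ringInv_rot_tet] at hface
    have hp' := rotBack_mem_Cyl (n := run w j) hp
    rcases src_eq_tet hP with ⟨hk, rfl⟩ | ⟨hk, rfl⟩ | ⟨hk, rfl⟩ | ⟨hk, rfl⟩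
    · exact absurd hface (g.rot_tet_notMem _ hp')
    · exact absurd hface (g.tet_notMem _ hp').2
    · exact absurd hface (g.rot_tet_notMem _ hp')
    · exact absurd hface (g.tet_notMem _ hp').2
  · rw [ringCell_last] at hP
    rcases src_eq_slab hP with rfl | rfl
    · exact ⟨run w j + 2, run w j + 3, by omega, Or.inr (Or.inl ⟨rfl, rfl⟩), isLink_last_slab g⟩
    · rw [act_ringInv_rot_slab] at hface
      exact absurd hface (g.rot_slab_notMem _ (rotBack_mem_Cyl hp))

/-- The same exclusion for pairings arriving at the cell, where the image of the face, rather than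
the face itself, must be kept away from the edge. -/
theorem exists_isLink_tgt (g : GoodRadius ε t₀) {i : ℕ} (hi : i < run w j + 4) {p : ℂ × ℝ}
    (hp : p ∈ Cyl ε t₀) {P : Pairing w} (hP : P.tgt = ringCell j hj i) {X : Heis}
    (hface : X ∈ P.face) (hX : act P.mat X = act (ringInv (run w j) i) p) :
    ∃ i' k, i' < run w j + 4 ∧ RingAdj (run w j + 4) i i' k ∧ IsLink ε t₀ j hj P i' i k := by
  have hidx : ∀ n : ℕ, j + ((n + 1 : ℕ) : ZMod m) = j + n + 1 := by
    intro n; push_cast; ring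
  obtain rfl | ⟨n, hn, rfl⟩ | rfl | rfl :
      i = 0 ∨ (∃ n ≤ run w j, i = n + 1) ∨ i = run w j + 2 ∨ i = run w j + 3 := by
    rcases i with _ | i
    · exact Or.inl rfl
    · by_cases h : i ≤ run w j
      · exact Or.inr (Or.inl ⟨i, h, rfl⟩)
      · omega
  · rw [act_ringInv_zero] at hX
    rcases tgt_eq_slab hP with rfl | ⟨l, hl, -, rfl⟩
    · change act 1 X = _ at hX
      rw [act_one] at hX
      rw [hX] at hface
      exact absurd hface (g.slab_notMem _ hp).1
    · exact absurd hX (g.slab_bigon_ne _ hp _ _ hface)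
  · rw [ringCell_tet (by omega), hidx] at hP
    rw [act_ringInv_tet hn] at hX
    have hp' := rotBack_mem_Cyl (n := n) hp
    rcases tgt_eq_tet hP with ⟨hk, rfl⟩ | ⟨hk, rfl⟩ | ⟨hk, rfl⟩ | ⟨hk, rfl⟩
    · obtain _ | n := n
      · rw [Nat.cast_zero, add_zero, hj] at hk
        exact absurd hk Letter.R_ne_L
      · exact ⟨n + 1, n + 2, by omega, Or.inr (Or.inl ⟨rfl, rfl⟩), isLink_tet g hn hk⟩
    · exact absurd hX (g.tet_G₂_ne _ hp' _ hface)
    · exact absurd hX (g.tet_G₃_ne _ hp' _ hface)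
    · obtain _ | n := n
      · have e : j + ((0 : ℕ) : ZMod m) = j := by rw [Nat.cast_zero, add_zero]
        refine ⟨0, 1, by omega, Or.inr (Or.inl ⟨rfl, rfl⟩), ?_⟩
        have e2 : (Pairing.slab124 (j + ((0 : ℕ) : ZMod m)) hk : Pairing w) =
            .slab124 j hj := by
          congr
        rw [e2]
        exact isLink_slab g
      · rw [eq_L_of_pos_of_le_run w (by omega) hn] at hk
        exact absurd hk.symm Letter.R_ne_L
  · rw [ringCell_tet (n := run w j + 1) le_rfl, hidx] at hP
    rcases tgt_eq_tet hP with ⟨hk, rfl⟩ | ⟨hk, rfl⟩ | ⟨hk, rfl⟩ | ⟨hk, rfl⟩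
    · rw [letter_at_run hj] at hk
      exact absurd hk Letter.R_ne_L
    · rw [letter_at_run hj] at hk
      exact absurd hk Letter.R_ne_L
    · exact ⟨run w j + 1, run w j + 2, by omega, Or.inr (Or.inl ⟨rfl, rfl⟩),
        isLink_last_tet g hk⟩
    · refine ⟨run w j + 3, run w j + 3, by omega, Or.inl ⟨rfl, rfl⟩, ?_⟩
      have e : j + ((run w j + 1 : ℕ) : ZMod m) = j + run w j + 1 := hidx _
      have e2 : (Pairing.slab124 (j + ((run w j + 1 : ℕ) : ZMod m)) hk : Pairing w) =
          .slab124 (j + run w j + 1) (run_spec w j hj) := by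
        congr
      rw [e2]
      exact isLink_last_slab g
  · rw [ringCell_last] at hP
    rw [act_ringInv_rot_slab] at hX
    rcases tgt_eq_slab hP with rfl | ⟨l, hl, h, rfl⟩
    · change act 1 X = _ at hX
      rw [act_one] at hX
      rw [hX] at hface
      exact absurd hface (g.slab_notMem _ (rotBack_mem_Cyl hp)).2
    · have := eq_of_next_eq hl hj h
      subst this
      exact ⟨0, 0, by omega, Or.inr (Or.inr (Or.inl ⟨rfl, rfl, rfl⟩)), isLink_bigon⟩

end Ring

/-! ### The chart around a point of the edge -/

section Chart

variable {m : ℕ} [NeZero m] {w : ZMod m → Letter} {j : ZMod m} {hj : w j = Letter.R}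
  {ε t₀ : ℝ}

/-- The part of the `i`-th cell around the edge that is developed into the cylinder. -/
def ringSet (ε t₀ : ℝ) (j : ZMod m) (hj : w j = Letter.R) (i : ℕ) : Set (TotalSpace w) :=
  {x | x.1 = ringCell j hj i ∧
    ∃ p ∈ Cyl ε t₀, (x.2 : Heis) = act (ringInv (run w j) i) (p : ℂ × ℝ)}

/-- The coordinates of a finite point. -/
def finPart (X : Heis) : ℂ × ℝ := Option.getD X (0, 0)

theorem finPart_coe (p : ℂ × ℝ) : finPart p = p := rfl

/-- The developed position of a point of the `i`-th cell around the edge. -/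
noncomputable def ringPos (r i : ℕ) (x : TotalSpace w) : ℂ × ℝ := finPart (act (ringDev r i) x.2)

theorem act_ringDev_of_eq {r i : ℕ} {X : Heis} {p : ℂ × ℝ} (h : X = act (ringInv r i) p) :
    act (ringDev r i) X = p := by rw [h, act_ringDev_act_ringInv]

theorem ringPos_of_eq {r i : ℕ} {x : TotalSpace w} {p : ℂ × ℝ}
    (h : (x.2 : Heis) = act (ringInv r i) p) : ringPos r i x = p := by
  rw [ringPos, act_ringDev_of_eq h, finPart_coe]

theorem mem_ringSet {i : ℕ} {x : TotalSpace w} (hx : x ∈ ringSet ε t₀ j hj i) :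
    x.1 = ringCell j hj i ∧ ringPos (run w j) i x ∈ Cyl ε t₀ ∧
      (x.2 : Heis) = act (ringInv (run w j) i) (ringPos (run w j) i x) ∧
      act (ringDev (run w j) i) x.2 = ringPos (run w j) i x := by
  obtain ⟨h1, p, hp, h2⟩ := hx
  rw [ringPos_of_eq h2]
  exact ⟨h1, hp, h2, act_ringDev_of_eq h2⟩

theorem isOpen_ringSet (i : ℕ) : IsOpen (ringSet ε t₀ j hj i) := by
  have e : ringSet ε t₀ j hj i = {x | x.1 = ringCell j hj i} ∩
      (fun x : TotalSpace w => act (ringDev (run w j) i) x.2) ⁻¹'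
        ((fun p : ℂ × ℝ => (p : Heis)) '' Cyl ε t₀) := by
    ext x
    constructor
    · rintro ⟨h1, p, hp, h2⟩
      exact ⟨h1, p, hp, (act_ringDev_of_eq h2).symm⟩
    · rintro ⟨h1, p, hp, h2⟩
      have h2 : (p : Heis) = act (ringDev (run w j) i) x.2 := h2
      exact ⟨h1, p, hp, by rw [h2, act_ringInv_act_ringDev]⟩
  rw [e]
  refine IsOpen.inter ?_ (IsOpen.preimage ?_ ?_)
  · rw [isOpen_sigma_iff]
    intro c
    by_cases h : c = ringCell j hj i <;> simp [h]
  · refine (continuous_act (ringDev_mem _ _)).comp ?_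
    rw [continuous_sigma_iff]
    intro c
    exact continuous_subtype_val
  · exact OnePoint.isOpenMap_coe _ (isOpen_Cyl ε t₀)

theorem continuousOn_ringPos (i : ℕ) :
    ContinuousOn (ringPos (run w j) i) (ringSet ε t₀ j hj i) := by
  intro x hx
  apply ContinuousAt.continuousWithinAt
  have h1 : Continuous fun x : TotalSpace w => act (ringDev (run w j) i) x.2 := by
    refine (continuous_act (ringDev_mem _ _)).comp ?_
    rw [continuous_sigma_iff]
    intro c
    exact continuous_subtype_val
  have h2 := (mem_ringSet hx).2.2.2
  refine ContinuousAt.comp (g := finPart) ?_ h1.continuousAt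
  rw [h2, OnePoint.continuousAt_coe]
  exact continuousAt_id

theorem ringPos_mem_wedge (g : GoodRadius ε t₀) {i : ℕ} (hi : i < run w j + 4)
    {x : TotalSpace w} (hx : x ∈ ringSet ε t₀ j hj i) :
    ringPos (run w j) i x ∈ Wedge (ringWall (run w j) i) (ringWall (run w j) (i + 1)) := by
  obtain ⟨h1, h2, h3, -⟩ := mem_ringSet hx
  rw [← act_ringInv_mem_idealSet hj g hi h2, ← h3, ← h1]
  exact x.2.2

/-- When the word has a single R, the two slabs of the ring are the same cell, and so are its first
and last tetrahedra. The pieces remain disjoint because they surround different edges of that cell.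
-/
theorem ringSet_disjoint_aux (g : GoodRadius ε t₀) {i i' : ℕ} (hii : i < i')
    (hi' : i' < run w j + 4) {x : TotalSpace w} (hx : x ∈ ringSet ε t₀ j hj i)
    (hx' : x ∈ ringSet ε t₀ j hj i') : False := by
  obtain ⟨h1, p, hp, h2⟩ := hx
  obtain ⟨h1', p', hp', h2'⟩ := hx'
  rw [h1] at h1'
  rw [h2] at h2'
  obtain _ | n := i
  · by_cases h : i' ≤ run w j + 2
    · obtain ⟨n', rfl⟩ : ∃ n', i' = n' + 1 := ⟨i' - 1, by omega⟩
      rw [ringCell_zero, ringCell_tet (by omega)] at h1'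
      cases h1'
    · obtain rfl : i' = run w j + 3 := by omega
      rw [act_ringInv_zero, act_ringInv_rot_slab] at h2'
      exact g.slab_ne _ (rotBack_mem_Cyl hp') _ hp h2'.symm
  · rw [ringCell_tet (by omega)] at h1'
    by_cases h : i' ≤ run w j + 2
    · obtain ⟨n', rfl⟩ : ∃ n', i' = n' + 1 := ⟨i' - 1, by omega⟩
      rw [ringCell_tet (by omega), Cell.tet.injEq, add_right_inj] at h1'
      by_cases h' : n' = run w j + 1
      · subst h'
        rw [act_ringInv_tet (by omega), act_ringInv_rot_tet] at h2'
        exact g.tet_ne _ (rotBack_mem_Cyl hp') _ (rotBack_mem_Cyl hp) h2'.symm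
      · push_cast at h1'
        have h3 := run_lt w hj
        have := natCast_injOn (i := n) (i' := n') (by omega) (by omega) (add_right_cancel h1')
        omega
    · obtain rfl : i' = run w j + 3 := by omega
      rw [ringCell_last] at h1'
      cases h1'

theorem glue_of_isLink {P : Pairing w} {i i' k : ℕ} (hL : IsLink ε t₀ j hj P i i' k)
    {x y : TotalSpace w} (hx : x ∈ ringSet ε t₀ j hj i) (hy : y ∈ ringSet ε t₀ j hj i')
    (h : ringPos (run w j) i x = ringPos (run w j) i' y)
    (hw : OnWall (ringWall (run w j) k) (ringPos (run w j) i x)) : Glue w x y := by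
  obtain ⟨h1, h2, h3, -⟩ := mem_ringSet hx
  obtain ⟨h1', -, h3', -⟩ := mem_ringSet hy
  refine ⟨P, by rw [h1, hL.src_eq], by rw [h1', hL.tgt_eq], ?_, ?_⟩
  · rw [h3]
    exact (hL.mem_face_iff _ h2).2 hw
  · rw [h3, hL.act_eq, h, ← h3']

/-- A gluing never leaves the cylinder: linked cells are developed to the same position. -/
theorem exists_ringSet_of_glue (g : GoodRadius ε t₀) {i : ℕ} (hi : i < run w j + 4)
    {x y : TotalSpace w} (hx : x ∈ ringSet ε t₀ j hj i) (h : Glue w x y ∨ Glue w y x) :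
    ∃ i' k, i' < run w j + 4 ∧ RingAdj (run w j + 4) i i' k ∧ y ∈ ringSet ε t₀ j hj i' ∧
      ringPos (run w j) i' y = ringPos (run w j) i x ∧
      OnWall (ringWall (run w j) k) (ringPos (run w j) i x) := by
  obtain ⟨h1, h2, h3, -⟩ := mem_ringSet hx
  rcases h with ⟨P, hs, ht, hf, he⟩ | ⟨P, hs, ht, hf, he⟩
  · rw [h3] at hf he
    rw [h1] at hs
    obtain ⟨i', k, hi', hadj, hL⟩ := exists_isLink_src g hi h2 hs hf
    rw [hL.act_eq] at he
    exact ⟨i', k, hi', hadj, ⟨by rw [← ht, hL.tgt_eq], _, h2, he⟩, ringPos_of_eq he,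
      (hL.mem_face_iff _ h2).1 hf⟩
  · rw [h3] at he
    rw [h1] at ht
    obtain ⟨i', k, hi', hadj, hL⟩ := exists_isLink_tgt g hi h2 ht hf he.symm
    rw [← hL.act_eq] at he
    have he := act_injective (pairing_mat_mem P) he.symm
    refine ⟨i', k, hi', hadj, ⟨by rw [← hs, hL.src_eq], _, h2, he⟩, ringPos_of_eq he, ?_⟩
    rw [he] at hf
    exact (hL.mem_face_iff _ h2).1 hf

theorem quot_eq_of_wall (g : GoodRadius ε t₀) {i : ℕ} (hi : i + 1 < run w j + 4)
    {x y : TotalSpace w} (hx : x ∈ ringSet ε t₀ j hj i) (hy : y ∈ ringSet ε t₀ j hj (i + 1))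
    (h : ringPos (run w j) i x = ringPos (run w j) (i + 1) y)
    (hw : OnWall (ringWall (run w j) (i + 1)) (ringPos (run w j) i x)) :
    Quot.mk (Glue w) x = Quot.mk (Glue w) y := by
  obtain _ | n := i
  · exact Quot.sound (glue_of_isLink (isLink_slab g) hx hy h hw)
  · by_cases h1 : n + 1 ≤ run w j
    · exact Quot.sound (glue_of_isLink
        (isLink_tet g h1 (eq_L_of_pos_of_le_run w (by omega) h1)) hx hy h hw)
    · by_cases h2 : n = run w j
      · subst h2
        exact Quot.sound (glue_of_isLink (isLink_last_tet g (letter_at_run hj)) hx hy h hw)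
      · obtain rfl : n = run w j + 1 := by omega
        exact (Quot.sound (glue_of_isLink (isLink_last_slab g) hy hx h.symm (h ▸ hw))).symm

theorem exists_chart (g : GoodRadius ε t₀) :
    ∃ h : OpenPartialHomeomorph (Bundle w) (ℂ × ℝ),
      (∀ i < run w j + 4, ∀ x ∈ ringSet ε t₀ j hj i, Quot.mk (Glue w) x ∈ h.source ∧
        branchMap (turns (run w j)) (h (Quot.mk (Glue w) x)) = ringPos (run w j) i x) ∧
      (∀ x, Quot.mk (Glue w) x ∈ h.source → ∃ i < run w j + 4, x ∈ ringSet ε t₀ j hj i) := by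
  classical
  have hnear : ∀ ρ t : ℝ, 0 ≤ ρ → ρ < ε → |t - t₀| < ε → NearEdge (ρ, t) := by
    intro ρ t h0 h1 h2
    have hn : ‖(ρ : ℂ)‖ = ρ := by rw [Complex.norm_real, Real.norm_of_nonneg h0]
    have := g.nearEdge ((ρ : ℂ), t) ⟨by simp only [hn]; exact h1, h2⟩
    simpa only [hn] using this
  have h0 : ((0 : ℂ), t₀) ∈ Cyl ε t₀ := ⟨by simp [g.pos], by simp [g.pos]⟩
  have hx0 : act (ringInv (run w j) 0) ((0 : ℂ), t₀) ∈ (ringCell j hj 0).idealSet := by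
    rw [act_ringInv_mem_idealSet hj g (by omega) h0]
    exact mem_wedge_of_zero rfl (ringWall_le (by omega) (g.nearEdge _ h0))
  -- Outside the i-th wedge the value is an arbitrary point on the axis in the first slab.
  let s : ℕ → ℂ × ℝ → TotalSpace w := fun i p =>
    if h : act (ringInv (run w j) i) p ∈ (ringCell j hj i).idealSet then
      ⟨ringCell j hj i, ⟨_, h⟩⟩ else ⟨ringCell j hj 0, ⟨_, hx0⟩⟩
  have hs : ∀ i < run w j + 4, ∀ p ∈ Cyl ε t₀ ∩
      Wedge (ringWall (run w j) i) (ringWall (run w j) (i + 1)),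
      ∃ h : act (ringInv (run w j) i) p ∈ (ringCell j hj i).idealSet,
        s i p = ⟨ringCell j hj i, ⟨_, h⟩⟩ := by
    intro i hi p hp
    have h := (act_ringInv_mem_idealSet hj g hi hp.1).2 hp.2
    exact ⟨h, dif_pos h⟩
  refine exists_chart_of_cyclic_wedges (Glue w) (one_le_turns (run w j)) (ringWall (run w j))
    (fun i hi => continuous_ringWall hi) (ringWall_last_eq _) (ε := ε) (t₀ := t₀)
    (fun i hi ρ t h1 h2 h3 => ringWall_lt hi (hnear ρ t h1.le h2 h3) h1)
    (fun i hi t h1 => ringWall_le hi (hnear 0 t le_rfl g.pos h1)) (ringCenter (run w j))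
    (fun i hi ρ t h1 h2 h3 => ringWall_near_center hi (hnear ρ t h1 h2 h3))
    (ringSet ε t₀ j hj) (fun i _ => isOpen_ringSet i) (ringPos (run w j))
    (fun i _ => continuousOn_ringPos i) s ?_ ?_ ?_ ?_ ?_ ?_ ?_
  · intro i hi x hx
    have hp : ringPos (run w j) i x ∈ Cyl ε t₀ ∩
      Wedge (ringWall (run w j) i) (ringWall (run w j) (i + 1)) :=
      ⟨(mem_ringSet hx).2.1, ringPos_mem_wedge g hi hx⟩
    refine ⟨hp, ?_⟩
    obtain ⟨h, e⟩ := hs i hi _ hp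
    obtain ⟨h1, -, h2, -⟩ := mem_ringSet hx
    rw [e]
    obtain ⟨c, y, hy⟩ := x
    simp only at h1 h2
    subst h1
    congr 1
    exact Subtype.ext h2.symm
  · intro i hi p hp
    obtain ⟨h, e⟩ := hs i hi _ hp
    rw [e]
    exact ⟨⟨rfl, p, hp.1, rfl⟩, ringPos_of_eq rfl⟩
  · intro i hi
    rw [continuousOn_iff_continuous_domRestrict]
    have hc : Continuous fun p : ↥(Cyl ε t₀ ∩
        Wedge (ringWall (run w j) i) (ringWall (run w j) (i + 1))) =>
        (⟨ringCell j hj i, ⟨act (ringInv (run w j) i) (p : ℂ × ℝ), (hs i hi _ p.2).choose⟩⟩ :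
          TotalSpace w) := by
      refine continuous_sigmaMk.comp (Continuous.subtype_mk ?_ _)
      exact (continuous_act (ringInv_mem _ _)).comp
        (OnePoint.continuous_coe.comp continuous_subtype_val)
    convert hc using 1
    ext1 p
    exact (hs i hi _ p.2).choose_spec
  · intro i hi i' hi' x hx hx'
    rcases lt_trichotomy i i' with h | h | h
    · exact (ringSet_disjoint_aux g h hi' hx hx').elim
    · exact h
    · exact (ringSet_disjoint_aux g h hi hx' hx).elim
  · intro i hi x hx y hxy
    obtain ⟨i', k, hi', hadj, hy, e, hw⟩ := exists_ringSet_of_glue g hi hx hxy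
    refine ⟨i', hi', hy, e, ?_⟩
    rcases hadj with ⟨h1, rfl⟩ | ⟨h1, rfl⟩ | ⟨h1, h2, rfl⟩ | ⟨h1, h2, rfl⟩
    · exact Or.inl ⟨h1, hw⟩
    · exact Or.inr (Or.inl ⟨h1, hw⟩)
    · exact Or.inr (Or.inr (Or.inl ⟨h1, h2, hw⟩))
    · exact Or.inr (Or.inr (Or.inr ⟨h1, h2, hw⟩))
  · intro i hi x hx y hy h hw
    exact quot_eq_of_wall g hi hx hy h hw
  · intro i hi x hx y hy h hw
    obtain rfl : i = run w j + 3 := by omega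
    exact (Quot.sound (glue_of_isLink isLink_bigon hy hx h.symm (h ▸ hw))).symm

/-! ### The ramification order -/

theorem coe_mem_arc_P₄_P₁ {q : ℂ × ℝ} :
    (q : Heis) ∈ arc P₄ P₁ ↔ q.1 = 1 ∧ q.2 ≤ Real.sqrt 3 := coe_mem_arc_from_infty

/-- The inverse of the inclusion of the finite points. -/
noncomputable def finChart : OpenPartialHomeomorph Heis (ℂ × ℝ) :=
  ((OnePoint.isOpenEmbedding_coe (X := ℂ × ℝ)).toOpenPartialHomeomorph _).symm

theorem coe_mem_finChart_source (p : ℂ × ℝ) : (p : Heis) ∈ finChart.source := by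
  simp [finChart]

theorem finChart_coe (p : ℂ × ℝ) : finChart p = p :=
  ((OnePoint.isOpenEmbedding_coe (X := ℂ × ℝ)).toOpenPartialHomeomorph _).left_inv
    (by simp)

theorem continuous_branchMap (N : ℕ) : Continuous (branchMap N) := by
  unfold branchMap; fun_prop

theorem branchMap_fst_eq_zero {N : ℕ} (hN : 1 ≤ N) {p q : ℂ × ℝ} (h : branchMap N p = q) :
    p.1 = 0 ↔ q.1 = 0 := by
  rw [← h, branchMap, pow_eq_zero_iff (by omega)]

theorem mem_edgeLocus_iff (g : GoodRadius ε t₀)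
    {h : OpenPartialHomeomorph (Bundle w) (ℂ × ℝ)}
    (h1 : ∀ i < run w j + 4, ∀ x ∈ ringSet ε t₀ j hj i, Quot.mk (Glue w) x ∈ h.source ∧
        branchMap (turns (run w j)) (h (Quot.mk (Glue w) x)) = ringPos (run w j) i x)
    (h2 : ∀ x, Quot.mk (Glue w) x ∈ h.source → ∃ i < run w j + 4, x ∈ ringSet ε t₀ j hj i)
    (y : Bundle w) (hy : y ∈ h.source) :
    y ∈ edgeLocus (w := w) (.slab j hj .e41) ↔ (h y).1 = 0 := by
  have hN := one_le_turns (run w j)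
  constructor
  · rintro ⟨z, hz, rfl⟩
    obtain ⟨i, hi, hx⟩ := h2 _ hy
    have e := (h1 i hi _ hx).2
    rw [branchMap_fst_eq_zero hN e]
    obtain ⟨hc, hp, hpos, -⟩ := mem_ringSet hx
    change (z : Heis) = _ at hpos
    change (z : Heis) ∈ arc P₄ P₁ at hz
    rw [hpos] at hz
    change Cell.slab j hj = _ at hc
    obtain _ | n := i
    · rw [act_ringInv_zero, act_Tinv_coe, coe_mem_arc_P₄_P₁] at hz
      exact add_eq_right.1 hz.1
    · exfalso
      by_cases hn : n ≤ run w j + 1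
      · rw [ringCell_tet hn] at hc
        cases hc
      · obtain rfl : n = run w j + 2 := by omega
        rw [act_ringInv_rot_slab, act_Tinv_coe, act_G₃_coe, coe_mem_arc_P₄_P₁] at hz
        have h3 := hz.1
        simp only at h3
        have h4 : (rotBack (run w j) (ringPos (run w j) (run w j + 3)
            (⟨_, z⟩ : TotalSpace w))).1 = om := by
          have := star_om
          have h5 := om_mul_star
          linear_combination (-star om) * h3 - this -
            ((rotBack (run w j) (ringPos (run w j) (run w j + 3)
              (⟨_, z⟩ : TotalSpace w))).1 + 1) * h5
        have h5 := (g.nearEdge _ (rotBack_mem_Cyl (n := run w j) hp)).lt_half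
        simp only at h5
        rw [h4, norm_om] at h5
        norm_num at h5
  · intro h0
    induction y using Quot.ind with
    | mk x =>
      obtain ⟨i, hi, hx⟩ := h2 _ hy
      have e := (h1 i hi _ hx).2
      rw [branchMap_fst_eq_zero hN e] at h0
      obtain ⟨-, hp, -, -⟩ := mem_ringSet hx
      obtain ⟨p, hpd⟩ : ∃ p, p = ringPos (run w j) i x := ⟨_, rfl⟩
      rw [← hpd] at e hp h0
      have hmem : act (ringInv (run w j) 0) p ∈ (ringCell j hj 0).idealSet := by
        rw [act_ringInv_mem_idealSet hj g (by omega) hp]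
        exact mem_wedge_of_zero h0 (ringWall_le (by omega) (g.nearEdge _ hp))
      have hx' : (⟨ringCell j hj 0, ⟨_, hmem⟩⟩ : TotalSpace w) ∈ ringSet ε t₀ j hj 0 :=
        ⟨rfl, p, hp, rfl⟩
      obtain ⟨hs', e'⟩ := h1 0 (by omega) _ hx'
      rw [ringPos_of_eq rfl] at e'
      refine ⟨⟨_, hmem⟩, ?_, ?_⟩
      · change act (ringInv (run w j) 0) p ∈ arc P₄ P₁
        rw [act_ringInv_zero, act_Tinv_coe, coe_mem_arc_P₄_P₁]
        have h3 := (g.nearEdge _ hp).neg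
        simp only at h3
        simp only [h0, zero_add, Complex.zero_im, mul_zero, sub_zero, true_and]
        linarith
      -- An axis point is determined by its height in the chart, so it coincides with a point of the
      -- first slab lying on the edge 41.
      · refine h.injOn hy hs' (Prod.ext ?_ ?_)
        · exact ((branchMap_fst_eq_zero hN e).2 h0).trans ((branchMap_fst_eq_zero hN e').2 h0).symm
        · have e1 := congrArg Prod.snd e
          have e2 := congrArg Prod.snd e'
          simp only [branchMap] at e1 e2
          exact e1.trans e2.symm

theorem hasRamificationOrder_edgeLocus (j : ZMod m) (hj : w j = Letter.R) :
    HasRamificationOrder (edgeLocus (w := w) (.slab j hj .e41)) (turns (run w j)) := by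
  refine ⟨one_le_turns _, ?_⟩
  rintro x ⟨⟨Y, hYmem⟩, hY, rfl⟩
  obtain ⟨q, rfl⟩ : ∃ q : ℂ × ℝ, (q : Heis) = Y :=
    OnePoint.ne_infty_iff_exists.1 fun h => hYmem.2 (Or.inr (Or.inr h))
  change (q : Heis) ∈ arc P₄ P₁ at hY
  rw [coe_mem_arc_P₄_P₁] at hY
  have hlt : q.2 < Real.sqrt 3 := by
    refine lt_of_le_of_ne hY.2 fun h => hYmem.2 (Or.inl ?_)
    change (q : Heis) = (((1 : ℂ), Real.sqrt 3) : ℂ × ℝ)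
    rw [← h, ← hY.1]
  -- `Tinv` raises heights on the axis by √3, so the base height is q.2 - √3; it is negative because
  -- P₁ has been removed.
  obtain ⟨ε, g⟩ := exists_goodRadius (sub_neg.2 hlt)
  obtain ⟨h, h1, h2⟩ := exists_chart (hj := hj) g
  have hsrc : ∀ i < run w j + 4, ∀ x ∈ ringSet ε (q.2 - Real.sqrt 3) j hj i,
      (branchMap (turns (run w j)) (h (Quot.mk (Glue w) x)) : Heis) =
        act (ringDev (run w j) i) x.2 := by
    intro i hi x hx
    rw [(h1 i hi x hx).2, (mem_ringSet hx).2.2.2]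
  -- The chart of the structure is the developed position itself: on the i-th cell it is the action
  -- of `ringDev`, an element of U(2,1).
  refine ⟨fun y => (branchMap (turns (run w j)) (h y) : ℂ × ℝ), h, finChart, ?_, ⟨?_, ?_⟩, ?_, ?_,
    mem_edgeLocus_iff g h1 h2⟩
  · refine (h1 0 (by omega) _ ⟨rfl, (0, q.2 - Real.sqrt 3), ⟨by simp [g.pos], by simp [g.pos]⟩,
      ?_⟩).1
    rw [act_ringInv_zero, act_Tinv_coe]
    change ((q : ℂ × ℝ) : Heis) = _
    refine congrArg _ (Prod.ext ?_ ?_)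
    · simp [hY.1]
    · simp
  · exact (OnePoint.continuous_coe.comp (continuous_branchMap _)).comp_continuousOn h.continuousOn
  · intro c y hy
    obtain ⟨i, hi, hmem⟩ := h2 _ hy
    refine ⟨_, ringDev_mem (run w j) i, ?_⟩
    have hcont : Continuous fun y : c.idealSet => (⟨c, y⟩ : TotalSpace w) :=
      continuous_sigmaMk (σ := fun c : Cell w => c.idealSet)
    filter_upwards [hcont.continuousAt.eventually_mem ((isOpen_ringSet i).mem_nhds hmem)]
      with y' hy'
    exact hsrc i hi _ hy'
  · intro y hy
    exact coe_mem_finChart_source _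
  · intro y hy
    exact finChart_coe _

end Chart

end CRBundle

theorem mainTheorem6
    (f : Matrix.SpecialLinearGroup (Fin 2) ℤ) (hf : CRBundle.HasDistinctPositiveEigenvalues f)
    (m : ℕ) [NeZero m] (w : ZMod m → CRBundle.Letter) (hw : CRBundle.IsFlipSequence f w)
    (j : ZMod m) (hj : w j = CRBundle.Letter.R) :
    ∃ n : ℕ, CRBundle.valence w (.slab j hj .e41) = n + 4 ∧
      CRBundle.HasRamificationOrder (CRBundle.edgeLocus (w := w) (.slab j hj .e41))
        ⌈((n : ℚ) + 5) / 6⌉₊ := by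
  refine ⟨CRBundle.run w j, CRBundle.valence_slab41 w j hj, ?_⟩
  rw [CRBundle.ceil_eq_turns]
  exact CRBundle.hasRamificationOrder_edgeLocus j hj
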